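/- Let $(M,g)$ be an $(n+1)$-dimensional spacetime: a smooth, Hausdorff, second countable manifold without boundary (not necessarily connected) with a smooth Lorentzian metric of signature $(-,+,\dots,+)$ and a time orientation. Let $\operatorname{vol}_g$ be its volume measure ($\sqrt{|\det g_{ij}|}\,dx$ in charts), let $I^+(x)$ be the chronological future of $x$, that is, the set of end points of future-directed timelike curves starting at $x$, and let $$\mathcal B := \{x \in M \mid \operatorname{vol}_g(I^+(x)) < \infty\}.$$ Timelike and causal curves are piecewise $C^1$ with timelike, respectively causal (timelike or null, nonzero), one-sided velocities everywhere. A causal curve $\gamma\colon[0,b)\to M$, $0<b\le\infty$, is future-inextendible if $\gamma(s)$ has no limit in $M$ as $s \to b$. A region $U\subseteq M$ is globally hyperbolic if, with respect to causal curves contained in $U$, it is strongly causal (for each $p \in U$, every neighbourhood $W$ of $p$ contains a neighbourhood $V$ of $p$ such that each causal curve in $U$ with both end points in $V$ stays in $W$) and the causal diamonds $J_U^+(p)\cap J_U^-(q)$, $p,q\in U$, are compact. Consider the conditions: 1. For every future-inextendible future-directed causal curve $\gamma\colon[0,b)\to M$ whose starting point $x=\gamma(0)$ satisfies $\operatorname{vol}_g(I^+(x))<\infty$,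 we have $\lim_{s\to b}\operatorname{vol}_g\big(I^+(\gamma(s))\big)=0$. 2. The region $\mathcal B$ is globally hyperbolic. If $\mathcal B$ is open (so that it is a spacetime in its own right), then 1 and 2 are equivalent. Moreover, without assuming that $\mathcal B$ is open, 2 implies 1, and 1 implies that the interior of $\mathcal B$ is globally hyperbolic. -/

import Mathlib

open scoped Manifold ContDiff Topology
open Set Filter MeasureTheory

noncomputable section

/-- An `(n+1)`-dimensional spacetime structure on a smooth manifold `M` without boundary: a smooth
Lorentzian metric of signature `(-, +, …, +)` together with a time orientation, given by a
continuous timelike vector field. -/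
structure Spacetime (n : ℕ) (M : Type*) [TopologicalSpace M]
    [ChartedSpace (EuclideanSpace ℝ (Fin (n + 1))) M] [IsManifold (𝓡 (n + 1)) ∞ M] where
  /-- The metric tensor. -/
  metric : ∀ x : M, TangentSpace (𝓡 (n + 1)) x →L[ℝ] TangentSpace (𝓡 (n + 1)) x →L[ℝ] ℝ
  metric_symm : ∀ (x : M) (v w : TangentSpace (𝓡 (n + 1)) x), metric x v w = metric x w v
  /-- The field of future-directed timelike vectors that fixes the time orientation. -/
  timeField : ∀ x : M, TangentSpace (𝓡 (n + 1)) x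
  timeField_timelike : ∀ x : M, metric x (timeField x) (timeField x) < 0
  /-- The metric has exactly one negative direction: it is positive definite on the orthogonal
  complement of a timelike vector. -/
  metric_pos : ∀ (x : M) (v : TangentSpace (𝓡 (n + 1)) x),
    metric x (timeField x) v = 0 → v ≠ 0 → 0 < metric x v v
  metric_smooth : ContMDiff (𝓡 (n + 1))
    ((𝓡 (n + 1)).prod 𝓘(ℝ, EuclideanSpace ℝ (Fin (n + 1)) →L[ℝ]
      EuclideanSpace ℝ (Fin (n + 1)) →L[ℝ] ℝ)) ∞
    (fun x : M ↦ Bundle.TotalSpace.mk' (EuclideanSpace ℝ (Fin (n + 1)) →L[ℝ]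
      EuclideanSpace ℝ (Fin (n + 1)) →L[ℝ] ℝ) x (metric x))
  timeField_continuous : Continuous
    (fun x : M ↦ (⟨x, timeField x⟩ : TangentBundle (𝓡 (n + 1)) M))

namespace Spacetime

variable {n : ℕ} {M : Type*} [TopologicalSpace M]
  [ChartedSpace (EuclideanSpace ℝ (Fin (n + 1))) M] [IsManifold (𝓡 (n + 1)) ∞ M]

/-- Future-directed timelike tangent vectors. -/
def FutureTimelike (g : Spacetime n M) (x : M) (v : TangentSpace (𝓡 (n + 1)) x) : Prop :=
  g.metric x v v < 0 ∧ g.metric x v (g.timeField x) < 0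

/-- Future-directed causal (timelike or null, nonzero) tangent vectors. -/
def FutureCausal (g : Spacetime n M) (x : M) (v : TangentSpace (𝓡 (n + 1)) x) : Prop :=
  v ≠ 0 ∧ g.metric x v v ≤ 0 ∧ g.metric x v (g.timeField x) < 0

end Spacetime

/-- `γ` is, on the interval `s`, a continuous and piecewise `C¹` curve all of whose velocities
(at a break point: both one-sided velocities) satisfy `P`. The set `D` of break points has only
finitely many elements in every compact subinterval of `s`; between break points `γ` is `C¹` up
to and including the ends. -/
def PiecewiseC1With {n : ℕ} {M : Type*} [TopologicalSpace M]
    [ChartedSpace (EuclideanSpace ℝ (Fin (n + 1))) M]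
    (P : ∀ x : M, TangentSpace (𝓡 (n + 1)) x → Prop) (γ : ℝ → M) (s : Set ℝ) : Prop :=
  ContinuousOn γ s ∧ ∃ D : Set ℝ,
    (∀ c d : ℝ, Icc c d ⊆ s → (D ∩ Icc c d).Finite) ∧
    ∀ c d : ℝ, c < d → Icc c d ⊆ s → Disjoint D (Ioo c d) →
      ContMDiffOn 𝓘(ℝ, ℝ) (𝓡 (n + 1)) 1 γ (Icc c d) ∧
      ∀ t ∈ Icc c d, P (γ t) (mfderivWithin 𝓘(ℝ, ℝ) (𝓡 (n + 1)) γ (Icc c d) t (1 : ℝ))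

namespace Spacetime

variable {n : ℕ} {M : Type*} [TopologicalSpace M]
  [ChartedSpace (EuclideanSpace ℝ (Fin (n + 1))) M] [IsManifold (𝓡 (n + 1)) ∞ M]

/-- `γ` restricted to the interval `s` is a future-directed timelike curve. -/
def IsTimelikeCurve (g : Spacetime n M) (γ : ℝ → M) (s : Set ℝ) : Prop :=
  PiecewiseC1With g.FutureTimelike γ s

/-- `γ` restricted to the interval `s` is a future-directed causal curve. -/
def IsCausalCurve (g : Spacetime n M) (γ : ℝ → M) (s : Set ℝ) : Prop :=
  PiecewiseC1With g.FutureCausal γ s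

/-- The chronological future `I⁺(x)`. -/
def chronFuture (g : Spacetime n M) (x : M) : Set M :=
  {y | ∃ γ : ℝ → M, g.IsTimelikeCurve γ (Icc 0 1) ∧ γ 0 = x ∧ γ 1 = y}

/-- `q` lies in the causal future of `p` in the region `U`: either `p = q`, or a future-directed
causal curve inside `U` runs from `p` to `q`. -/
def CausalLE (g : Spacetime n M) (U : Set M) (p q : M) : Prop :=
  (p = q ∧ p ∈ U) ∨
    ∃ γ : ℝ → M, g.IsCausalCurve γ (Icc 0 1) ∧ MapsTo γ (Icc 0 1) U ∧ γ 0 = p ∧ γ 1 = q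

/-- Strong causality of the region `U`, with its own causal curves: every neighbourhood `W` of a
point contains a neighbourhood `V` such that causal curves in `U` with both ends in `V` stay
in `W`. -/
def StronglyCausalOn (g : Spacetime n M) (U : Set M) : Prop :=
  ∀ p ∈ U, ∀ W ∈ 𝓝 p, ∃ V ∈ 𝓝 p, V ⊆ W ∧
    ∀ (γ : ℝ → M) (a b : ℝ), a ≤ b → g.IsCausalCurve γ (Icc a b) → MapsTo γ (Icc a b) U →
      γ a ∈ V → γ b ∈ V → MapsTo γ (Icc a b) W

/-- Global hyperbolicity of the region `U`, as a spacetime in its own right: `U` is strongly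
causal and its causal diamonds `J⁺(p) ∩ J⁻(q)` are compact. -/
def GloballyHyperbolicOn (g : Spacetime n M) (U : Set M) : Prop :=
  g.StronglyCausalOn U ∧
    ∀ p ∈ U, ∀ q ∈ U, IsCompact {x : M | g.CausalLE U p x ∧ g.CausalLE U x q}

/-- The parameter interval `[0, b)`, where `b` may be `∞`. -/
def paramInterval (b : EReal) : Set ℝ := {s : ℝ | 0 ≤ s ∧ (s : EReal) < b}

/-- The filter `s → b` (from below) on the real parameters, where `b` may be `∞`. -/
def towards (b : EReal) : Filter ℝ := comap (fun s : ℝ ↦ (s : EReal)) (𝓝[<] b)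

/-- `γ : [0, b) → M` is a future-directed causal curve without future endpoint. -/
def IsFutureInextendible (g : Spacetime n M) (γ : ℝ → M) (b : EReal) : Prop :=
  g.IsCausalCurve γ (paramInterval b) ∧ ¬ ∃ p : M, Tendsto γ (towards b) (𝓝 p)

/-- The coefficients `g_{ij}(z) = g(∂_i, ∂_j)` of the metric at the point with coordinates `z` in
the preferred chart around `x`. -/
def gram (g : Spacetime n M) (x : M) (z : EuclideanSpace ℝ (Fin (n + 1))) :
    Matrix (Fin (n + 1)) (Fin (n + 1)) ℝ :=
  Matrix.of fun i j ↦
    g.metric ((chartAt (EuclideanSpace ℝ (Fin (n + 1))) x).symm z)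
      (mfderiv (𝓡 (n + 1)) (𝓡 (n + 1)) (chartAt (EuclideanSpace ℝ (Fin (n + 1))) x).symm z
        (EuclideanSpace.single i (1 : ℝ)))
      (mfderiv (𝓡 (n + 1)) (𝓡 (n + 1)) (chartAt (EuclideanSpace ℝ (Fin (n + 1))) x).symm z
        (EuclideanSpace.single j (1 : ℝ)))

/-- The volume measure on the domain of the preferred chart around `x`, extended by zero to `M`:
in coordinates it is `√|det g_{ij}| dz`. -/
def chartVol [MeasurableSpace M] [BorelSpace M] (g : Spacetime n M) (x : M) : Measure M :=
  Measure.map (chartAt (EuclideanSpace ℝ (Fin (n + 1))) x).symm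
    ((volume.restrict (chartAt (EuclideanSpace ℝ (Fin (n + 1))) x).target).withDensity
      fun z ↦ ENNReal.ofReal √|(g.gram x z).det|)

/-- The volume measure `vol_g` of the spacetime. The measures `chartVol x` agree on overlaps of
charts, so their least upper bound is the measure on `M` that restricts to each of them (`M` being
second countable). -/
def vol [MeasurableSpace M] [BorelSpace M] (g : Spacetime n M) : Measure M :=
  ⨆ x : M, g.chartVol x

/-- The region `𝓑` of the points whose chronological future has finite volume. -/
def finiteFutureRegion [MeasurableSpace M] [BorelSpace M] (g : Spacetime n M) : Set M :=
  {x | g.vol (g.chronFuture x) < ⊤}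

/-- Along every future-inextendible future-directed causal curve `γ : [0, b) → M` that starts at a
point whose chronological future has finite volume, the volume of `I⁺(γ(s))` tends to `0` as
`s → b`. -/
def FutureVolumeVanishes [MeasurableSpace M] [BorelSpace M] (g : Spacetime n M) : Prop :=
  ∀ (b : EReal) (γ : ℝ → M), 0 < b → g.IsFutureInextendible γ b →
    g.vol (g.chronFuture (γ 0)) < ⊤ →
      Tendsto (fun s : ℝ ↦ g.vol (g.chronFuture (γ s))) (towards b) (𝓝 0)

end Spacetime

end

/-! Hyperbolicity implies vanishing. Volumes of futures decrease along a causal curve. If they do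
not tend to zero, they are bounded below, and continuity from above of a finite measure gives a
point `q` in the future of every point of the curve. Since 𝓑 contains the causal future of each of
its points, the curve lies in a compact causal diamond of 𝓑. It therefore has a cluster point there,
and strong causality turns the cluster point into a limit, so the curve was extendible
(`futureVolumeVanishes_of_globallyHyperbolic`).

Vanishing implies hyperbolicity of the interior. The core is `FutureVolumeVanishes.exists_limit`: if
`a i` tends to a point `z` of the interior along an ultrafilter, and `a i ≤ x i ≤ q` causally, then
`x i` converges to some `w ≥ z`. Otherwise the curves from `a i` to `x i` leave a coordinate ball
around `z`, their exit points converge to some `y ≥ z`, and the argument repeats at `y`. The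
resulting causal chain has no limit. Since its points are not known to precede `q`, it is shadowed
from the past by a chronological chain in 𝓑 that comes ever closer to it; the shadow points do
precede `q`, so the volumes of their futures stay above the positive volume of the future of `q`.
This contradicts vanishing along the shadow. Two uses of this lemma give compactness of diamonds. If
strong causality failed at `p`, the exit points of the escaping curves would produce `w ≠ p` with `p
≤ w ≤ p`, and running round such a loop forever again contradicts vanishing (`causalLE_antisymm`).

The local input is that the causal relation of a small coordinate ball has limits
(`Patch.causalLE_of_tendsto`). A limit of causal curves is a priori only Lipschitz, whereas curves
here must be piecewise C¹. Either two points of the limit are chronologically related, and then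
small timelike deformations of the approximating curves (`exists_push_from`, `exists_push_to`) join
the end points by a timelike curve; or the limit is achronal, and then its difference quotients
satisfy an estimate that forces it to be C¹ (`joins_of_achronal`, `contDiffOn_one_of_slope`). -/

/-! ### Piecewise C¹ curves: restriction, reparametrization, concatenation, induction along a curve.
-/

section Curves

set_option linter.unusedSectionVars false

variable {n : ℕ} {M : Type*} [TopologicalSpace M]
  [ChartedSpace (EuclideanSpace ℝ (Fin (n + 1))) M]
  {P P' : ∀ x : M, TangentSpace (𝓡 (n + 1)) x → Prop} {γ γ' : ℝ → M}

/-- `γ` is `C¹` on `[c, d]` with all velocities satisfying `P`. -/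
def C1With (P : ∀ x : M, TangentSpace (𝓡 (n + 1)) x → Prop) (γ : ℝ → M) (c d : ℝ) : Prop :=
  ContMDiffOn 𝓘(ℝ, ℝ) (𝓡 (n + 1)) 1 γ (Icc c d) ∧
    ∀ t ∈ Icc c d, P (γ t) (mfderivWithin 𝓘(ℝ, ℝ) (𝓡 (n + 1)) γ (Icc c d) t (1 : ℝ))

theorem uniqueMDiffWithinAt_Icc_real {c d t : ℝ} (hcd : c < d) (ht : t ∈ Icc c d) :
    UniqueMDiffWithinAt 𝓘(ℝ, ℝ) (Icc c d) t :=
  (uniqueDiffOn_Icc hcd t ht).uniqueMDiffWithinAt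

theorem C1With.mono {c d c' d' : ℝ} (h : C1With P γ c d) (hc : c ≤ c') (hcd : c' < d')
    (hd : d' ≤ d) : C1With P γ c' d' := by
  have hs : Icc c' d' ⊆ Icc c d := Icc_subset_Icc hc hd
  refine ⟨h.1.mono hs, fun t ht ↦ ?_⟩
  rw [mfderivWithin_subset hs (uniqueMDiffWithinAt_Icc_real hcd ht)
    ((h.1 t (hs ht)).mdifferentiableWithinAt one_ne_zero)]
  exact h.2 t (hs ht)

theorem C1With.imp {c d : ℝ} (h : C1With P γ c d) (hP : ∀ x v, P x v → P' x v) :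
    C1With P' γ c d :=
  ⟨h.1, fun t ht ↦ hP _ _ (h.2 t ht)⟩

/-- All tangent spaces are definitionally the model space, so one `v` can be read at both base
points; this avoids casts when a curve is replaced by an equal one. -/
theorem tangentProp_congr {x y : M} (h : x = y) {v : EuclideanSpace ℝ (Fin (n + 1))}
    (hv : P x v) : P y v := by
  subst h; exact hv

theorem C1With.congr {c d : ℝ} (h : C1With P γ c d) (heq : EqOn γ' γ (Icc c d)) :
    C1With P γ' c d := by
  refine ⟨h.1.congr heq, fun t ht ↦ ?_⟩
  have := mfderivWithin_congr (I := 𝓘(ℝ, ℝ)) (I' := 𝓡 (n + 1)) heq (heq ht)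
  rw [this]
  exact tangentProp_congr (heq ht).symm (h.2 t ht)

theorem C1With.comp_affine {c d k m : ℝ} (hk : 0 < k) (hcd : c < d)
    (hP : ∀ x v (a : ℝ), 0 < a → P x v → P x (a • v))
    (h : C1With P γ (k * c + m) (k * d + m)) : C1With P (fun t ↦ γ (k * t + m)) c d := by
  have hmaps : MapsTo (fun t ↦ k * t + m) (Icc c d) (Icc (k * c + m) (k * d + m)) := by
    intro t ht
    exact ⟨by nlinarith [ht.1], by nlinarith [ht.2]⟩
  have hcd' : k * c + m < k * d + m := by nlinarith
  have haff : ContMDiffOn 𝓘(ℝ, ℝ) 𝓘(ℝ, ℝ) 1 (fun t : ℝ ↦ k * t + m) (Icc c d) := by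
    apply ContDiffOn.contMDiffOn
    fun_prop
  refine ⟨h.1.comp haff hmaps, fun t ht ↦ ?_⟩
  have hd : HasDerivWithinAt (fun t : ℝ ↦ k * t + m) k (Icc c d) t := by
    simpa using (((hasDerivAt_id t).const_mul k).add_const m).hasDerivWithinAt
  have h1 := (h.1 _ (hmaps ht)).mdifferentiableWithinAt one_ne_zero
  have := mfderivWithin_comp (I := 𝓘(ℝ, ℝ)) (I' := 𝓘(ℝ, ℝ)) (I'' := 𝓡 (n + 1)) (g := γ) t h1
    ((haff t ht).mdifferentiableWithinAt one_ne_zero) hmaps.subset_preimage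
    (uniqueMDiffWithinAt_Icc_real hcd ht)
  have h2 : mfderivWithin 𝓘(ℝ, ℝ) 𝓘(ℝ, ℝ) (fun t : ℝ ↦ k * t + m) (Icc c d) t =
      ContinuousLinearMap.toSpanSingleton ℝ k :=
    mfderivWithin_eq_fderivWithin.trans
      (hd.hasFDerivWithinAt.fderivWithin (uniqueDiffOn_Icc hcd t ht))
  change P _ (mfderivWithin 𝓘(ℝ, ℝ) (𝓡 (n + 1)) (γ ∘ fun t ↦ k * t + m) (Icc c d) t (1 : ℝ))
  rw [this]
  have h3 : ((mfderivWithin 𝓘(ℝ, ℝ) (𝓡 (n + 1)) γ (Icc (k * c + m) (k * d + m)) (k * t + m)).comp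
      (mfderivWithin 𝓘(ℝ, ℝ) 𝓘(ℝ, ℝ) (fun t : ℝ ↦ k * t + m) (Icc c d) t)) (1 : ℝ) =
      k • mfderivWithin 𝓘(ℝ, ℝ) (𝓡 (n + 1)) γ (Icc (k * c + m) (k * d + m)) (k * t + m)
        (1 : ℝ) := by
    rw [h2]
    exact (congrArg _ (mul_comm (1 : ℝ) k)).trans
      (map_smul (mfderivWithin 𝓘(ℝ, ℝ) (𝓡 (n + 1)) γ (Icc (k * c + m) (k * d + m))
        (k * t + m)) k (1 : ℝ))
  exact h3 ▸ hP _ _ _ hk (h.2 _ (hmaps ht))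

theorem PiecewiseC1With.mono {s s' : Set ℝ} (h : PiecewiseC1With P γ s) (hs : s' ⊆ s) :
    PiecewiseC1With P γ s' := by
  obtain ⟨hc, D, hD, h1⟩ := h
  exact ⟨hc.mono hs, D, fun c d hcd ↦ hD c d (hcd.trans hs),
    fun c d hlt hcd ↦ h1 c d hlt (hcd.trans hs)⟩

theorem PiecewiseC1With.imp {s : Set ℝ} (h : PiecewiseC1With P γ s)
    (hP : ∀ x v, P x v → P' x v) : PiecewiseC1With P' γ s := by
  obtain ⟨hc, D, hD, h1⟩ := h
  exact ⟨hc, D, hD, fun c d hlt hcd hdis ↦ C1With.imp (h1 c d hlt hcd hdis) hP⟩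

theorem PiecewiseC1With.congr {s : Set ℝ} (h : PiecewiseC1With P γ s) (heq : EqOn γ' γ s) :
    PiecewiseC1With P γ' s := by
  obtain ⟨hc, D, hD, h1⟩ := h
  exact ⟨hc.congr heq, D, hD,
    fun c d hlt hcd hdis ↦ C1With.congr (h1 c d hlt hcd hdis) (heq.mono hcd)⟩

theorem PiecewiseC1With.comp_affine {a b k m : ℝ} (hk : 0 < k)
    (hP : ∀ x v (a : ℝ), 0 < a → P x v → P x (a • v))
    (h : PiecewiseC1With P γ (Icc (k * a + m) (k * b + m))) :
    PiecewiseC1With P (fun t ↦ γ (k * t + m)) (Icc a b) := by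
  obtain ⟨hc, D, hD, h1⟩ := h
  have hmaps : ∀ c d, MapsTo (fun t ↦ k * t + m) (Icc c d) (Icc (k * c + m) (k * d + m)) := by
    intro c d t ht
    exact ⟨by nlinarith [ht.1], by nlinarith [ht.2]⟩
  have hsub : ∀ c d, c ≤ d → Icc c d ⊆ Icc a b →
      Icc (k * c + m) (k * d + m) ⊆ Icc (k * a + m) (k * b + m) := by
    intro c d hcd hs
    have h1 := hs (left_mem_Icc.2 hcd)
    have h2 := hs (right_mem_Icc.2 hcd)
    exact Icc_subset_Icc (by nlinarith [h1.1]) (by nlinarith [h2.2])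
  refine ⟨hc.comp (by fun_prop) (hmaps a b), (fun t ↦ k * t + m) ⁻¹' D, fun c d hs ↦ ?_,
    fun c d hlt hs hdis ↦ ?_⟩
  · rcases lt_or_ge d c with hlt | hcd
    · simp [Icc_eq_empty_of_lt hlt]
    · refine ((hD _ _ (hsub c d hcd hs)).preimage
        (f := fun t ↦ k * t + m) (fun x _ y _ hxy ↦ ?_)).subset fun t ht ↦ ⟨ht.1, hmaps c d ht.2⟩
      simpa [hk.ne'] using hxy
  · refine C1With.comp_affine hk hlt hP (h1 _ _ (by nlinarith) (hsub c d hlt.le hs) ?_)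
    rw [Set.disjoint_left] at hdis ⊢
    intro u hu hu'
    have hue : k * ((u - m) / k) + m = u := by field_simp; ring
    refine hdis (a := (u - m) / k) (by simpa [hue] using hu) ⟨?_, ?_⟩
    · rw [lt_div_iff₀ hk]; linarith [hu'.1]
    · rw [div_lt_iff₀ hk]; linarith [hu'.2]

theorem C1With.piecewise {c d : ℝ} (h : C1With P γ c d) : PiecewiseC1With P γ (Icc c d) := by
  refine ⟨h.1.continuousOn, ∅, fun _ _ _ ↦ by simp, fun a b hab hs _ ↦ ?_⟩
  exact h.mono (hs (left_mem_Icc.2 hab.le)).1 hab (hs (right_mem_Icc.2 hab.le)).2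

theorem PiecewiseC1With.of_subsingleton {s : Set ℝ} (hs : s.Subsingleton) :
    PiecewiseC1With P γ s := by
  refine ⟨hs.continuousOn _, ∅, fun _ _ _ ↦ by simp, fun a b hab hab' _ ↦ ?_⟩
  exact absurd (hs (hab' (left_mem_Icc.2 hab.le)) (hab' (right_mem_Icc.2 hab.le))) hab.ne

/-- A curve that is piecewise `C¹` on each interval between consecutive integers is so. -/
theorem PiecewiseC1With.of_int {s : Set ℝ} (hs : IsClosed s)
    (h : ∀ i : ℤ, PiecewiseC1With P γ (Icc (i : ℝ) (i + 1) ∩ s)) : PiecewiseC1With P γ s := by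
  choose hc D hD h1 using h
  -- All integers are declared break points, so an interval free of break points in its interior
  -- lies in one unit interval.
  refine ⟨?_, range ((↑) : ℤ → ℝ) ∪ ⋃ i : ℤ, D i ∩ Icc (i : ℝ) (i + 1), fun c d hcd ↦ ?_,
    fun c d hlt hcd hdis ↦ ?_⟩
  · have hU : (⋃ i : ℤ, Icc (i : ℝ) (i + 1) ∩ s) = s := by
      have : (⋃ i : ℤ, Icc (i : ℝ) (i + 1)) = univ :=
        iUnion_eq_univ_iff.2 fun t ↦ ⟨⌊t⌋, Int.floor_le t, (Int.lt_floor_add_one t).le⟩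
      rw [← iUnion_inter, this, univ_inter]
    rw [← hU]
    refine LocallyFinite.continuousOn_iUnion ?_ (fun i ↦ isClosed_Icc.inter hs) hc
    intro t
    refine ⟨Ioo (t - 1) (t + 1), Ioo_mem_nhds (by linarith) (by linarith),
      (finite_Icc (⌊t⌋ - 3) (⌊t⌋ + 3)).subset ?_⟩
    rintro i ⟨u, ⟨⟨hu1, hu2⟩, -⟩, hu3, hu4⟩
    have a1 := Int.floor_le t
    have a2 := Int.lt_floor_add_one t
    constructor
    · have : (⌊t⌋ : ℝ) - 3 ≤ i := by linarith
      exact_mod_cast this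
    · have : (i : ℝ) ≤ ⌊t⌋ + 3 := by linarith
      exact_mod_cast this
  · have hfin : (⋃ i ∈ Icc ⌊c - 1⌋ ⌈d⌉, (insert (i : ℝ) (D i ∩ Icc (max c i) (min d (i + 1))))).Finite := by
      refine (finite_Icc _ _).biUnion fun i _ ↦ Finite.insert _ (hD i (max c i) (min d (i + 1)) ?_)
      intro t ht
      exact ⟨⟨(le_max_right _ _).trans ht.1, ht.2.trans (min_le_right _ _)⟩,
        hcd ⟨(le_max_left _ _).trans ht.1, ht.2.trans (min_le_left _ _)⟩⟩
    refine hfin.subset ?_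
    rintro t ⟨ht, htc, htd⟩
    have key : ∀ i : ℤ, (i : ℝ) ≤ t → t ≤ i + 1 → i ∈ Icc ⌊c - 1⌋ ⌈d⌉ := by
      intro i h1 h2
      constructor
      · have := Int.floor_le (c - 1)
        have : (⌊c - 1⌋ : ℝ) ≤ i := by linarith
        exact_mod_cast this
      · have := Int.le_ceil d
        have : (i : ℝ) ≤ ⌈d⌉ := by linarith
        exact_mod_cast this
    rcases ht with ⟨i, rfl⟩ | ht
    · exact mem_biUnion (key i le_rfl (by linarith)) (mem_insert _ _)
    · obtain ⟨i, hi⟩ := mem_iUnion.1 ht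
      refine mem_biUnion (key i hi.2.1 hi.2.2) (mem_insert_of_mem _ ⟨hi.1, ?_, ?_⟩)
      · exact max_le htc hi.2.1
      · exact le_min htd hi.2.2
  · have hle : d ≤ ⌊c⌋ + 1 := by
      by_contra! hlt'
      refine (Set.disjoint_left.1 hdis) (Or.inl ⟨⌊c⌋ + 1, rfl⟩) ⟨?_, ?_⟩
      · push_cast; exact Int.lt_floor_add_one c
      · push_cast; exact hlt'
    have hsub : Icc c d ⊆ Icc (⌊c⌋ : ℝ) (⌊c⌋ + 1) := Icc_subset_Icc (Int.floor_le c) hle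
    refine h1 ⌊c⌋ c d hlt (fun t ht ↦ ⟨hsub ht, hcd ht⟩) ?_
    rw [Set.disjoint_left] at hdis ⊢
    exact fun t ht ht' ↦ hdis (Or.inr (mem_iUnion.2 ⟨_, ht, hsub (Ioo_subset_Icc_self ht')⟩)) ht'

/-- Transitive local relations on an interval are global. -/
theorem interval_induction {a b : ℝ} (hab : a ≤ b) {Q : ℝ → ℝ → Prop}
    (hrefl : ∀ t ∈ Icc a b, Q t t)
    (htrans : ∀ r s t, a ≤ r → r ≤ s → s ≤ t → t ≤ b → Q r s → Q s t → Q r t)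
    (hloc : ∀ t ∈ Icc a b, ∃ ε > 0, ∀ c d, a ≤ c → c < d → d ≤ b → t - ε < c → d < t + ε →
      (t = c ∨ t = d) → Q c d) : Q a b := by
  set S : Set ℝ := {t | t ∈ Icc a b ∧ Q a t} with hS
  have haS : a ∈ S := ⟨left_mem_Icc.2 hab, hrefl a (left_mem_Icc.2 hab)⟩
  have hbdd : BddAbove S := ⟨b, fun t ht ↦ ht.1.2⟩
  have hx : sSup S ∈ Icc a b := ⟨le_csSup hbdd haS, csSup_le ⟨a, haS⟩ fun t ht ↦ ht.1.2⟩
  set x := sSup S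
  obtain ⟨ε, hε, hl⟩ := hloc x hx
  have hQx : Q a x := by
    obtain ⟨t, ht, hxt⟩ := exists_lt_of_lt_csSup ⟨a, haS⟩ (show x - ε < sSup S by grind)
    have htx : t ≤ x := le_csSup hbdd ht
    rcases htx.eq_or_lt with rfl | hlt
    · exact ht.2
    · exact htrans a t x le_rfl ht.1.1 htx hx.2 ht.2
        (hl t x ht.1.1 hlt hx.2 hxt (by linarith) (Or.inr rfl))
  rcases hx.2.eq_or_lt with h | hlt
  · exact h ▸ hQx
  · exfalso
    have h1 : x < min b (x + ε / 2) := lt_min hlt (by linarith)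
    have h2 : min b (x + ε / 2) ∈ S := by
      refine ⟨⟨hx.1.trans h1.le, min_le_left _ _⟩, ?_⟩
      refine htrans a x _ le_rfl hx.1 h1.le (min_le_left _ _) hQx
        (hl x _ hx.1 h1 (min_le_left _ _) (by linarith) ?_ (Or.inl rfl))
      exact (min_le_right _ _).trans_lt (by linarith)
    exact absurd (le_csSup hbdd h2) (not_le.2 h1)

/-- Break points are locally finite, so close to `t` the only possible one is `t` itself. Intervals
having `t` as an end point are therefore C¹, even if `t` is a break. -/
theorem PiecewiseC1With.exists_pieces {a b t : ℝ} (h : PiecewiseC1With P γ (Icc a b))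
    (ht : t ∈ Icc a b) {W : Set M} (hW : W ∈ 𝓝 (γ t)) :
    ∃ ε > 0, ∀ c d, a ≤ c → c < d → d ≤ b → t - ε < c → d < t + ε → (t = c ∨ t = d) →
      C1With P γ c d ∧ MapsTo γ (Icc c d) W := by
  obtain ⟨hc, D, hD, h1⟩ := h
  have hfin := hD a b subset_rfl
  have hcl : ((D ∩ Icc a b) \ {t})ᶜ ∈ 𝓝 t :=
    ((hfin.subset sdiff_subset).isClosed.isOpen_compl).mem_nhds (by simp)
  obtain ⟨ε₁, hε₁, hb₁⟩ := Metric.mem_nhds_iff.1 hcl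
  obtain ⟨ε₂, hε₂, hb₂⟩ := Metric.mem_nhdsWithin_iff.1 (hc t ht hW)
  refine ⟨min ε₁ ε₂, lt_min hε₁ hε₂, fun c d hac hcd hdb hct hdt htcd ↦ ?_⟩
  have hball : ∀ u ∈ Icc c d, |u - t| < min ε₁ ε₂ := by
    intro u hu
    rw [abs_lt]
    constructor <;> linarith [hu.1, hu.2]
  have hsub : Icc c d ⊆ Icc a b := Icc_subset_Icc hac hdb
  refine ⟨h1 c d hcd hsub ?_, fun u hu ↦ hb₂ ⟨?_, hsub hu⟩⟩
  · rw [Set.disjoint_left]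
    intro u hu hu'
    have h3 := @hb₁ u (by
      rw [Metric.mem_ball, Real.dist_eq]
      exact (hball u (Ioo_subset_Icc_self hu')).trans_le (min_le_left _ _))
    refine h3 ⟨⟨hu, hsub (Ioo_subset_Icc_self hu')⟩, ?_⟩
    rcases htcd with rfl | rfl
    · exact hu'.1.ne'
    · exact hu'.2.ne
  · rw [Metric.mem_ball, Real.dist_eq]
    exact (hball u hu).trans_le (min_le_right _ _)

/-- A transitive relation between parameters holds along a piecewise `C¹` curve if it holds along
short `C¹` pieces. -/
theorem PiecewiseC1With.induction {a b : ℝ} (hab : a ≤ b) (h : PiecewiseC1With P γ (Icc a b))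
    {Q : ℝ → ℝ → Prop} (hrefl : ∀ t ∈ Icc a b, Q t t)
    (htrans : ∀ r s t, a ≤ r → r ≤ s → s ≤ t → t ≤ b → Q r s → Q s t → Q r t)
    (hloc : ∀ t ∈ Icc a b, ∃ W ∈ 𝓝 (γ t), ∀ c d, a ≤ c → c < d → d ≤ b → (t = c ∨ t = d) →
      MapsTo γ (Icc c d) W → C1With P γ c d → Q c d) : Q a b := by
  refine interval_induction hab hrefl htrans fun t ht ↦ ?_
  obtain ⟨W, hW, hl⟩ := hloc t ht
  obtain ⟨ε, hε, hp⟩ := h.exists_pieces ht hW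
  refine ⟨ε, hε, fun c d hac hcd hdb hct hdt htcd ↦ ?_⟩
  obtain ⟨h1, h2⟩ := hp c d hac hcd hdb hct hdt htcd
  exact hl c d hac hcd hdb htcd h2 h1

/-- Concatenation of infinitely many curves defined on `[0, 1]`. -/
noncomputable def chainCurve (σ : ℤ → ℝ → M) (t : ℝ) : M := σ ⌊t⌋ (t - ⌊t⌋)

theorem chainCurve_int (σ : ℤ → ℝ → M) (i : ℤ) : chainCurve σ i = σ i 0 := by
  simp [chainCurve]

theorem chainCurve_eqOn {σ : ℤ → ℝ → M} {i : ℤ} (h : σ i 1 = σ (i + 1) 0) :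
    EqOn (chainCurve σ) (fun t ↦ σ i (t - i)) (Icc i (i + 1)) := by
  intro t ht
  rcases ht.2.eq_or_lt with rfl | hlt
  · have := chainCurve_int σ (i + 1)
    push_cast at this
    simp [this, h]
  · have : ⌊t⌋ = i := Int.floor_eq_iff.2 ⟨ht.1, hlt⟩
    simp [chainCurve, this]

theorem PiecewiseC1With.chainCurve {σ : ℤ → ℝ → M} {i : ℤ}
    (hP : ∀ x v (a : ℝ), 0 < a → P x v → P x (a • v)) (h : σ i 1 = σ (i + 1) 0)
    (hσ : PiecewiseC1With P (σ i) (Icc 0 1)) :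
    PiecewiseC1With P (chainCurve σ) (Icc (i : ℝ) (i + 1)) := by
  refine PiecewiseC1With.congr ?_ (chainCurve_eqOn h)
  have := PiecewiseC1With.comp_affine (P := P) (γ := σ i) (a := i) (b := i + 1) (k := 1)
    (m := -(i : ℝ)) one_pos hP (by convert hσ using 2 <;> ring)
  convert this using 3
  ring

/-- `y` can be reached from `x` by a curve in `U` with velocities in `P`. -/
def Joins (P : ∀ x : M, TangentSpace (𝓡 (n + 1)) x → Prop) (U : Set M) (x y : M) : Prop :=
  ∃ γ : ℝ → M, PiecewiseC1With P γ (Icc 0 1) ∧ MapsTo γ (Icc 0 1) U ∧ γ 0 = x ∧ γ 1 = y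

theorem Joins.of_Icc {U : Set M} {a b : ℝ} (hab : a < b)
    (hP : ∀ x v (a : ℝ), 0 < a → P x v → P x (a • v)) (h : PiecewiseC1With P γ (Icc a b))
    (hU : MapsTo γ (Icc a b) U) : Joins P U (γ a) (γ b) := by
  refine ⟨fun t ↦ γ ((b - a) * t + a), PiecewiseC1With.comp_affine (sub_pos.2 hab) hP
    (by simpa using h), fun t ht ↦ hU ⟨?_, ?_⟩, by simp, by simp⟩
  · nlinarith [ht.1, ht.2]
  · nlinarith [ht.1, ht.2]

theorem Joins.mono {U U' : Set M} {x y : M} (h : Joins P U x y) (hU : U ⊆ U') :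
    Joins P U' x y := by
  obtain ⟨γ, h1, h2, h3⟩ := h
  exact ⟨γ, h1, h2.mono_right hU, h3⟩

theorem Joins.imp {U : Set M} {x y : M} (h : Joins P U x y)
    (hP : ∀ x v, P x v → P' x v) : Joins P' U x y := by
  obtain ⟨γ, h1, h2, h3⟩ := h
  exact ⟨γ, h1.imp hP, h2, h3⟩

/-- A chain of joined points is traversed by one curve on `[0, ∞)`. -/
theorem exists_curve_of_chain {U : Set M}
    (hP : ∀ x v (a : ℝ), 0 < a → P x v → P x (a • v)) {z : ℕ → M}
    (h : ∀ i, Joins P U (z i) (z (i + 1))) :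
    ∃ γ : ℝ → M, PiecewiseC1With P γ (Ici 0) ∧ MapsTo γ (Ici 0) U ∧ ∀ i : ℕ, γ i = z i := by
  choose σ h1 h2 h3 h4 using h
  set τ : ℤ → ℝ → M := fun i ↦ σ i.toNat with hτ
  have hmatch : ∀ i : ℕ, τ i 1 = τ (i + 1) 0 := by
    intro i
    have : ((i : ℤ) + 1).toNat = i + 1 := by omega
    simp only [hτ, this]
    simp [h3, h4]
  have hcase : ∀ i : ℤ, i ≤ -1 ∨ ∃ k : ℕ, i = k := by
    intro i
    rcases lt_or_ge i 0 with hi | hi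
    · exact Or.inl (by omega)
    · exact Or.inr ⟨i.toNat, by omega⟩
  refine ⟨chainCurve τ, PiecewiseC1With.of_int isClosed_Ici fun i ↦ ?_, fun t ht ↦ ?_,
    fun i ↦ ?_⟩
  · rcases hcase i with hi | ⟨k, rfl⟩
    · have hi' : (i : ℝ) ≤ -1 := by exact_mod_cast hi
      -- Unit intervals of negative index meet `[0, ∞)` at most in the point `0`, so the values of
      -- `τ` there do not matter.
      refine PiecewiseC1With.of_subsingleton fun s hs t ht ↦ ?_
      have := hs.1.2; have := ht.1.2; have := mem_Ici.1 hs.2; have := mem_Ici.1 ht.2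
      linarith
    · refine (PiecewiseC1With.chainCurve hP (hmatch k) ?_).mono inter_subset_left
      simpa [hτ] using h1 k
  · obtain ⟨k, hk⟩ : ∃ k : ℕ, ⌊t⌋ = k := ⟨⌊t⌋.toNat, by have := Int.floor_nonneg.2 (mem_Ici.1 ht); omega⟩
    simp only [chainCurve, hk, hτ, Int.toNat_natCast]
    have a1 := Int.floor_le t
    have a2 := Int.lt_floor_add_one t
    rw [hk] at a1 a2
    exact h2 k ⟨by linarith, by linarith⟩
  · have := chainCurve_int τ i
    simpa [hτ, h3] using this

theorem Joins.trans {U : Set M} {x y w : M}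
    (hP : ∀ x v (a : ℝ), 0 < a → P x v → P x (a • v)) (h1 : Joins P U x y)
    (h2 : Joins P U y w) : Joins P U x w := by
  obtain ⟨σ₁, p1, m1, s1, e1⟩ := h1
  obtain ⟨σ₂, p2, m2, s2, e2⟩ := h2
  set τ : ℤ → ℝ → M := fun i ↦ if i ≤ 0 then σ₁ else σ₂ with hτ
  have q0 : PiecewiseC1With P (_root_.chainCurve τ) (Icc ((0 : ℤ) : ℝ) ((0 : ℤ) + 1)) :=
    PiecewiseC1With.chainCurve hP (by simp [hτ, e1, s2]) (by simpa [hτ] using p1)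
  have q1 : PiecewiseC1With P (fun t ↦ if t ≤ 1 then σ₁ t else σ₂ (t - 1)) (Icc (0 : ℝ) 2) := by
    refine PiecewiseC1With.of_int isClosed_Icc fun i ↦ ?_
    have hc : i = 0 ∨ i = 1 ∨ i ≤ -1 ∨ 2 ≤ i := by omega
    rcases hc with rfl | rfl | hi | hi
    · refine (p1.congr fun t ht ↦ ?_).mono (s := Icc 0 1) fun t ht ↦ ?_
      · simp [ht.2]
      · simpa using ht.1
    · refine (PiecewiseC1With.congr (γ := fun t ↦ σ₂ (1 * t + -1)) (PiecewiseC1With.comp_affine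
        one_pos hP (by norm_num; exact p2)) fun t ht ↦ ?_).mono (s := Icc 1 2) fun t ht ↦ ?_
      · rcases ht.1.eq_or_lt with rfl | hlt
        · simp [e1, s2]
        · simp [not_le.2 hlt, sub_eq_add_neg]
      · have := ht.1
        norm_num at this ⊢
        exact this
    · have hi' : (i : ℝ) ≤ -1 := by exact_mod_cast hi
      refine PiecewiseC1With.of_subsingleton fun s hs t ht ↦ ?_
      have := hs.1.2; have := ht.1.2; have := hs.2.1; have := ht.2.1
      linarith
    · have hi' : (2 : ℝ) ≤ i := by exact_mod_cast hi
      refine PiecewiseC1With.of_subsingleton fun s hs t ht ↦ ?_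
      have := hs.1.1; have := ht.1.1; have := hs.2.2; have := ht.2.2
      linarith
  have := Joins.of_Icc (U := U) two_pos hP q1 fun t ht ↦ ?_
  · norm_num [s1, e2] at this
    exact this
  · by_cases h : t ≤ 1
    · simp only [h, if_true]
      exact m1 ⟨ht.1, h⟩
    · simp only [h, if_false]
      exact m2 ⟨by linarith, by linarith [ht.2]⟩

end Curves

/-! ### Calculus in normed spaces: displacements in cones, and C¹ regularity from difference
quotients. -/

section Analysis

variable {E : Type*} [NormedAddCommGroup E] [NormedSpace ℝ E]

/-- The displacement is `b - a` times the average of the derivative, and averages stay in a closed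
convex set. -/
theorem sub_mem_of_derivWithin_mem [CompleteSpace E] {S : Set E} (hconv : Convex ℝ S)
    (hclosed : IsClosed S) (hcone : ∀ a : ℝ, 0 < a → ∀ x ∈ S, a • x ∈ S) {f : ℝ → E} {a b : ℝ}
    (hab : a < b) (hf : ContDiffOn ℝ 1 f (Icc a b))
    (hS : ∀ t ∈ Icc a b, derivWithin f (Icc a b) t ∈ S) : f b - f a ∈ S := by
  have hint := intervalIntegral.integral_derivWithin_Icc_of_contDiffOn_Icc hf hab.le
  have hcont : ContinuousOn (derivWithin f (Icc a b)) (Icc a b) :=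
    hf.continuousOn_derivWithin (uniqueDiffOn_Icc hab) le_rfl
  have hav : (⨍ t in Icc a b, derivWithin f (Icc a b) t) ∈ S := by
    refine hconv.set_average_mem hclosed ?_ ?_ ?_ (hcont.integrableOn_Icc)
    · simp [hab]
    · simp
    · exact (ae_restrict_iff' measurableSet_Icc).2 (ae_of_all _ hS)
  rw [setAverage_eq, integral_Icc_eq_integral_Ioc,
    ← intervalIntegral.integral_of_le hab.le, hint] at hav
  have := hcone (b - a) (sub_pos.2 hab) _ hav
  rwa [Measure.real, Real.volume_Icc, ENNReal.toReal_ofReal (sub_pos.2 hab).le, smul_smul,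
    mul_inv_cancel₀ (sub_pos.2 hab).ne', one_smul] at this

/-- `B` is, up to the constant `c`, positive definite on the kernel of `ℓ`. -/
theorem bilin_le_of_pos_on_ker {B : E →L[ℝ] E →L[ℝ] ℝ} (hsymm : ∀ v w, B v w = B w v)
    {ℓ : E →L[ℝ] ℝ} (hB : ∀ u, ℓ u = 0 → 0 ≤ B u u) (v w : E) :
    2 * (ℓ v * ℓ w) * B v w ≤ ℓ w ^ 2 * B v v + ℓ v ^ 2 * B w w := by
  -- This combination lies in the kernel of `ℓ`; expanding the form there is the reverse
  -- Cauchy–Schwarz inequality.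
  have h := hB (ℓ w • v - ℓ v • w) (by simp [mul_comm])
  simp only [map_sub, map_smul, sub_apply, smul_apply,
    smul_eq_mul, hsymm w v] at h
  nlinarith [h]

/-- The mixed term `B x y` is at most `δ * (ℓ x * ℓ y)` by the reverse Cauchy–Schwarz inequality, as
for the cone `δ = 0` of causal vectors. The slack `δ` accommodates causal vectors of neighbouring
points. -/
theorem convex_perturbed_cone {B : E →L[ℝ] E →L[ℝ] ℝ} (hsymm : ∀ v w, B v w = B w v)
    {ℓ : E →L[ℝ] ℝ} {c : ℝ} (hc : 0 < c) (hB : ∀ u, ℓ u = 0 → c * ‖u‖ ^ 2 ≤ B u u) (δ : ℝ) :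
    Convex ℝ {v : E | 0 ≤ ℓ v ∧ B v v ≤ δ * ℓ v ^ 2} := by
  have hpos : ∀ u, ℓ u = 0 → 0 ≤ B u u := fun u hu ↦ (by positivity : 0 ≤ c * ‖u‖ ^ 2).trans (hB u hu)
  have hzero : ∀ x, 0 ≤ ℓ x ∧ B x x ≤ δ * ℓ x ^ 2 → ℓ x = 0 → x = 0 := by
    intro x hx h0
    have h1 := hB x h0
    have h2 := hx.2
    rw [h0] at h2
    have h3 : ‖x‖ ^ 2 ≤ 0 := by
      by_contra! h
      nlinarith
    simpa using h3
  have hxy : ∀ x y, (0 ≤ ℓ x ∧ B x x ≤ δ * ℓ x ^ 2) → (0 ≤ ℓ y ∧ B y y ≤ δ * ℓ y ^ 2) →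
      B x y ≤ δ * (ℓ x * ℓ y) := by
    intro x y hx hy
    rcases hx.1.eq_or_lt with h | h
    · simp [hzero x hx h.symm]
    rcases hy.1.eq_or_lt with h' | h'
    · simp [hzero y hy h'.symm]
    have h1 := bilin_le_of_pos_on_ker hsymm hpos x y
    have h2 : 0 < ℓ x * ℓ y := mul_pos h h'
    have h3 : ℓ y ^ 2 * B x x ≤ ℓ y ^ 2 * (δ * ℓ x ^ 2) := by gcongr; exact hx.2
    have h4 : ℓ x ^ 2 * B y y ≤ ℓ x ^ 2 * (δ * ℓ y ^ 2) := by gcongr; exact hy.2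
    by_contra! hlt
    nlinarith [mul_lt_mul_of_pos_left hlt h2]
  intro x hx y hy a b ha hb hab
  refine ⟨?_, ?_⟩
  · have := hx.1
    have := hy.1
    simp only [map_add, map_smul, smul_eq_mul]
    positivity
  · simp only [map_add, map_smul, add_apply, smul_apply,
      smul_eq_mul, hsymm y x]
    have h1 := mul_le_mul_of_nonneg_left hx.2 (mul_nonneg ha ha)
    have h2 := mul_le_mul_of_nonneg_left hy.2 (mul_nonneg hb hb)
    have h3 := mul_le_mul_of_nonneg_left (hxy x y hx hy) (mul_nonneg ha hb)
    nlinarith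

section Slope

variable {f : ℝ → E} {A : ℝ}

/-- The slope over `[s, t]` is the weighted mean of those over `[s, m]` and `[m, t]`. As `m` is not
before the midpoint, the weight of the second piece is small enough to absorb the factor `m - s` of
the hypothesis. -/
theorem norm_slope_sub_slope_le_of_le_two {s m t : ℝ} (hsm : s < m) (hmt : m ≤ t)
    (h2 : t - s ≤ 2 * (m - s))
    (h : m < t → (m - s) * (t - m) * ‖slope f s m - slope f m t‖ ^ 2 ≤ A * (t - s) ^ 3)
    (hA : 0 ≤ A) : ‖slope f s t - slope f s m‖ ≤ √A * √(t - s) := by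
  rcases hmt.eq_or_lt with rfl | hmt
  · simp; positivity
  have e1 : slope f s t - slope f s m = ((t - m) / (t - s)) • (slope f m t - slope f s m) := by
    have h1 : t - s ≠ 0 := by linarith
    have h2 : m - s ≠ 0 := by linarith
    have h3 : t - m ≠ 0 := by linarith
    have a1 : (t - s) • slope f s t = f t - f s := by simp [slope_def_module, smul_smul, h1]
    have a2 : (m - s) • slope f s m = f m - f s := by simp [slope_def_module, smul_smul, h2]
    have a3 : (t - m) • slope f m t = f t - f m := by simp [slope_def_module, smul_smul, h3]
    apply smul_right_injective E h1
    simp only [smul_sub, smul_smul]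
    rw [show (t - s) * ((t - m) / (t - s)) = t - m by field_simp, a1, a3,
      show t - s = (t - m) + (m - s) by ring, add_smul, a2]
    abel
  rw [e1, norm_smul, Real.norm_eq_abs, abs_of_pos (div_pos (by linarith) (by linarith)),
    ← Real.sqrt_mul hA]
  apply Real.le_sqrt_of_sq_le
  have h3 := h hmt
  rw [norm_sub_rev] at h3
  set θ := ‖slope f m t - slope f s m‖
  have hp : 0 < m - s := by linarith
  have hq : 0 < t - m := by linarith
  have hr : 0 < t - s := by linarith
  rw [mul_pow, div_pow, div_mul_eq_mul_div, div_le_iff₀ (by positivity)]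
  have h4 : (t - m) ^ 2 * θ ^ 2 ≤ (m - s) * (t - m) * θ ^ 2 := by
    have : (t - m) ^ 2 ≤ (m - s) * (t - m) := by nlinarith
    exact mul_le_mul_of_nonneg_right this (sq_nonneg _)
  nlinarith

/-- Halve `[s, t]` towards `s` until `m` lies past the midpoint. The errors form a geometric series:
`√(1/2) ≤ 3/4` and `1 + 4 * (3/4) = 4` close the induction. -/
theorem norm_slope_sub_slope_left_le (hA : 0 ≤ A) {I : Set ℝ} (hI : I.OrdConnected)
    (h : ∀ s m t, s ∈ I → t ∈ I → s < m → m < t →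
      (m - s) * (t - m) * ‖slope f s m - slope f m t‖ ^ 2 ≤ A * (t - s) ^ 3) {s m t : ℝ}
    (hs : s ∈ I) (ht : t ∈ I) (hsm : s < m) (hmt : m ≤ t) :
    ‖slope f s t - slope f s m‖ ≤ 4 * √A * √(t - s) := by
  obtain ⟨k, hk⟩ : ∃ k : ℕ, t - s ≤ 2 ^ k * (m - s) := by
    obtain ⟨k, hk⟩ := pow_unbounded_of_one_lt ((t - s) / (m - s)) (one_lt_two (α := ℝ))
    exact ⟨k, by rw [div_lt_iff₀ (by linarith)] at hk; exact hk.le⟩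
  induction k generalizing t with
  | zero =>
    have : m = t := by linarith
    subst this
    simp; positivity
  | succ k ih =>
    have hA' := Real.sqrt_nonneg A
    have hB' := Real.sqrt_nonneg (t - s)
    rcases le_or_gt (t - s) (2 * (m - s)) with h2 | h2
    · refine (norm_slope_sub_slope_le_of_le_two hsm hmt h2 (h s m t hs ht hsm) hA).trans ?_
      nlinarith [mul_nonneg hA' hB']
    · have ht' : (s + t) / 2 ∈ I := hI.out hs ht ⟨by linarith, by linarith⟩
      have h3 := ih ht' (by linarith) (by rw [pow_succ] at hk; linarith)
      have h4 := norm_slope_sub_slope_le_of_le_two (f := f) (s := s) (m := (s + t) / 2) (t := t)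
        (by linarith) (by linarith) (by linarith) (h s _ t hs ht (by linarith)) hA
      have h5 : √((s + t) / 2 - s) ≤ 3 / 4 * √(t - s) := by
        rw [Real.sqrt_le_left (by positivity), mul_pow, Real.sq_sqrt (by linarith)]
        linarith
      calc ‖slope f s t - slope f s m‖
          = ‖(slope f s t - slope f s ((s + t) / 2)) + (slope f s ((s + t) / 2) - slope f s m)‖ := by
            congr 1; abel
        _ ≤ √A * √(t - s) + 4 * √A * (3 / 4 * √(t - s)) :=
            (norm_add_le _ _).trans (add_le_add h4 (h3.trans (by gcongr)))
        _ = 4 * √A * √(t - s) := by ring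

theorem norm_slope_sub_slope_right_le (hA : 0 ≤ A) {I : Set ℝ} (hI : I.OrdConnected)
    (h : ∀ s m t, s ∈ I → t ∈ I → s < m → m < t →
      (m - s) * (t - m) * ‖slope f s m - slope f m t‖ ^ 2 ≤ A * (t - s) ^ 3) {s m t : ℝ}
    (hs : s ∈ I) (ht : t ∈ I) (hsm : s ≤ m) (hmt : m < t) :
    ‖slope f s t - slope f m t‖ ≤ 4 * √A * √(t - s) := by
  have hneg : ∀ a b, slope (fun x ↦ f (-x)) a b = -slope f (-b) (-a) := by
    intro a b
    rw [slope_comm f, slope_def_module, slope_def_module,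
      show (-b - -a) = -(b - a) by ring, inv_neg, neg_smul, neg_neg]
  -- Time reversal exchanges the two end points.
  have key := norm_slope_sub_slope_left_le (f := fun x ↦ f (-x)) hA (I := (fun x : ℝ ↦ -x) ⁻¹' I)
    (hI.preimage_anti fun a b hab ↦ neg_le_neg hab) (fun a b c ha hc hab hbc ↦ ?_)
    (s := -t) (m := -m) (t := -s) (by simpa using ht) (by simpa using hs) (by linarith)
    (by linarith)
  · rw [hneg, hneg] at key
    simp only [neg_neg] at key
    rwa [neg_sub_neg, norm_sub_rev, show -s - -t = t - s by ring] at key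
  · have := h (-c) (-b) (-a) hc ha (by linarith) (by linarith)
    rw [hneg, hneg]
    rw [show (-slope f (-b) (-a) - -slope f (-c) (-b)) = slope f (-c) (-b) - slope f (-b) (-a) by
      abel]
    convert this using 1 <;> ring

theorem norm_slope_sub_slope_le (hA : 0 ≤ A) {I : Set ℝ} (hI : I.OrdConnected)
    (h : ∀ s m t, s ∈ I → t ∈ I → s < m → m < t →
      (m - s) * (t - m) * ‖slope f s m - slope f m t‖ ^ 2 ≤ A * (t - s) ^ 3) {a s t b : ℝ}
    (ha : a ∈ I) (hb : b ∈ I) (has : a ≤ s) (hst : s < t) (htb : t ≤ b) :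
    ‖slope f s t - slope f a b‖ ≤ 8 * √A * √(b - a) := by
  have h1 := norm_slope_sub_slope_left_le (f := f) hA hI h ha hb (m := t) (by linarith) htb
  have h2 := norm_slope_sub_slope_right_le (f := f) hA hI h ha
    (hI.out ha hb ⟨by linarith, htb⟩ : t ∈ I) has hst
  have h3 : √(t - a) ≤ √(b - a) := Real.sqrt_le_sqrt (by linarith)
  rw [norm_sub_rev] at h1 h2
  calc ‖slope f s t - slope f a b‖
      = ‖(slope f s t - slope f a t) + (slope f a t - slope f a b)‖ := by congr 1; abel
    _ ≤ 4 * √A * √(b - a) + 4 * √A * √(b - a) :=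
        (norm_add_le _ _).trans (add_le_add (h2.trans (by gcongr)) h1)
    _ = 8 * √A * √(b - a) := by ring

/-- A curve whose difference quotients over adjacent intervals are close is `C¹`. -/
theorem contDiffOn_one_of_slope [CompleteSpace E] {p q : ℝ} (hpq : p < q)
    (hA : 0 ≤ A) (h : ∀ s m t, s ∈ Icc p q → t ∈ Icc p q → s < m → m < t →
      (m - s) * (t - m) * ‖slope f s m - slope f m t‖ ^ 2 ≤ A * (t - s) ^ 3) :
    ContDiffOn ℝ 1 f (Icc p q) := by
  have hI : (Icc p q).OrdConnected := ordConnected_Icc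
  have hle := fun {a s t b} ↦ norm_slope_sub_slope_le (f := f) (a := a) (s := s) (t := t) (b := b)
    hA hI h
  have hle' : ∀ {a u v b : ℝ}, a ∈ Icc p q → b ∈ Icc p q → u ∈ Icc a b → v ∈ Icc a b → v ≠ u →
      ‖slope f u v - slope f a b‖ ≤ 8 * √A * √(b - a) := by
    intro a u v b ha hb hu hv hne
    rcases lt_or_gt_of_ne hne with hlt | hlt
    · rw [slope_comm]; exact hle ha hb hv.1 hlt hu.2
    · exact hle ha hb hu.1 hlt hv.2
  have hlim0 : ∀ η > 0, ∃ δ > 0, ∀ x : ℝ, x < δ → 8 * √A * √x < η := by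
    intro η hη
    have : Tendsto (fun x : ℝ ↦ 8 * √A * √x) (𝓝 0) (𝓝 (8 * √A * √0)) :=
      (Continuous.tendsto (by fun_prop) 0)
    rw [Real.sqrt_zero, mul_zero] at this
    obtain ⟨δ, hδ, hb⟩ := Metric.eventually_nhds_iff.1 (this.eventually (gt_mem_nhds hη))
    refine ⟨δ, hδ, fun x hx ↦ ?_⟩
    rcases le_or_gt x 0 with h0 | h0
    · simpa [Real.sqrt_eq_zero_of_nonpos h0] using hη
    · exact hb (by simpa [abs_of_pos h0] using hx)
  have hex : ∀ u ∈ Icc p q, ∃ d, HasDerivWithinAt f d (Icc p q) u := by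
    intro u hu
    -- All slopes from `u` to nearby points are close to the slope across one short interval around
    -- `u`, clipped to `[p, q]`.
    have : Cauchy (map (slope f u) (𝓝[Icc p q \ {u}] u)) := by
      rw [Metric.cauchy_iff]
      refine ⟨?_, fun η hη ↦ ?_⟩
      · have := ((uniqueDiffOn_Icc hpq) u hu).accPt
        rw [accPt_principal_iff_nhdsWithin] at this
        exact this.map _
      · obtain ⟨δ, hδ, hb⟩ := hlim0 (η / 2) (by linarith)
        refine ⟨slope f u '' ((Icc p q \ {u}) ∩ Ioo (u - δ / 4) (u + δ / 4)), image_mem_map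
          (inter_mem self_mem_nhdsWithin (mem_nhdsWithin_of_mem_nhds
            (Ioo_mem_nhds (by linarith) (by linarith)))), ?_⟩
        rintro _ ⟨v, ⟨⟨hv, hvu⟩, hv'⟩, rfl⟩ _ ⟨w, ⟨⟨hw, hwu⟩, hw'⟩, rfl⟩
        have ha : max p (u - δ / 4) ∈ Icc p q := ⟨le_max_left _ _, max_le hpq.le (by linarith [hu.2])⟩
        have hb' : min q (u + δ / 4) ∈ Icc p q := ⟨le_min hpq.le (by linarith [hu.1]), min_le_left _ _⟩
        have hmem : ∀ x ∈ Icc p q, x ∈ Ioo (u - δ / 4) (u + δ / 4) →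
            x ∈ Icc (max p (u - δ / 4)) (min q (u + δ / 4)) := fun x hx hx' ↦
          ⟨max_le hx.1 hx'.1.le, le_min hx.2 hx'.2.le⟩
        have hu' := hmem u hu ⟨by linarith, by linarith⟩
        have e1 := hle' ha hb' hu' (hmem v hv hv') hvu
        have e2 := hle' ha hb' hu' (hmem w hw hw') hwu
        have e3 := hb (min q (u + δ / 4) - max p (u - δ / 4)) (by
          have := min_le_right q (u + δ / 4)
          have := le_max_right p (u - δ / 4)
          linarith)
        rw [dist_eq_norm]
        calc _ ≤ _ := norm_sub_le_norm_sub_add_norm_sub _ (slope f (max p (u - δ / 4)) (min q (u + δ / 4))) _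
          _ < η := by rw [norm_sub_rev _ (slope f u w)]; linarith
    obtain ⟨d, hd⟩ := CompleteSpace.complete this
    exact ⟨d, hasDerivWithinAt_iff_tendsto_slope.2 hd⟩
  have hle'' : ∀ {a u b : ℝ}, a ∈ Icc p q → b ∈ Icc p q → a < b → u ∈ Icc a b →
      ‖derivWithin f (Icc p q) u - slope f a b‖ ≤ 8 * √A * √(b - a) := by
    intro a u b ha hb hab hu
    have hup : u ∈ Icc p q := hI.out ha hb hu
    obtain ⟨d, hd⟩ := hex u hup
    rw [hd.derivWithin (uniqueDiffOn_Icc hpq u hup)]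
    have hd' : HasDerivWithinAt f d (Icc a b) u := hd.mono (hI.out ha hb)
    have := hasDerivWithinAt_iff_tendsto_slope.1 hd'
    have hne : (𝓝[Icc a b \ {u}] u).NeBot := by
      have := ((uniqueDiffOn_Icc hab) u hu).accPt
      rwa [accPt_principal_iff_nhdsWithin] at this
    refine le_of_tendsto (this.sub_const _).norm ?_
    filter_upwards [self_mem_nhdsWithin] with v hv
    exact hle' ha hb hu hv.1 hv.2
  rw [contDiffOn_one_iff_derivWithin (uniqueDiffOn_Icc hpq)]
  refine ⟨fun u hu ↦ (hex u hu).choose_spec.differentiableWithinAt, ?_⟩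
  rw [Metric.continuousOn_iff]
  intro u hu η hη
  obtain ⟨δ, hδ, hb⟩ := hlim0 (η / 2) (by linarith)
  have main : ∀ a ∈ Icc p q, ∀ b ∈ Icc p q, a < b → b - a < δ →
      ‖derivWithin f (Icc p q) a - derivWithin f (Icc p q) b‖ < η := by
    intro a ha b hb' hab hlt
    have e1 := hle'' ha hb' hab (left_mem_Icc.2 hab.le)
    have e2 := hle'' ha hb' hab (right_mem_Icc.2 hab.le)
    have e3 := hb _ hlt
    calc _ ≤ _ := norm_sub_le_norm_sub_add_norm_sub _ (slope f a b) _
      _ < η := by rw [norm_sub_rev _ (derivWithin f (Icc p q) b)]; linarith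
  refine ⟨δ, hδ, fun v hv hvu ↦ ?_⟩
  rw [Real.dist_eq, abs_lt] at hvu
  rw [dist_eq_norm]
  rcases lt_trichotomy v u with hlt | rfl | hlt
  · exact main v hv u hu hlt (by linarith)
  · simpa using hη
  · rw [norm_sub_rev]; exact main u hu v hv hlt (by linarith)

end Slope

end Analysis

/-! ### The metric, curves and the time orientation in coordinates. -/

section Charts

set_option linter.unusedSectionVars false

variable {n : ℕ} {M : Type*} [TopologicalSpace M]
  [ChartedSpace (EuclideanSpace ℝ (Fin (n + 1))) M] [IsManifold (𝓡 (n + 1)) ∞ M]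
  {P : ∀ x : M, TangentSpace (𝓡 (n + 1)) x → Prop}

local notation "Eₙ" => EuclideanSpace ℝ (Fin (n + 1))

/-- The derivative of the inverse of the preferred chart at `p`. -/
noncomputable def chartFrame (p : M) (z : Eₙ) :
    Eₙ →L[ℝ] TangentSpace (𝓡 (n + 1)) ((chartAt Eₙ p).symm z) :=
  mfderiv (𝓡 (n + 1)) (𝓡 (n + 1)) (chartAt Eₙ p).symm z

/-- The metric in the coordinates of the preferred chart at `p`. -/
noncomputable def Spacetime.pullback (g : Spacetime n M) (p : M) (z : Eₙ) : Eₙ →L[ℝ] Eₙ →L[ℝ] ℝ :=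
  ContinuousLinearMap.bilinearComp (E := Eₙ) (F := Eₙ) (g.metric ((chartAt Eₙ p).symm z))
    (chartFrame p z) (chartFrame p z)

theorem Spacetime.pullback_apply (g : Spacetime n M) (p : M) (z v w : Eₙ) :
    g.pullback p z v w =
      g.metric ((chartAt Eₙ p).symm z) (chartFrame p z v) (chartFrame p z w) := rfl

theorem Spacetime.pullback_symm (g : Spacetime n M) (p : M) (z v w : Eₙ) :
    g.pullback p z v w = g.pullback p z w v := g.metric_symm _ _ _

theorem contMDiffOn_chartFrame (p : M) (v : Eₙ) :
    ContMDiffOn (𝓡 (n + 1)) ((𝓡 (n + 1)).prod 𝓘(ℝ, Eₙ)) ∞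
      (fun z : Eₙ ↦ Bundle.TotalSpace.mk' Eₙ (E := (TangentSpace (𝓡 (n + 1)) : M → Type _))
        ((chartAt Eₙ p).symm z) (chartFrame p z v)) (chartAt Eₙ p).target := by
  have ho := (chartAt Eₙ p).open_target
  have h1 := (contMDiffOn_chart_symm (I := 𝓡 (n + 1)) (n := ∞) (x := p)).contMDiffOn_tangentMapWithin
    (m := ∞) (by simp) ho.uniqueMDiffOn
  have h2 : ContMDiffOn (𝓡 (n + 1)) ((𝓡 (n + 1)).prod 𝓘(ℝ, Eₙ)) ∞
      (fun z : Eₙ ↦ Bundle.TotalSpace.mk' Eₙ (E := (TangentSpace (𝓡 (n + 1)) : Eₙ → Type _)) z v)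
      (chartAt Eₙ p).target :=
    contMDiffOn_vectorSpace_iff_contDiffOn.2 contDiffOn_const
  refine (h1.comp h2 fun z hz ↦ hz).congr fun z hz ↦ ?_
  simp only [Function.comp, tangentMapWithin, mfderivWithin_of_isOpen ho hz]
  rfl

theorem Spacetime.contDiffOn_pullback (g : Spacetime n M) (p : M) :
    ContDiffOn ℝ ∞ (g.pullback p) (chartAt Eₙ p).target := by
  -- In finite dimension smoothness of the form can be tested on fixed pairs of coordinate vectors.
  refine contDiffOn_clm_apply.2 fun v ↦ contDiffOn_clm_apply.2 fun w ↦ ?_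
  rw [← contMDiffOn_iff_contDiffOn]
  have h1 := contMDiffOn_chart_symm (I := 𝓡 (n + 1)) (n := ∞) (x := p)
  have : ContMDiffOn (𝓡 (n + 1)) ((𝓡 (n + 1)).prod 𝓘(ℝ)) ∞
      (fun z ↦ Bundle.TotalSpace.mk' ℝ (E := Bundle.Trivial M ℝ) ((chartAt Eₙ p).symm z)
        (g.metric ((chartAt Eₙ p).symm z) (chartFrame p z v) (chartFrame p z w)))
        (chartAt Eₙ p).target := by
    apply ContMDiffOn.clm_bundle_apply₂ (F₁ := Eₙ) (F₂ := Eₙ)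
    · exact g.metric_smooth.comp_contMDiffOn h1
    · exact contMDiffOn_chartFrame p v
    · exact contMDiffOn_chartFrame p w
  intro z hz
  have := this z hz
  simp only [Bundle.contMDiffWithinAt_totalSpace] at this
  exact this.2

theorem mfderivWithin_chart_symm_comp {p : M} {β : ℝ → Eₙ} {c d t : ℝ} (hcd : c < d)
    (ht : t ∈ Icc c d) (hβ : ContDiffOn ℝ 1 β (Icc c d)) (hz : β t ∈ (chartAt Eₙ p).target) :
    mfderivWithin 𝓘(ℝ, ℝ) (𝓡 (n + 1)) ((chartAt Eₙ p).symm ∘ β) (Icc c d) t (1 : ℝ) =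
      chartFrame p (β t) (derivWithin β (Icc c d) t) := by
  have h1 := mdifferentiableAt_atlas_symm (I := 𝓡 (n + 1)) (chart_mem_atlas Eₙ p) hz
  have h2 : MDifferentiableWithinAt 𝓘(ℝ, ℝ) (𝓡 (n + 1)) β (Icc c d) t :=
    ((hβ t ht).differentiableWithinAt one_ne_zero).mdifferentiableWithinAt
  rw [mfderiv_comp_mfderivWithin t h1 h2 (uniqueMDiffWithinAt_Icc_real hcd ht)]
  have h3 : mfderivWithin 𝓘(ℝ, ℝ) (𝓡 (n + 1)) β (Icc c d) t (1 : ℝ) = derivWithin β (Icc c d) t := by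
    rw [mfderivWithin_eq_fderivWithin]
    rfl
  exact congrArg (chartFrame p (β t)) h3

theorem C1With.of_chart {p : M} {β : ℝ → Eₙ} {c d : ℝ} (hcd : c < d)
    (hβ : ContDiffOn ℝ 1 β (Icc c d)) (hz : MapsTo β (Icc c d) (chartAt Eₙ p).target)
    (hP : ∀ t ∈ Icc c d,
      P ((chartAt Eₙ p).symm (β t)) (chartFrame p (β t) (derivWithin β (Icc c d) t))) :
    C1With P ((chartAt Eₙ p).symm ∘ β) c d := by
  refine ⟨(contMDiffOn_chart_symm (I := 𝓡 (n + 1)) (n := 1)).comp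
    (contMDiffOn_iff_contDiffOn.2 hβ) hz, fun t ht ↦ ?_⟩
  have := hP t ht
  rwa [← mfderivWithin_chart_symm_comp hcd ht hβ (hz ht)] at this

theorem C1With.to_chart {p : M} {γ : ℝ → M} {c d : ℝ} (hcd : c < d) (h : C1With P γ c d)
    (hz : MapsTo γ (Icc c d) (chartAt Eₙ p).source) :
    ContDiffOn ℝ 1 (chartAt Eₙ p ∘ γ) (Icc c d) ∧ ∀ t ∈ Icc c d,
      P ((chartAt Eₙ p).symm ((chartAt Eₙ p ∘ γ) t))
        (chartFrame p ((chartAt Eₙ p ∘ γ) t) (derivWithin (chartAt Eₙ p ∘ γ) (Icc c d) t)) := by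
  have h1 : ContDiffOn ℝ 1 (chartAt Eₙ p ∘ γ) (Icc c d) :=
    contMDiffOn_iff_contDiffOn.1 ((contMDiffOn_chart (I := 𝓡 (n + 1)) (n := 1)).comp h.1 hz)
  refine ⟨h1, fun t ht ↦ ?_⟩
  have h2 := h.congr (γ' := (chartAt Eₙ p).symm ∘ (chartAt Eₙ p ∘ γ))
    fun s hs ↦ (chartAt Eₙ p).left_inv (hz hs)
  rw [← mfderivWithin_chart_symm_comp hcd ht h1 ((chartAt Eₙ p).map_source (hz ht))]
  exact h2.2 t ht

theorem chartFrame_injective {p : M} {z : Eₙ} (hz : z ∈ (chartAt Eₙ p).target) :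
    Function.Injective (chartFrame p z) := by
  have h := (mdifferentiable_chart (I := 𝓡 (n + 1)) p).symm.mfderiv_injective (x := z) (by simpa using hz)
  exact h

/-- The time orientation in the coordinates of the preferred chart at `p`. -/
theorem Spacetime.exists_coord_timeField (g : Spacetime n M) (p : M) :
    ∃ T : Eₙ → Eₙ, ContinuousAt T (chartAt Eₙ p p) ∧ ∀ z ∈ (chartAt Eₙ p).target,
      chartFrame p z (T z) = g.timeField ((chartAt Eₙ p).symm z) := by
  refine ⟨fun z ↦ mfderiv (𝓡 (n + 1)) (𝓡 (n + 1)) (chartAt Eₙ p) ((chartAt Eₙ p).symm z)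
    (g.timeField ((chartAt Eₙ p).symm z)), ?_, fun z hz ↦ ?_⟩
  · have h1 := (FiberBundle.continuousAt_totalSpace Eₙ _).1 (g.timeField_continuous.continuousAt (x := p))
    have h2 : ContinuousAt (fun z ↦ (trivializationAt Eₙ (TangentSpace (𝓡 (n + 1))) p
        ⟨(chartAt Eₙ p).symm z, g.timeField ((chartAt Eₙ p).symm z)⟩).2) (chartAt Eₙ p p) := by
      refine ContinuousAt.comp (f := (chartAt Eₙ p).symm) (g := fun x ↦
        (trivializationAt Eₙ (TangentSpace (𝓡 (n + 1))) p ⟨x, g.timeField x⟩).2) ?_ ?_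
      · rw [(chartAt Eₙ p).left_inv (mem_chart_source _ p)]
        exact h1.2
      · exact (chartAt Eₙ p).continuousAt_symm (mem_chart_target _ p)
    refine h2.congr ?_
    filter_upwards [(chartAt Eₙ p).open_target.mem_nhds (mem_chart_target _ p)] with z hz
    have hx := (chartAt Eₙ p).map_target hz
    rw [← Bundle.Trivialization.continuousLinearMapAt_apply_of_mem (R := ℝ) _ (by simpa using hx),
      TangentBundle.continuousLinearMapAt_trivializationAt hx]
    simp [extChartAt]
    rfl
  · have h := (mdifferentiable_chart (I := 𝓡 (n + 1)) p).symm_comp_deriv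
      ((chartAt Eₙ p).map_target hz)
    rw [(chartAt Eₙ p).right_inv hz] at h
    exact DFunLike.congr_fun h (g.timeField ((chartAt Eₙ p).symm z))

end Charts

/-! ### Coordinate balls with uniform control of the light cones. -/

section Patches

set_option linter.unusedSectionVars false

variable {n : ℕ} {M : Type*} [TopologicalSpace M]
  [ChartedSpace (EuclideanSpace ℝ (Fin (n + 1))) M] [IsManifold (𝓡 (n + 1)) ∞ M]

local notation "Eₙ" => EuclideanSpace ℝ (Fin (n + 1))

/-- A coordinate ball around `p` on which the metric is close to its value at `p`: `ℓ` is a linear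
time function, `e` a timelike vector, and causal vectors stay uniformly away from `ker ℓ`. -/
structure Patch (g : Spacetime n M) (p : M) where
  ℓ : Eₙ →L[ℝ] ℝ
  e : Eₙ
  R : ℝ
  L : ℝ
  c : ℝ
  C : ℝ
  R_pos : 0 < R
  L_nonneg : 0 ≤ L
  c_pos : 0 < c
  C_pos : 0 < C
  ball_subset : Metric.closedBall (chartAt Eₙ p p) R ⊆ (chartAt Eₙ p).target
  lip : ∀ z ∈ Metric.closedBall (chartAt Eₙ p p) R, ∀ z' ∈ Metric.closedBall (chartAt Eₙ p p) R,
    ∀ v, g.pullback p z v v ≤ g.pullback p z' v v + L * ‖z - z'‖ * ‖v‖ ^ 2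
  coercive : ∀ z ∈ Metric.closedBall (chartAt Eₙ p p) R, ∀ u, ℓ u = 0 →
    c * ‖u‖ ^ 2 ≤ g.pullback p z u u
  cone : ∀ z ∈ Metric.closedBall (chartAt Eₙ p p) R, ∀ v, g.pullback p z v v ≤ 0 →
    ‖v‖ ≤ C * |ℓ v|
  ℓ_e : ℓ e = 1
  e_timelike : ∀ z ∈ Metric.closedBall (chartAt Eₙ p p) R, g.pullback p z e e ≤ -(1 / 2)
  future : ∀ z ∈ Metric.closedBall (chartAt Eₙ p p) R, ∀ v, v ≠ 0 → g.pullback p z v v ≤ 0 →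
    (g.metric ((chartAt Eₙ p).symm z) (chartFrame p z v) (g.timeField ((chartAt Eₙ p).symm z)) < 0 ↔
      0 < ℓ v)
  -- This allows displacements proportional to `ε` along `e`, for any `ε`, at a cost in the metric
  -- that is only a small fraction of `ε`.
  small : L * C ^ 2 * (2 * R * ‖ℓ‖ * ‖e‖) ≤ 1 / 4

/-- The constant is the minimum of `H` on the unit sphere; an empty sphere means that the space is
zero. -/
theorem exists_coercive_const {F : Type*} [NormedAddCommGroup F] [NormedSpace ℝ F]
    [FiniteDimensional ℝ F] {H : F → ℝ} (hc : Continuous H) (hpos : ∀ v, v ≠ 0 → 0 < H v)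
    (hhom : ∀ (a : ℝ) v, H (a • v) = a ^ 2 * H v) : ∃ c > 0, ∀ v, c * ‖v‖ ^ 2 ≤ H v := by
  have h0 : H 0 = 0 := by simpa using hhom 0 0
  rcases (Metric.sphere (0 : F) 1).eq_empty_or_nonempty with he | hne
  · refine ⟨1, one_pos, fun v ↦ ?_⟩
    rcases eq_or_ne v 0 with rfl | hv
    · simp [h0]
    · exfalso
      have : ‖v‖⁻¹ • v ∈ Metric.sphere (0 : F) 1 := by
        simp [norm_smul, norm_ne_zero_iff.2 hv]
      simp [he] at this
  · obtain ⟨w, hw, hmin⟩ := (isCompact_sphere (0 : F) 1).exists_isMinOn hne hc.continuousOn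
    have hw' : w ≠ 0 := by rintro rfl; simp at hw
    refine ⟨H w, hpos w hw', fun v ↦ ?_⟩
    rcases eq_or_ne v 0 with rfl | hv
    · simp [h0]
    · have hn : ‖v‖ ≠ 0 := norm_ne_zero_iff.2 hv
      have h1 : ‖v‖⁻¹ • v ∈ Metric.sphere (0 : F) 1 := by simp [norm_smul, hn]
      have h2 : H w ≤ H (‖v‖⁻¹ • v) := hmin h1
      rw [hhom, inv_pow, inv_mul_eq_div, le_div_iff₀ (by positivity)] at h2
      exact h2

/-- Normalize `T` to `e` and let `ℓ = -B e`. In the splitting into `ker ℓ` and the line of `e` the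
form is its positive restriction to `ker ℓ` minus `ℓ²`, so adding `2ℓ²` makes it positive definite.
-/
theorem exists_time_functional {F : Type*} [NormedAddCommGroup F] [NormedSpace ℝ F]
    [FiniteDimensional ℝ F] {B : F →L[ℝ] F →L[ℝ] ℝ} (hsymm : ∀ v w, B v w = B w v) {T : F}
    (hT : B T T < 0) (hpos : ∀ v, B T v = 0 → v ≠ 0 → 0 < B v v) :
    ∃ (ℓ : F →L[ℝ] ℝ) (e : F) (c : ℝ), ℓ e = 1 ∧ B e e = -1 ∧ 0 < ℓ T ∧ 0 < c ∧
      ∀ v, c * ‖v‖ ^ 2 ≤ B v v + 2 * ℓ v ^ 2 := by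
  set a := -B T T with ha
  have hapos : 0 < a := by linarith
  have hsa : 0 < √a := Real.sqrt_pos.2 hapos
  set e : F := (√a)⁻¹ • T with he
  have hTe : T = √a • e := by rw [he, smul_smul, mul_inv_cancel₀ hsa.ne', one_smul]
  have hee : B e e = -1 := by
    have : B T T = -a := by simp [ha]
    simp only [he, map_smul, smul_apply, smul_eq_mul, this]
    field_simp
    rw [Real.sq_sqrt hapos.le]
  set ℓ : F →L[ℝ] ℝ := -(B e) with hℓ
  have hℓa : ∀ v, ℓ v = -B e v := fun v ↦ rfl
  have hℓe : ℓ e = 1 := by rw [hℓa, hee]; norm_num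
  have hℓT : 0 < ℓ T := by
    rw [hTe, map_smul, hℓe]
    simpa using hsa
  have hker : ∀ u, ℓ u = 0 → u ≠ 0 → 0 < B u u := by
    intro u hu hne
    refine hpos u ?_ hne
    have h0 : B e u = 0 := by rw [hℓa] at hu; linarith
    rw [hTe, map_smul, smul_apply, h0, smul_zero]
  obtain ⟨c₀, hc₀, hH⟩ : ∃ c > 0, ∀ v, c * ‖v‖ ^ 2 ≤ B v v + 2 * ℓ v ^ 2 := by
    refine exists_coercive_const (H := fun v ↦ B v v + 2 * ℓ v ^ 2) (by fun_prop) (fun v hv ↦ ?_)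
      fun b v ↦ ?_
    · set u := v - ℓ v • e with hu
      have hv' : v = u + ℓ v • e := by simp [hu]
      have hℓu : ℓ u = 0 := by simp [hu, hℓe]
      have hue : B e u = 0 := by rw [hℓa] at hℓu; linarith
      have hvv : B v v = B u u - ℓ v ^ 2 := by
        conv_lhs => rw [hv']
        simp only [map_add, map_smul, add_apply, smul_apply, smul_eq_mul, hsymm u e, hue, hee]
        ring
      rcases eq_or_ne u 0 with h0 | h0
      · have : ℓ v ≠ 0 := by
          intro h
          rw [h0, h, zero_smul, add_zero] at hv'
          exact hv hv'
        rw [hvv, h0, map_zero]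
        nlinarith [sq_pos_of_ne_zero this]
      · have := hker u hℓu h0
        rw [hvv]
        nlinarith [sq_nonneg (ℓ v)]
    · simp only [map_smul, smul_apply, smul_eq_mul]
      ring
  exact ⟨ℓ, e, c₀, hℓe, hee, hℓT, hc₀, hH⟩

theorem neg_iff_pos_of_two_mul_neg {x y t : ℝ} (ht : 0 < t) (h : 2 * (x * t) * y < 0) :
    y < 0 ↔ 0 < x := by
  have h' : x * y < 0 := by
    by_contra! h6
    nlinarith [mul_nonneg h6 ht.le]
  constructor
  · intro h
    by_contra! h''
    nlinarith
  · intro h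
    by_contra! h''
    nlinarith

/-- At the centre everything follows from `exists_time_functional`; the estimates persist nearby
with half the coercivity constant, and the Lipschitz constant comes from smoothness of the metric.
-/
theorem Spacetime.exists_patch (g : Spacetime n M) (p : M) {W : Set M} (hW : W ∈ 𝓝 p) :
    ∃ Q : Patch g p, MapsTo (chartAt Eₙ p).symm (Metric.closedBall (chartAt Eₙ p p) Q.R) W := by
  set φ := chartAt Eₙ p with hφ
  set o := φ p with ho
  have hot : o ∈ φ.target := mem_chart_target _ p
  have hsymm := g.pullback_symm p
  set G := g.pullback p with hG
  obtain ⟨T, hTc, hT⟩ := g.exists_coord_timeField p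
  have hTneg : ∀ z ∈ φ.target, G z (T z) (T z) < 0 := by
    intro z hz
    rw [hG, g.pullback_apply, hT z hz]
    exact g.timeField_timelike _
  obtain ⟨ℓ, e, c₀, hℓe, hee, hℓT, hc₀, hH⟩ := exists_time_functional (hsymm o) (hTneg o hot)
    fun u hu hne ↦ by
      refine g.metric_pos _ (chartFrame p o u) ?_ fun h ↦
        hne (chartFrame_injective hot (h.trans (map_zero _).symm))
      rw [← hT o hot, ← g.pullback_apply]
      exact hu
  have hGo : ContDiffAt ℝ 1 G o :=
    ((g.contDiffOn_pullback p).contDiffAt (φ.open_target.mem_nhds hot)).of_le (by simp)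
  obtain ⟨K, t, ht, hlip⟩ := hGo.exists_lipschitzOnWith
  have hGc : ContinuousAt G o := hGo.continuousAt
  have ev : ∀ᶠ z in 𝓝 o, z ∈ φ.target ∧ φ.symm z ∈ W ∧ z ∈ t ∧ ‖G z - G o‖ < c₀ / 2 ∧
      G z e e < -(1 / 2) ∧ 0 < ℓ (T z) := by
    have e1 : ∀ᶠ z in 𝓝 o, z ∈ φ.target := IsOpen.mem_nhds φ.open_target hot
    have e2 : ∀ᶠ z in 𝓝 o, φ.symm z ∈ W := by
      have : ContinuousAt φ.symm o := φ.continuousAt_symm hot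
      refine this ?_
      rwa [ho, φ.left_inv (mem_chart_source _ p)]
    have e3 : ∀ᶠ z in 𝓝 o, z ∈ t := ht
    have e4 : ∀ᶠ z in 𝓝 o, ‖G z - G o‖ < c₀ / 2 := by
      have hK : 0 < (K : ℝ) + 1 := by positivity
      filter_upwards [ht, Metric.ball_mem_nhds o (show 0 < c₀ / 2 / (K + 1) by positivity)] with z h1 h2
      rw [mem_ball_iff_norm, lt_div_iff₀ hK] at h2
      have h3 := hlip.norm_sub_le h1 (mem_of_mem_nhds ht)
      have h4 := norm_nonneg (z - o)
      calc ‖G z - G o‖ ≤ K * ‖z - o‖ := h3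
        _ < c₀ / 2 := by linarith
    have e5 : ∀ᶠ z in 𝓝 o, G z e e < -(1 / 2) := by
      have : ContinuousAt (fun z ↦ G z e e) o :=
        (hGc.clm_apply continuousAt_const).clm_apply continuousAt_const
      refine this.eventually (gt_mem_nhds ?_)
      change G o e e < _
      rw [hee]; norm_num
    have e6 : ∀ᶠ z in 𝓝 o, 0 < ℓ (T z) :=
      (ℓ.continuous.continuousAt.comp hTc).eventually (lt_mem_nhds hℓT)
    filter_upwards [e1, e2, e3, e4, e5, e6] with z h1 h2 h3 h4 h5 h6
    exact ⟨h1, h2, h3, h4, h5, h6⟩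
  obtain ⟨R₀, hR₀, hball⟩ := Metric.nhds_basis_closedBall.mem_iff.1 ev
  have hcoer : ∀ z, ‖G z - G o‖ < c₀ / 2 → ∀ v, c₀ / 2 * ‖v‖ ^ 2 ≤ G z v v + 2 * ℓ v ^ 2 := by
    intro z hz v
    have h1 := hH v
    have h2 : |(G z - G o) v v| ≤ c₀ / 2 * ‖v‖ ^ 2 := by
      rw [pow_two, ← mul_assoc]
      exact ((G z - G o).le_opNorm₂ v v).trans (by gcongr)
    have h3 := abs_le.1 h2
    simp only [sub_apply] at h3
    linarith [h3.1]
  have hcone : ∀ z, ‖G z - G o‖ < c₀ / 2 → ∀ v, G z v v ≤ 0 → ‖v‖ ≤ √(4 / c₀) * |ℓ v| := by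
    intro z hz v hv
    have := hcoer z hz v
    rw [← Real.sqrt_sq_eq_abs, ← Real.sqrt_mul (by positivity)]
    apply Real.le_sqrt_of_sq_le
    rw [div_mul_eq_mul_div, le_div_iff₀ hc₀]
    nlinarith
  -- For `G z v v ≤ 0` coercivity reads `c₀ / 2 * ‖v‖² ≤ 2 (ℓ v)²`.
  set C := √(4 / c₀) with hC
  have hCpos : 0 < C := Real.sqrt_pos.2 (by positivity)
  set X := (K : ℝ) * C ^ 2 * (2 * ‖ℓ‖ * ‖e‖) with hX
  have hXnn : 0 ≤ X := by positivity
  set R := min R₀ (1 / (4 * (X + 1))) with hR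
  have hRpos : 0 < R := lt_min hR₀ (by positivity)
  have hsub : Metric.closedBall o R ⊆ Metric.closedBall o R₀ :=
    Metric.closedBall_subset_closedBall (min_le_left _ _)
  refine ⟨⟨ℓ, e, R, K, c₀ / 2, C, hRpos, K.2, by positivity, hCpos,
    fun z hz ↦ (hball (hsub hz)).1, fun z hz z' hz' v ↦ ?_, fun z hz u hu ↦ ?_,
    fun z hz ↦ hcone z (hball (hsub hz)).2.2.2.1, hℓe,
    fun z hz ↦ (hball (hsub hz)).2.2.2.2.1.le, fun z hz v hv hvv ↦ ?_, ?_⟩,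
    fun z hz ↦ (hball (hsub hz)).2.1⟩
  · have h1 := hlip.norm_sub_le (hball (hsub hz)).2.2.1 (hball (hsub hz')).2.2.1
    have h2 : |(G z - G z') v v| ≤ K * ‖z - z'‖ * ‖v‖ ^ 2 := by
      rw [pow_two, ← mul_assoc]
      exact ((G z - G z').le_opNorm₂ v v).trans (by gcongr)
    have h3 := abs_le.1 h2
    simp only [sub_apply] at h3
    linarith [h3.2]
  · have := hcoer z (hball (hsub hz)).2.2.2.1 u
    rw [hu] at this
    simpa using this
  · obtain ⟨hzt, -, -, hz4, -, hz6⟩ := hball (hsub hz)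
    have hℓv : ℓ v ≠ 0 := by
      intro h
      have := hcone z hz4 v hvv
      rw [h, abs_zero, mul_zero] at this
      exact hv (norm_le_zero_iff.1 this)
    rw [← hφ, ← hT z hzt, ← g.pullback_apply, ← hG]
    -- The reverse Cauchy–Schwarz inequality with the time field, on which `ℓ` is positive, ties the
    -- time orientation of `v` to the sign of `ℓ v`.
    have h1 := bilin_le_of_pos_on_ker (B := G z) (ℓ := ℓ) (hsymm z) (fun u hu ↦ by
      have := hcoer z hz4 u
      rw [hu] at this
      have h2 : 0 ≤ c₀ / 2 * ‖u‖ ^ 2 := by positivity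
      linarith) v (T z)
    have h2 := hTneg z hzt
    have h3 : 0 < ℓ v ^ 2 := by positivity
    have h4 : ℓ (T z) ^ 2 * G z v v ≤ 0 := mul_nonpos_of_nonneg_of_nonpos (sq_nonneg _) hvv
    have h5 : ℓ v ^ 2 * G z (T z) (T z) < 0 := mul_neg_of_pos_of_neg h3 h2
    exact neg_iff_pos_of_two_mul_neg hz6 (h1.trans_lt (add_neg_of_nonpos_of_neg h4 h5))
  · have h1 : R ≤ 1 / (4 * (X + 1)) := min_le_right _ _
    have h2 : (K : ℝ) * C ^ 2 * (2 * R * ‖ℓ‖ * ‖e‖) = X * R := by rw [hX]; ring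
    change (K : ℝ) * C ^ 2 * (2 * R * ‖ℓ‖ * ‖e‖) ≤ 1 / 4
    rw [h2]
    calc X * R ≤ (X + 1) * (1 / (4 * (X + 1))) := by gcongr; linarith
      _ = 1 / 4 := by field_simp

namespace Patch

variable {g : Spacetime n M} {p : M} (Q : Patch g p)

/-- The coordinate ball of radius `r` in `M`. -/
def region (_ : Patch g p) (r : ℝ) : Set M :=
  (chartAt Eₙ p).symm '' Metric.closedBall (chartAt Eₙ p p) r

theorem futureCausal_iff {z : Eₙ} (hz : z ∈ Metric.closedBall (chartAt Eₙ p p) Q.R) (v : Eₙ) :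
    g.FutureCausal ((chartAt Eₙ p).symm z) (chartFrame p z v) ↔
      v ≠ 0 ∧ g.pullback p z v v ≤ 0 ∧ 0 < Q.ℓ v := by
  have hinj := chartFrame_injective (Q.ball_subset hz)
  have h0 : chartFrame p z v = 0 ↔ v = 0 :=
    ⟨fun h ↦ hinj (h.trans (map_zero _).symm), fun h ↦ by rw [h, map_zero]⟩
  unfold Spacetime.FutureCausal
  rw [ne_eq, h0, g.pullback_apply]
  constructor
  · rintro ⟨h1, h2, h3⟩
    exact ⟨h1, h2, (Q.future z hz v h1 h2).1 h3⟩
  · rintro ⟨h1, h2, h3⟩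
    exact ⟨h1, h2, (Q.future z hz v h1 h2).2 h3⟩

theorem futureTimelike_iff {z : Eₙ} (hz : z ∈ Metric.closedBall (chartAt Eₙ p p) Q.R) (v : Eₙ) :
    g.FutureTimelike ((chartAt Eₙ p).symm z) (chartFrame p z v) ↔
      g.pullback p z v v < 0 ∧ 0 < Q.ℓ v := by
  have h0 : g.pullback p z v v < 0 → v ≠ 0 := by rintro h rfl; simp at h
  unfold Spacetime.FutureTimelike
  constructor
  · rintro ⟨h2, h3⟩
    exact ⟨h2, (Q.future z hz v (h0 h2) h2.le).1 h3⟩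
  · rintro ⟨h2, h3⟩
    exact ⟨h2, (Q.future z hz v (h0 h2) h2.le).2 h3⟩

end Patch

end Patches

/-! ### Elementary causality relations and openness of chronological futures and pasts. -/

section LocalCausality

set_option linter.unusedSectionVars false

variable {n : ℕ} {M : Type*} [TopologicalSpace M]
  [ChartedSpace (EuclideanSpace ℝ (Fin (n + 1))) M] [IsManifold (𝓡 (n + 1)) ∞ M]

local notation "Eₙ" => EuclideanSpace ℝ (Fin (n + 1))

namespace Spacetime

variable {g : Spacetime n M}

theorem FutureTimelike.smul {x : M} {v : TangentSpace (𝓡 (n + 1)) x} {a : ℝ}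
    (ha : 0 < a) (h : g.FutureTimelike x v) : g.FutureTimelike x (a • v) := by
  obtain ⟨h1, h2⟩ := h
  have e1 : g.metric x (a • v) (a • v) = a * (a * g.metric x v v) := by
    simp only [map_smul, smul_apply, smul_eq_mul]
  have e2 : g.metric x (a • v) (g.timeField x) = a * g.metric x v (g.timeField x) := by
    simp only [map_smul, smul_apply, smul_eq_mul]
  exact ⟨e1 ▸ mul_neg_of_pos_of_neg ha (mul_neg_of_pos_of_neg ha h1),
    e2 ▸ mul_neg_of_pos_of_neg ha h2⟩

theorem FutureCausal.smul {x : M} {v : TangentSpace (𝓡 (n + 1)) x} {a : ℝ}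
    (ha : 0 < a) (h : g.FutureCausal x v) : g.FutureCausal x (a • v) := by
  obtain ⟨h0, h1, h2⟩ := h
  have e1 : g.metric x (a • v) (a • v) = a * (a * g.metric x v v) := by
    simp only [map_smul, smul_apply, smul_eq_mul]
  have e2 : g.metric x (a • v) (g.timeField x) = a * g.metric x v (g.timeField x) := by
    simp only [map_smul, smul_apply, smul_eq_mul]
  exact ⟨smul_ne_zero ha.ne' h0, e1 ▸ mul_nonpos_of_nonneg_of_nonpos ha.le
    (mul_nonpos_of_nonneg_of_nonpos ha.le h1), e2 ▸ mul_neg_of_pos_of_neg ha h2⟩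

theorem FutureTimelike.causal {x : M} {v : TangentSpace (𝓡 (n + 1)) x}
    (h : g.FutureTimelike x v) : g.FutureCausal x v := by
  refine ⟨?_, h.1.le, h.2⟩
  rintro rfl
  simpa using h.1

theorem futureTimelike_smul (g : Spacetime n M) : ∀ (x : M) (v : TangentSpace (𝓡 (n + 1)) x) (a : ℝ),
    0 < a → g.FutureTimelike x v → g.FutureTimelike x (a • v) :=
  fun _ _ _ ha h ↦ h.smul ha

theorem futureCausal_smul (g : Spacetime n M) : ∀ (x : M) (v : TangentSpace (𝓡 (n + 1)) x) (a : ℝ),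
    0 < a → g.FutureCausal x v → g.FutureCausal x (a • v) :=
  fun _ _ _ ha h ↦ h.smul ha

theorem mem_chronFuture_iff {x y : M} :
    y ∈ g.chronFuture x ↔ Joins g.FutureTimelike univ x y := by
  constructor
  · rintro ⟨γ, h1, h2, h3⟩
    exact ⟨γ, h1, mapsTo_univ _ _, h2, h3⟩
  · rintro ⟨γ, h1, -, h2, h3⟩
    exact ⟨γ, h1, h2, h3⟩

theorem chronFuture_trans {x y z : M} (h1 : y ∈ g.chronFuture x) (h2 : z ∈ g.chronFuture y) :
    z ∈ g.chronFuture x :=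
  mem_chronFuture_iff.2 ((mem_chronFuture_iff.1 h1).trans g.futureTimelike_smul
    (mem_chronFuture_iff.1 h2))

theorem CausalLE.trans {U : Set M} {x y z : M} (h1 : g.CausalLE U x y) (h2 : g.CausalLE U y z) :
    g.CausalLE U x z := by
  rcases h1 with ⟨rfl, -⟩ | h1
  · exact h2
  · rcases h2 with ⟨rfl, -⟩ | h2
    · exact Or.inr h1
    · exact Or.inr (Joins.trans g.futureCausal_smul h1 h2)

theorem CausalLE.mono {U U' : Set M} {x y : M} (h : g.CausalLE U x y) (hU : U ⊆ U') :
    g.CausalLE U' x y := by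
  rcases h with ⟨h1, h2⟩ | h
  · exact Or.inl ⟨h1, hU h2⟩
  · exact Or.inr (Joins.mono h hU)

theorem joins_causal_of_mem_chronFuture {x y : M} (h : y ∈ g.chronFuture x) :
    Joins g.FutureCausal univ x y :=
  (mem_chronFuture_iff.1 h).imp fun _ _ hv ↦ FutureTimelike.causal hv

theorem mem_chronFuture_of_Icc {γ : ℝ → M} {a b : ℝ} (hab : a < b)
    (h : g.IsTimelikeCurve γ (Icc a b)) : γ b ∈ g.chronFuture (γ a) :=
  mem_chronFuture_iff.2 (Joins.of_Icc hab g.futureTimelike_smul h (mapsTo_univ _ _))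

end Spacetime

open Spacetime

namespace Patch

variable {g : Spacetime n M} {p : M} (Q : Patch g p)

theorem mem_region_iff {r : ℝ} (hr : r ≤ Q.R) {x : M} :
    x ∈ Q.region r ↔
      x ∈ (chartAt Eₙ p).source ∧ chartAt Eₙ p x ∈ Metric.closedBall (chartAt Eₙ p p) r := by
  constructor
  · rintro ⟨z, hz, rfl⟩
    have ht := Q.ball_subset (Metric.closedBall_subset_closedBall hr hz)
    exact ⟨(chartAt Eₙ p).map_target ht, by rwa [(chartAt Eₙ p).right_inv ht]⟩
  · rintro ⟨h1, h2⟩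
    exact ⟨_, h2, (chartAt Eₙ p).left_inv h1⟩

theorem isCompact_region {r : ℝ} (hr : r ≤ Q.R) : IsCompact (Q.region r) :=
  (isCompact_closedBall _ _).image_of_continuousOn ((chartAt Eₙ p).continuousOn_symm.mono
    ((Metric.closedBall_subset_closedBall hr).trans Q.ball_subset))

theorem preimage_mem_nhds {x : M} {r : ℝ} (hx : x ∈ (chartAt Eₙ p).source)
    (h : chartAt Eₙ p x ∈ Metric.ball (chartAt Eₙ p p) r) :
    (chartAt Eₙ p).source ∩ chartAt Eₙ p ⁻¹' Metric.ball (chartAt Eₙ p p) r ∈ 𝓝 x :=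
  ((chartAt Eₙ p).isOpen_inter_preimage Metric.isOpen_ball).mem_nhds ⟨hx, h⟩

theorem tendsto_symm {z : Eₙ} (hz : z ∈ Metric.closedBall (chartAt Eₙ p p) Q.R) :
    ContinuousAt (chartAt Eₙ p).symm z :=
  (chartAt Eₙ p).continuousAt_symm (Q.ball_subset hz)

/-- A `C¹` timelike curve in coordinates. -/
theorem chron_of_chart {β : ℝ → Eₙ} {c d : ℝ} (hcd : c < d) (hβ : ContDiffOn ℝ 1 β (Icc c d))
    (hz : MapsTo β (Icc c d) (Metric.closedBall (chartAt Eₙ p p) Q.R))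
    (hP : ∀ t ∈ Icc c d, g.pullback p (β t) (derivWithin β (Icc c d) t)
      (derivWithin β (Icc c d) t) < 0 ∧ 0 < Q.ℓ (derivWithin β (Icc c d) t)) :
    (chartAt Eₙ p).symm (β d) ∈ g.chronFuture ((chartAt Eₙ p).symm (β c)) :=
  mem_chronFuture_of_Icc (γ := (chartAt Eₙ p).symm ∘ β) hcd (C1With.of_chart hcd hβ
    (fun _ ht ↦ Q.ball_subset (hz ht))
    fun t ht ↦ (Q.futureTimelike_iff (hz ht) _).2 (hP t ht)).piecewise

theorem chron_of_segment {z z' : Eₙ} (hz : z ∈ Metric.closedBall (chartAt Eₙ p p) Q.R)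
    (hz' : z' ∈ Metric.closedBall (chartAt Eₙ p p) Q.R) (hℓ : 0 < Q.ℓ (z' - z))
    (hG : ∀ ζ ∈ segment ℝ z z', g.pullback p ζ (z' - z) (z' - z) < 0) :
    (chartAt Eₙ p).symm z' ∈ g.chronFuture ((chartAt Eₙ p).symm z) := by
  have hseg : ∀ t ∈ Icc (0 : ℝ) 1, z + t • (z' - z) ∈ segment ℝ z z' := fun t ht ↦
    segment_eq_image' ℝ z z' ▸ ⟨t, ht, rfl⟩
  have hd : ∀ t ∈ Icc (0 : ℝ) 1, derivWithin (fun t : ℝ ↦ z + t • (z' - z)) (Icc 0 1) t = z' - z := by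
    intro t ht
    have : HasDerivAt (fun t : ℝ ↦ z + t • (z' - z)) ((1 : ℝ) • (z' - z)) t :=
      ((hasDerivAt_id t).smul_const _).const_add z
    rw [one_smul] at this
    exact this.hasDerivWithinAt.derivWithin (uniqueDiffOn_Icc one_pos t ht)
  have := Q.chron_of_chart (β := fun t : ℝ ↦ z + t • (z' - z)) one_pos (by fun_prop)
    (fun t ht ↦ (convex_closedBall _ _).segment_subset hz hz' (hseg t ht))
    (fun t ht ↦ by rw [hd t ht]; exact ⟨hG _ (hseg t ht), hℓ⟩)
  simpa using this

/-- The straight segment is timelike: along it the form, evaluated on the displacement, changes by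
at most `Q.L * ‖z' - z‖ ^ 3`. -/
theorem chron_of_neg {z z' : Eₙ} (hz : z ∈ Metric.closedBall (chartAt Eₙ p p) Q.R)
    (hz' : z' ∈ Metric.closedBall (chartAt Eₙ p p) Q.R) (hℓ : 0 < Q.ℓ (z' - z))
    (hG : g.pullback p z (z' - z) (z' - z) + Q.L * ‖z' - z‖ ^ 3 < 0) :
    (chartAt Eₙ p).symm z' ∈ g.chronFuture ((chartAt Eₙ p).symm z) := by
  refine Q.chron_of_segment hz hz' hℓ fun ζ hζ ↦ ?_
  have h1 := Q.lip ζ ((convex_closedBall _ _).segment_subset hz hz' hζ) z hz (z' - z)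
  have h2 : ‖ζ - z‖ ≤ ‖z' - z‖ := by
    obtain ⟨t, ht, rfl⟩ := (segment_eq_image' ℝ z z') ▸ hζ
    simp only [add_sub_cancel_left, norm_smul, Real.norm_eq_abs, abs_of_nonneg ht.1]
    exact mul_le_of_le_one_left (norm_nonneg _) ht.2
  have h3 : Q.L * ‖ζ - z‖ * ‖z' - z‖ ^ 2 ≤ Q.L * ‖z' - z‖ * ‖z' - z‖ ^ 2 := by
    have := Q.L_nonneg
    gcongr
  nlinarith

/-- Near the centre, displacements close to a timelike direction are chronological. -/
theorem exists_chron_cone {v : Eₙ} (hv : g.pullback p (chartAt Eₙ p p) v v < 0) (hℓ : 0 < Q.ℓ v) :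
    ∃ δ > 0, ∀ z z' : Eₙ, ‖z - chartAt Eₙ p p‖ < δ → ‖z' - chartAt Eₙ p p‖ < δ → ∀ s > 0,
      ‖z' - z - s • v‖ < δ * s →
      (chartAt Eₙ p).symm z' ∈ g.chronFuture ((chartAt Eₙ p).symm z) := by
  set o := chartAt Eₙ p p with ho
  have hcont : ContinuousAt (fun q : Eₙ × Eₙ ↦ g.pullback p q.1 q.2 q.2) (o, v) := by
    have h1 : ContinuousAt (g.pullback p) o := ((g.contDiffOn_pullback p).continuousOn).continuousAt
      ((chartAt Eₙ p).open_target.mem_nhds (mem_chart_target _ p))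
    have h2 : ContinuousAt (fun q : Eₙ × Eₙ ↦ g.pullback p q.1) (o, v) :=
      ContinuousAt.comp (g := g.pullback p) (f := Prod.fst) h1 continuousAt_fst
    exact (h2.clm_apply continuousAt_snd).clm_apply continuousAt_snd
  have e1 := hcont.eventually (gt_mem_nhds hv)
  have e2 : ∀ᶠ q : Eₙ × Eₙ in 𝓝 (o, v), 0 < Q.ℓ q.2 :=
    (Q.ℓ.continuous.comp continuous_snd).continuousAt.eventually (lt_mem_nhds hℓ)
  obtain ⟨δ, hδ, hb⟩ := Metric.eventually_nhds_iff_ball.1 (e1.and e2)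
  refine ⟨min δ Q.R, lt_min hδ Q.R_pos, fun z z' hz hz' s hs hzz ↦ ?_⟩
  -- Being timelike is invariant under positive scaling, so the displacement is rescaled to a vector
  -- near `v`.
  have hzz' : ‖s⁻¹ • (z' - z) - v‖ < δ := by
    have h1 : s⁻¹ • (z' - z) - v = s⁻¹ • (z' - z - s • v) := by
      rw [smul_sub _ (z' - z), smul_smul, inv_mul_cancel₀ hs.ne', one_smul]
    rw [h1, norm_smul, norm_inv, Real.norm_eq_abs, abs_of_pos hs, inv_mul_lt_iff₀ hs, mul_comm]
    exact hzz.trans_le (by gcongr; exact min_le_left _ _)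
  have hmem : ∀ ζ ∈ Metric.ball o δ, g.pullback p ζ (z' - z) (z' - z) < 0 ∧ 0 < Q.ℓ (z' - z) := by
    intro ζ hζ
    have := hb (ζ, s⁻¹ • (z' - z)) (by
      rw [← ball_prod_same]
      exact ⟨hζ, by rwa [mem_ball_iff_norm]⟩)
    simp only [map_smul, smul_apply, smul_eq_mul] at this
    have hs' : 0 < s⁻¹ := inv_pos.2 hs
    constructor
    · by_contra! h
      exact absurd this.1 (not_lt.2 (by positivity))
    · exact (mul_pos_iff_of_pos_left hs').1 this.2
  have hz1 : z ∈ Metric.ball o δ := mem_ball_iff_norm.2 (hz.trans_le (min_le_left _ _))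
  have hz1' : z' ∈ Metric.ball o δ := mem_ball_iff_norm.2 (hz'.trans_le (min_le_left _ _))
  refine Q.chron_of_segment ?_ ?_ (hmem z hz1).2 fun ζ hζ ↦
    (hmem ζ ((convex_ball _ _).segment_subset hz1 hz1' hζ)).1
  · exact mem_closedBall_iff_norm.2 (hz.le.trans (min_le_right _ _))
  · exact mem_closedBall_iff_norm.2 (hz'.le.trans (min_le_right _ _))

theorem center_mem : chartAt Eₙ p p ∈ Metric.closedBall (chartAt Eₙ p p) Q.R :=
  Metric.mem_closedBall_self Q.R_pos.le

end Patch

namespace Spacetime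

variable (g : Spacetime n M)

theorem exists_mem_chronFuture_near (x : M) {W : Set M} (hW : W ∈ 𝓝 x) :
    ∃ y ∈ W, y ∈ g.chronFuture x ∧ ∃ w ∈ W, x ∈ g.chronFuture w := by
  obtain ⟨Q, hQ⟩ := g.exists_patch x hW
  obtain ⟨δ, hδ, h⟩ := Q.exists_chron_cone (v := Q.e)
    (by have := Q.e_timelike _ Q.center_mem; linarith) (by rw [Q.ℓ_e]; exact one_pos)
  set o := chartAt Eₙ x x with ho
  obtain ⟨s, hs, hs'⟩ : ∃ s > 0, s * ‖Q.e‖ < min δ Q.R := by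
    refine ⟨min δ Q.R / (2 * (‖Q.e‖ + 1)), ?_, ?_⟩
    · have := lt_min hδ Q.R_pos; positivity
    · have := lt_min hδ Q.R_pos
      rw [div_mul_eq_mul_div, div_lt_iff₀ (by positivity)]
      nlinarith [norm_nonneg Q.e]
  have hn : ‖s • Q.e‖ < min δ Q.R := by rwa [norm_smul, Real.norm_eq_abs, abs_of_pos hs]
  have hx : (chartAt Eₙ x).symm o = x := (chartAt Eₙ x).left_inv (mem_chart_source _ x)
  refine ⟨(chartAt Eₙ x).symm (o + s • Q.e), hQ ?_, ?_, (chartAt Eₙ x).symm (o - s • Q.e), hQ ?_, ?_⟩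
  · rw [mem_closedBall_iff_norm, add_sub_cancel_left]
    exact hn.le.trans (min_le_right _ _)
  · have := h o (o + s • Q.e) (by simpa using hδ) (by
      rw [add_sub_cancel_left]; exact hn.trans_le (min_le_left _ _)) s hs (by simpa using by positivity)
    rwa [hx] at this
  · rw [mem_closedBall_iff_norm, sub_sub_cancel_left, norm_neg]
    exact hn.le.trans (min_le_right _ _)
  · have := h (o - s • Q.e) o (by
      rw [sub_sub_cancel_left, norm_neg]; exact hn.trans_le (min_le_left _ _))
      (by simpa using hδ) s hs (by simpa using by positivity)
    rwa [hx] at this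

/-- Near its end the curve is approximated by its timelike left velocity `v`. From an earlier point
`γ s` the coordinate displacement to `y` is `(1 - s) • v` up to `δ / 2 * (1 - s)`, which leaves the
same margin for moving `y`. -/
theorem isOpen_chronFuture (x : M) : IsOpen (g.chronFuture x) := by
  rw [isOpen_iff_mem_nhds]
  rintro y ⟨γ, hγ, rfl, rfl⟩
  set y := γ 1 with hy
  obtain ⟨Q, -⟩ := g.exists_patch y univ_mem
  set φ := chartAt Eₙ y with hφ
  have hsrc : φ.source ∈ 𝓝 y := chart_source_mem_nhds Eₙ y
  obtain ⟨ε, hε, hp⟩ := hγ.exists_pieces (right_mem_Icc.2 zero_le_one) hsrc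
  set c := max 0 (1 - ε / 2) with hc
  have hc0 : 0 ≤ c := le_max_left _ _
  have hc1 : c < 1 := max_lt one_pos (by linarith)
  obtain ⟨h1, h2⟩ := hp c 1 hc0 hc1 le_rfl (by have := le_max_right 0 (1 - ε / 2); linarith)
    (by linarith) (Or.inr rfl)
  obtain ⟨hβ, hP⟩ := h1.to_chart hc1 h2
  have h1m : (1 : ℝ) ∈ Icc c 1 := right_mem_Icc.2 hc1.le
  obtain ⟨hv, hℓ⟩ := (Q.futureTimelike_iff Q.center_mem _).1 (hP 1 h1m)
  obtain ⟨δ, hδ, hcone⟩ := Q.exists_chron_cone hv hℓ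
  set v := derivWithin (φ ∘ γ) (Icc c 1) 1 with hvdef
  have hder : HasDerivWithinAt (φ ∘ γ) v (Icc c 1) 1 :=
    ((hβ 1 h1m).differentiableWithinAt one_ne_zero).hasDerivWithinAt
  have e1 := (hasDerivWithinAt_iff_isLittleO.1 hder).def (half_pos hδ)
  have e2 : ∀ᶠ s in 𝓝[Icc c 1] 1, ‖φ (γ s) - φ y‖ < δ := by
    have := (hβ.continuousOn 1 h1m)
    filter_upwards [this (Metric.ball_mem_nhds _ hδ)] with s hs
    exact mem_ball_iff_norm.1 hs
  have e3 : ∃ᶠ s in 𝓝[Icc c 1] (1 : ℝ), s ∈ Ioo c 1 := by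
    have : ∃ᶠ s in 𝓝[<] (1 : ℝ), s ∈ Ioo c 1 :=
      Eventually.frequently (Ioo_mem_nhdsLT hc1)
    refine this.filter_mono ?_
    rw [← nhdsWithin_Ioo_eq_nhdsLT hc1]
    exact nhdsWithin_mono _ Ioo_subset_Icc_self
  obtain ⟨s, hs, hs1, hs2⟩ := (e3.and_eventually (e1.and e2)).exists
  have hs0 : 0 < 1 - s := by linarith [hs.2]
  have hsI : s ∈ Icc c 1 := Ioo_subset_Icc_self hs
  have hxs : γ s ∈ g.chronFuture (γ 0) := mem_chronFuture_of_Icc (by linarith [hs.1])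
    (hγ.mono (Icc_subset_Icc_right hs.2.le))
  have e4 : ∀ᶠ y' in 𝓝 y, y' ∈ φ.source ∧ ‖φ y' - φ y‖ < min δ (δ / 2 * (1 - s)) := by
    refine Eventually.and hsrc ?_
    filter_upwards [(φ.continuousAt (mem_chart_source _ y))
      (Metric.ball_mem_nhds _ (show 0 < min δ (δ / 2 * (1 - s)) by positivity))] with y' hy'
    exact mem_ball_iff_norm.1 hy'
  filter_upwards [e4] with y' hy'
  refine chronFuture_trans hxs ?_
  have := hcone (φ (γ s)) (φ y') hs2 (hy'.2.trans_le (min_le_left _ _)) (1 - s) hs0 ?_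
  · rwa [φ.left_inv hy'.1, φ.left_inv (h2 hsI)] at this
  · have h5 := hy'.2.trans_le (min_le_right _ _)
    have h6 : φ y' - φ (γ s) - (1 - s) • v =
        (φ y' - φ y) - ((φ ∘ γ) s - (φ ∘ γ) 1 - (s - 1) • v) := by
      simp only [Function.comp, ← hy, sub_smul]; abel
    rw [h6]
    refine (norm_sub_le _ _).trans_lt ?_
    rw [Real.norm_eq_abs, abs_sub_comm, abs_of_pos hs0] at hs1
    linarith

/-- The argument for the future, applied to the right velocity at the starting point. -/
theorem isOpen_chronPast (y : M) : IsOpen {x | y ∈ g.chronFuture x} := by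
  rw [isOpen_iff_mem_nhds]
  rintro x ⟨γ, hγ, rfl, rfl⟩
  set x := γ 0 with hx
  obtain ⟨Q, -⟩ := g.exists_patch x univ_mem
  set φ := chartAt Eₙ x with hφ
  have hsrc : φ.source ∈ 𝓝 x := chart_source_mem_nhds Eₙ x
  obtain ⟨ε, hε, hp⟩ := hγ.exists_pieces (left_mem_Icc.2 zero_le_one) hsrc
  set d := min 1 (ε / 2) with hd
  have hd1 : d ≤ 1 := min_le_left _ _
  have hd0 : 0 < d := lt_min one_pos (by linarith)
  obtain ⟨h1, h2⟩ := hp 0 d le_rfl hd0 hd1 (by linarith)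
    (by have := min_le_right 1 (ε / 2); linarith) (Or.inl rfl)
  obtain ⟨hβ, hP⟩ := h1.to_chart hd0 h2
  have h0m : (0 : ℝ) ∈ Icc 0 d := left_mem_Icc.2 hd0.le
  obtain ⟨hv, hℓ⟩ := (Q.futureTimelike_iff Q.center_mem _).1 (hP 0 h0m)
  obtain ⟨δ, hδ, hcone⟩ := Q.exists_chron_cone hv hℓ
  set v := derivWithin (φ ∘ γ) (Icc 0 d) 0 with hvdef
  have hder : HasDerivWithinAt (φ ∘ γ) v (Icc 0 d) 0 :=
    ((hβ 0 h0m).differentiableWithinAt one_ne_zero).hasDerivWithinAt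
  have e1 := (hasDerivWithinAt_iff_isLittleO.1 hder).def (half_pos hδ)
  have e2 : ∀ᶠ s in 𝓝[Icc 0 d] 0, ‖φ (γ s) - φ x‖ < δ := by
    have := (hβ.continuousOn 0 h0m)
    filter_upwards [this (Metric.ball_mem_nhds _ hδ)] with s hs
    exact mem_ball_iff_norm.1 hs
  have e3 : ∃ᶠ s in 𝓝[Icc 0 d] (0 : ℝ), s ∈ Ioo 0 d := by
    have : ∃ᶠ s in 𝓝[>] (0 : ℝ), s ∈ Ioo 0 d :=
      Eventually.frequently (Ioo_mem_nhdsGT hd0)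
    refine this.filter_mono ?_
    rw [← nhdsWithin_Ioo_eq_nhdsGT hd0]
    exact nhdsWithin_mono _ Ioo_subset_Icc_self
  obtain ⟨s, hs, hs1, hs2⟩ := (e3.and_eventually (e1.and e2)).exists
  have hs0 : 0 < s := hs.1
  have hsI : s ∈ Icc 0 d := Ioo_subset_Icc_self hs
  have hxs : γ 1 ∈ g.chronFuture (γ s) := mem_chronFuture_of_Icc (by linarith [hs.2])
    (hγ.mono (Icc_subset_Icc_left hs0.le))
  have e4 : ∀ᶠ y' in 𝓝 x, y' ∈ φ.source ∧ ‖φ y' - φ x‖ < min δ (δ / 2 * s) := by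
    refine Eventually.and hsrc ?_
    filter_upwards [(φ.continuousAt (mem_chart_source _ x))
      (Metric.ball_mem_nhds _ (show 0 < min δ (δ / 2 * s) by positivity))] with y' hy'
    exact mem_ball_iff_norm.1 hy'
  filter_upwards [e4] with y' hy'
  refine chronFuture_trans ?_ hxs
  have := hcone (φ y') (φ (γ s)) (hy'.2.trans_le (min_le_left _ _)) hs2 s hs0 ?_
  · rwa [φ.left_inv hy'.1, φ.left_inv (h2 hsI)] at this
  · have h5 := hy'.2.trans_le (min_le_right _ _)
    have h6 : φ (γ s) - φ y' - s • v =
        ((φ ∘ γ) s - (φ ∘ γ) 0 - (s - 0) • v) - (φ y' - φ x) := by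
      simp only [Function.comp, ← hx, sub_smul, zero_smul]; abel
    rw [h6]
    refine (norm_sub_le _ _).trans_lt ?_
    rw [Real.norm_eq_abs, sub_zero, abs_of_pos hs0] at hs1
    rw [sub_zero]
    linarith

end Spacetime

end LocalCausality

/-! ### Deforming causal curves into timelike ones, and the push-up property. -/

section Push

set_option linter.unusedSectionVars false

variable {n : ℕ} {M : Type*} [TopologicalSpace M]
  [ChartedSpace (EuclideanSpace ℝ (Fin (n + 1))) M] [IsManifold (𝓡 (n + 1)) ∞ M]

local notation "Eₙ" => EuclideanSpace ℝ (Fin (n + 1))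

open Spacetime

namespace Patch

variable {g : Spacetime n M} {p : M} (Q : Patch g p)

theorem norm_le_of_causal {z : Eₙ} (hz : z ∈ Metric.closedBall (chartAt Eₙ p p) Q.R) {v : Eₙ}
    (hv : g.pullback p z v v ≤ 0) (hℓ : 0 < Q.ℓ v) : ‖v‖ ≤ Q.C * Q.ℓ v := by
  have := Q.cone z hz v hv
  rwa [abs_of_pos hℓ] at this

/-- A causal vector is no worse than slightly spacelike at a nearby point. -/
theorem pullback_le_of_causal {z z' : Eₙ} (hz : z ∈ Metric.closedBall (chartAt Eₙ p p) Q.R)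
    (hz' : z' ∈ Metric.closedBall (chartAt Eₙ p p) Q.R) {v : Eₙ}
    (hv : g.pullback p z v v ≤ 0) (hℓ : 0 < Q.ℓ v) :
    g.pullback p z' v v ≤ Q.L * Q.C ^ 2 * ‖z' - z‖ * Q.ℓ v ^ 2 := by
  have h1 := Q.lip z' hz' z hz v
  have h2 := Q.norm_le_of_causal hz hv hℓ
  have h3 : Q.L * ‖z' - z‖ * ‖v‖ ^ 2 ≤ Q.L * ‖z' - z‖ * (Q.C * Q.ℓ v) ^ 2 := by
    have := Q.L_nonneg
    gcongr
  calc _ ≤ 0 + Q.L * ‖z' - z‖ * (Q.C * Q.ℓ v) ^ 2 := h1.trans (add_le_add hv h3)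
    _ = _ := by ring

/-- At `z'` the vector `v` is spacelike by less than `ε / 2 * (ℓ v)²`. Adding `ε * ℓ v` times `e`
gains more: the mixed term is bounded by the reverse Cauchy–Schwarz inequality, and `g(e, e) ≤
-1/2`. -/
theorem push_vector {z z' v : Eₙ} {ε : ℝ} (hz : z ∈ Metric.closedBall (chartAt Eₙ p p) Q.R)
    (hz' : z' ∈ Metric.closedBall (chartAt Eₙ p p) Q.R) (hε : 0 < ε)
    (hv : g.pullback p z v v ≤ 0) (hℓ : 0 < Q.ℓ v)
    (hd : Q.L * Q.C ^ 2 * ‖z' - z‖ < ε / 2) :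
    g.pullback p z' (v + (ε * Q.ℓ v) • Q.e) (v + (ε * Q.ℓ v) • Q.e) < 0 ∧
      0 < Q.ℓ (v + (ε * Q.ℓ v) • Q.e) := by
  have h1 := Q.pullback_le_of_causal hz hz' hv hℓ
  have h2 := Q.e_timelike z' hz'
  have h3 := bilin_le_of_pos_on_ker (B := g.pullback p z') (ℓ := Q.ℓ) (g.pullback_symm p z')
    (fun u hu ↦ (mul_nonneg Q.c_pos.le (sq_nonneg _)).trans (Q.coercive z' hz' u hu)) v Q.e
  rw [Q.ℓ_e] at h3
  have hs := g.pullback_symm p z' Q.e v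
  simp only [map_add, map_smul, add_apply, smul_apply, smul_eq_mul, Q.ℓ_e, hs]
  set A := g.pullback p z' v v
  set B := g.pullback p z' v Q.e
  set D := g.pullback p z' Q.e Q.e
  set t := Q.ℓ v
  have ht2 : 0 < t ^ 2 := by positivity
  have h4 : A < ε / 2 * t ^ 2 := h1.trans_lt (by gcongr)
  have h5 : t ^ 2 * D ≤ t ^ 2 * -(1 / 2) := by gcongr
  refine ⟨?_, by positivity⟩
  have h6 : 2 * t * B ≤ A + t ^ 2 * D := by linarith
  have h7 : ε * (2 * t * B) ≤ ε * (A + t ^ 2 * D) := by gcongr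
  have h8 : (1 + ε) * A < (1 + ε) * (ε / 2 * t ^ 2) := by gcongr
  have h9 : (ε + ε ^ 2) * (t ^ 2 * D) ≤ (ε + ε ^ 2) * (t ^ 2 * -(1 / 2)) := by gcongr
  nlinarith

/-- The coordinate map used to deform causal curves into timelike ones. -/
noncomputable def pushMap (w a : Eₙ) (ε : ℝ) (z : Eₙ) : Eₙ := z + (w + (ε * Q.ℓ (z - a)) • Q.e)

theorem hasDerivWithinAt_pushMap {w a : Eₙ} {ε : ℝ} {β : ℝ → Eₙ} {v : Eₙ} {s : Set ℝ} {t : ℝ}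
    (h : HasDerivWithinAt β v s t) :
    HasDerivWithinAt (fun t ↦ Q.pushMap w a ε (β t)) (v + (ε * Q.ℓ v) • Q.e) s t := by
  have h1 : HasDerivWithinAt (fun t ↦ ε * Q.ℓ (β t - a)) (ε * Q.ℓ v) s t :=
    (Q.ℓ.hasFDerivAt.comp_hasDerivWithinAt t (h.sub_const a)).const_mul ε
  exact h.add ((h1.smul_const Q.e).const_add w)

theorem contDiff_pushMap (w a : Eₙ) (ε : ℝ) : ContDiff ℝ 1 (Q.pushMap w a ε) := by
  unfold pushMap
  fun_prop

/-- The pushed curve has velocity `v + (ε * ℓ v) • e`, which is timelike by `push_vector`; neither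
`w` nor `a` enters the velocity. -/
theorem chron_pushMap {w a : Eₙ} {ε : ℝ} (hε : 0 < ε) {x y : M}
    (h : Joins g.FutureCausal (Q.region (Q.R / 2)) x y)
    (hΦ : ∀ z ∈ Metric.closedBall (chartAt Eₙ p p) (Q.R / 2),
      Q.pushMap w a ε z ∈ Metric.closedBall (chartAt Eₙ p p) Q.R ∧
        Q.L * Q.C ^ 2 * ‖Q.pushMap w a ε z - z‖ < ε / 2) :
    (chartAt Eₙ p).symm (Q.pushMap w a ε (chartAt Eₙ p y)) ∈
      g.chronFuture ((chartAt Eₙ p).symm (Q.pushMap w a ε (chartAt Eₙ p x))) := by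
  obtain ⟨γ, hγ, hN, rfl, rfl⟩ := h
  have hR : Q.R / 2 ≤ Q.R := by have := Q.R_pos; linarith
  have hsub : Metric.closedBall (chartAt Eₙ p p) (Q.R / 2) ⊆ Metric.closedBall (chartAt Eₙ p p) Q.R :=
    Metric.closedBall_subset_closedBall hR
  set Ψ : M → M := fun q ↦ (chartAt Eₙ p).symm (Q.pushMap w a ε (chartAt Eₙ p q))
  have := PiecewiseC1With.induction (Q := fun s t ↦ s = t ∨ Ψ (γ t) ∈ g.chronFuture (Ψ (γ s)))
    zero_le_one hγ (fun t _ ↦ Or.inl rfl) (fun r s t _ _ _ _ h1 h2 ↦ ?_) fun t ht ↦ ?_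
  · exact this.resolve_left zero_ne_one
  · rcases h1 with rfl | h1
    · exact h2
    · rcases h2 with rfl | h2
      · exact Or.inr h1
      · exact Or.inr (chronFuture_trans h1 h2)
  · refine ⟨univ, univ_mem, fun c d hc hcd hd _ _ hpc ↦ Or.inr ?_⟩
    have hmem : ∀ s ∈ Icc c d, γ s ∈ (chartAt Eₙ p).source ∧
        chartAt Eₙ p (γ s) ∈ Metric.closedBall (chartAt Eₙ p p) (Q.R / 2) := fun s hs ↦
      (Q.mem_region_iff hR).1 (hN ⟨hc.trans hs.1, hs.2.trans hd⟩)
    obtain ⟨hβ, hP⟩ := hpc.to_chart hcd fun s hs ↦ (hmem s hs).1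
    refine Q.chron_of_chart (β := fun s ↦ Q.pushMap w a ε (chartAt Eₙ p (γ s))) hcd
      ((Q.contDiff_pushMap w a ε).comp_contDiffOn hβ) (fun s hs ↦ (hΦ _ (hmem s hs).2).1)
      fun s hs ↦ ?_
    have hd' := Q.hasDerivWithinAt_pushMap (w := w) (a := a) (ε := ε)
      ((hβ s hs).differentiableWithinAt one_ne_zero).hasDerivWithinAt
    have hd'' := hd'.derivWithin (uniqueDiffOn_Icc hcd s hs)
    simp only [Function.comp] at hd''
    rw [hd'']
    obtain ⟨-, h2, h3⟩ := (Q.futureCausal_iff (hsub (hmem s hs).2) _).1 (hP s hs)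
    exact Q.push_vector (hsub (hmem s hs).2) (hΦ _ (hmem s hs).2).1 hε h2 h3 (hΦ _ (hmem s hs).2).2

/-- Uniformly small deformations of causal curves into timelike ones. -/
theorem exists_push {r : ℝ} (hr : 0 < r) : ∃ ε > 0, ∃ δ > 0,
    ∀ a ∈ Metric.closedBall (chartAt Eₙ p p) (Q.R / 2), ∀ w : Eₙ, ‖w‖ < δ →
      (∀ z ∈ Metric.closedBall (chartAt Eₙ p p) (Q.R / 2), ‖Q.pushMap w a ε z - z‖ < r) ∧
      ∀ x y : M, Joins g.FutureCausal (Q.region (Q.R / 2)) x y →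
        (chartAt Eₙ p).symm (Q.pushMap w a ε (chartAt Eₙ p y)) ∈
          g.chronFuture ((chartAt Eₙ p).symm (Q.pushMap w a ε (chartAt Eₙ p x))) := by
  have hR := Q.R_pos
  have hL := Q.L_nonneg
  set r' := min r (Q.R / 2) with hr'
  have hr'pos : 0 < r' := lt_min hr (by linarith)
  set K := Q.R * ‖Q.ℓ‖ * ‖Q.e‖ with hK
  have hKnn : 0 ≤ K := by positivity
  set ε := r' / (4 * (K + 1)) with hε
  have hεpos : 0 < ε := by positivity
  have hεK : ε * K ≤ r' / 4 := by
    rw [hε, div_mul_eq_mul_div, div_le_div_iff₀ (by positivity) (by norm_num)]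
    nlinarith
  -- The shift along `e` and the shift by `w` each use at most `ε / 8` of the admissible `ε / 2`.
  have hsmall : Q.L * Q.C ^ 2 * K ≤ 1 / 8 := by
    have := Q.small
    rw [hK]
    nlinarith
  set δ := min (r' / 4) (ε / (8 * (Q.L * Q.C ^ 2 + 1))) with hδ
  have hδpos : 0 < δ := by positivity
  refine ⟨ε, hεpos, δ, hδpos, fun a ha w hw ↦ ?_⟩
  have hbound : ∀ z ∈ Metric.closedBall (chartAt Eₙ p p) (Q.R / 2),
      ‖Q.pushMap w a ε z - z‖ ≤ ‖w‖ + ε * K := by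
    intro z hz
    have h1 : ‖z - a‖ ≤ Q.R := by
      rw [← dist_eq_norm]
      have := dist_triangle_right z a (chartAt Eₙ p p)
      rw [Metric.mem_closedBall] at hz ha
      linarith
    rw [pushMap, add_sub_cancel_left]
    refine (norm_add_le _ _).trans (add_le_add le_rfl ?_)
    rw [norm_smul, norm_mul, Real.norm_eq_abs ε, abs_of_pos hεpos, mul_assoc]
    gcongr
    rw [hK, mul_comm Q.R]
    gcongr
    exact (Q.ℓ.le_opNorm _).trans (by gcongr)
  have hw1 : ‖w‖ < r' / 4 := hw.trans_le (min_le_left _ _)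
  have hw2 : Q.L * Q.C ^ 2 * ‖w‖ ≤ ε / 8 := by
    have h1 : ‖w‖ ≤ ε / (8 * (Q.L * Q.C ^ 2 + 1)) := hw.le.trans (min_le_right _ _)
    rw [le_div_iff₀ (by positivity)] at h1
    nlinarith [norm_nonneg w]
  have hr1 : r' ≤ r := min_le_left _ _
  have hr2 : r' ≤ Q.R / 2 := min_le_right _ _
  refine ⟨fun z hz ↦ ?_, fun x y hxy ↦ ?_⟩
  · have := hbound z hz
    linarith
  · refine Q.chron_pushMap hεpos hxy fun z hz ↦ ⟨?_, ?_⟩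
    · have h1 := hbound z hz
      rw [mem_closedBall_iff_norm] at hz ⊢
      have := norm_sub_le_norm_sub_add_norm_sub (Q.pushMap w a ε z) z (chartAt Eₙ p p)
      linarith
    · have h1 := hbound z hz
      have h2 : Q.L * Q.C ^ 2 * ‖Q.pushMap w a ε z - z‖ ≤ Q.L * Q.C ^ 2 * (‖w‖ + ε * K) := by
        gcongr
      nlinarith

theorem pushMap_self (w a : Eₙ) (ε : ℝ) : Q.pushMap w a ε a = a + w := by
  simp [pushMap]

/-- Anchor the deformation at the starting point, with `w` equal to the prescribed offset: the
deformed curve then starts exactly at `z`. The tolerance `δ` does not depend on the curve, which is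
what limits need. -/
theorem exists_push_from {r : ℝ} (hr : 0 < r) : ∃ δ > 0, ∀ x y : M,
    Joins g.FutureCausal (Q.region (Q.R / 2)) x y → ∀ z : Eₙ, ‖z - chartAt Eₙ p x‖ < δ →
      ∃ z' : Eₙ, ‖z' - chartAt Eₙ p y‖ < r ∧
        (chartAt Eₙ p).symm z' ∈ g.chronFuture ((chartAt Eₙ p).symm z) := by
  obtain ⟨ε, hε, δ, hδ, h⟩ := Q.exists_push hr
  have hR : Q.R / 2 ≤ Q.R := by have := Q.R_pos; linarith
  refine ⟨δ, hδ, fun x y hxy z hz ↦ ?_⟩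
  obtain ⟨γ, hγ, hN, rfl, rfl⟩ := id hxy
  have hx := (Q.mem_region_iff hR).1 (hN (left_mem_Icc.2 zero_le_one))
  have hy := (Q.mem_region_iff hR).1 (hN (right_mem_Icc.2 zero_le_one))
  obtain ⟨h1, h2⟩ := h _ hx.2 (z - chartAt Eₙ p (γ 0)) hz
  refine ⟨_, h1 _ hy.2, ?_⟩
  have := h2 _ _ hxy
  rwa [Q.pushMap_self, add_sub_cancel] at this

/-- The same deformation anchored at the final point. -/
theorem exists_push_to {r : ℝ} (hr : 0 < r) : ∃ δ > 0, ∀ x y : M,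
    Joins g.FutureCausal (Q.region (Q.R / 2)) x y → ∀ z' : Eₙ, ‖z' - chartAt Eₙ p y‖ < δ →
      ∃ z : Eₙ, ‖z - chartAt Eₙ p x‖ < r ∧
        (chartAt Eₙ p).symm z' ∈ g.chronFuture ((chartAt Eₙ p).symm z) := by
  obtain ⟨ε, hε, δ, hδ, h⟩ := Q.exists_push hr
  have hR : Q.R / 2 ≤ Q.R := by have := Q.R_pos; linarith
  refine ⟨δ, hδ, fun x y hxy z hz ↦ ?_⟩
  obtain ⟨γ, hγ, hN, rfl, rfl⟩ := id hxy
  have hx := (Q.mem_region_iff hR).1 (hN (left_mem_Icc.2 zero_le_one))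
  have hy := (Q.mem_region_iff hR).1 (hN (right_mem_Icc.2 zero_le_one))
  obtain ⟨h1, h2⟩ := h _ hy.2 (z - chartAt Eₙ p (γ 1)) hz
  refine ⟨_, h1 _ hx.2, ?_⟩
  have := h2 _ _ hxy
  rwa [Q.pushMap_self, add_sub_cancel] at this

end Patch

namespace Spacetime

variable {g : Spacetime n M}

/-- Short causal curves are covered by patches. -/
theorem exists_local_joins (γ : ℝ → M) (p : M) :
    ∃ (Q : Patch g p) (W : Set M), W ∈ 𝓝 p ∧ W ⊆ Q.region (Q.R / 2) ∧
      ∀ c d, c < d → MapsTo γ (Icc c d) W → C1With g.FutureCausal γ c d →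
        Joins g.FutureCausal (Q.region (Q.R / 2)) (γ c) (γ d) := by
  obtain ⟨Q, -⟩ := g.exists_patch p univ_mem
  have hR : Q.R / 2 ≤ Q.R := by have := Q.R_pos; linarith
  have hW := Patch.preimage_mem_nhds (x := p) (r := Q.R / 2) (mem_chart_source Eₙ p)
    (Metric.mem_ball_self (by have := Q.R_pos; linarith))
  have hsub : (chartAt Eₙ p).source ∩ chartAt Eₙ p ⁻¹' Metric.ball (chartAt Eₙ p p) (Q.R / 2) ⊆
      Q.region (Q.R / 2) := fun x hx ↦
    (Q.mem_region_iff hR).2 ⟨hx.1, Metric.ball_subset_closedBall hx.2⟩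
  exact ⟨Q, _, hW, hsub, fun c d hcd hm hp ↦
    Joins.of_Icc hcd g.futureCausal_smul hp.piecewise (hm.mono_right hsub)⟩

/-- Move back along the causal curve in short pieces. The past of `z` is open, so a timelike
deformation that keeps the start of a piece fixed and ends close enough to its end still reaches
that past. -/
theorem chronFuture_of_joins_of_chron {x y z : M} (h1 : Joins g.FutureCausal univ x y)
    (h2 : z ∈ g.chronFuture y) : z ∈ g.chronFuture x := by
  obtain ⟨γ, hγ, -, rfl, rfl⟩ := h1
  refine PiecewiseC1With.induction
    (Q := fun s t ↦ ∀ z, z ∈ g.chronFuture (γ t) → z ∈ g.chronFuture (γ s)) zero_le_one hγ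
    (fun _ _ _ h ↦ h) (fun r s t _ _ _ _ h1 h2 z hz ↦ h1 z (h2 z hz)) (fun t _ ↦ ?_) z h2
  obtain ⟨Q, W, hW, hsub, hj⟩ := exists_local_joins (g := g) γ (γ t)
  have hR : Q.R / 2 ≤ Q.R := by have := Q.R_pos; linarith
  refine ⟨W, hW, fun c d _ hcd _ _ hm hp z hz ↦ ?_⟩
  have hc := (Q.mem_region_iff hR).1 (hsub (hm (left_mem_Icc.2 hcd.le)))
  have hd := (Q.mem_region_iff hR).1 (hsub (hm (right_mem_Icc.2 hcd.le)))
  have hnh : {q | (chartAt Eₙ (γ t)).symm q ∈ {x | z ∈ g.chronFuture x}} ∈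
      𝓝 (chartAt Eₙ (γ t) (γ d)) := by
    refine Q.tendsto_symm (Metric.closedBall_subset_closedBall hR hd.2)
      ((g.isOpen_chronPast z).mem_nhds ?_)
    rwa [(chartAt Eₙ (γ t)).left_inv hd.1]
  obtain ⟨r, hr, hball⟩ := Metric.mem_nhds_iff.1 hnh
  obtain ⟨δ, hδ, h⟩ := Q.exists_push_from hr
  obtain ⟨z', hz', hch⟩ := h _ _ (hj c d hcd hm hp) (chartAt Eₙ (γ t) (γ c)) (by simpa using hδ)
  rw [(chartAt Eₙ (γ t)).left_inv hc.1] at hch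
  exact chronFuture_trans hch (hball (mem_ball_iff_norm.2 hz'))

theorem chronFuture_of_chron_of_joins {x y z : M} (h1 : y ∈ g.chronFuture x)
    (h2 : Joins g.FutureCausal univ y z) : z ∈ g.chronFuture x := by
  obtain ⟨γ, hγ, -, rfl, rfl⟩ := h2
  refine PiecewiseC1With.induction
    (Q := fun s t ↦ ∀ x, γ s ∈ g.chronFuture x → γ t ∈ g.chronFuture x) zero_le_one hγ
    (fun _ _ _ h ↦ h) (fun r s t _ _ _ _ h1 h2 z hz ↦ h2 z (h1 z hz)) (fun t _ ↦ ?_) x h1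
  obtain ⟨Q, W, hW, hsub, hj⟩ := exists_local_joins (g := g) γ (γ t)
  have hR : Q.R / 2 ≤ Q.R := by have := Q.R_pos; linarith
  refine ⟨W, hW, fun c d _ hcd _ _ hm hp x hx ↦ ?_⟩
  have hc := (Q.mem_region_iff hR).1 (hsub (hm (left_mem_Icc.2 hcd.le)))
  have hd := (Q.mem_region_iff hR).1 (hsub (hm (right_mem_Icc.2 hcd.le)))
  have hnh : {q | (chartAt Eₙ (γ t)).symm q ∈ g.chronFuture x} ∈
      𝓝 (chartAt Eₙ (γ t) (γ c)) := by
    refine Q.tendsto_symm (Metric.closedBall_subset_closedBall hR hc.2)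
      ((g.isOpen_chronFuture x).mem_nhds ?_)
    rwa [(chartAt Eₙ (γ t)).left_inv hc.1]
  obtain ⟨r, hr, hball⟩ := Metric.mem_nhds_iff.1 hnh
  obtain ⟨δ, hδ, h⟩ := Q.exists_push_to hr
  obtain ⟨z', hz', hch⟩ := h _ _ (hj c d hcd hm hp) (chartAt Eₙ (γ t) (γ d)) (by simpa using hδ)
  rw [(chartAt Eₙ (γ t)).left_inv hd.1] at hch
  exact chronFuture_trans (hball (mem_ball_iff_norm.2 hz')) hch

theorem CausalLE.chronFuture_subset {U : Set M} {x y : M} (h : g.CausalLE U x y) :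
    g.chronFuture y ⊆ g.chronFuture x := by
  rcases h with ⟨rfl, -⟩ | h
  · exact subset_rfl
  · exact fun z hz ↦ chronFuture_of_joins_of_chron (Joins.mono h (subset_univ _)) hz

theorem mem_chronFuture_of_chron_of_causalLE {U : Set M} {x y z : M} (h1 : y ∈ g.chronFuture x)
    (h2 : g.CausalLE U y z) : z ∈ g.chronFuture x := by
  rcases h2 with ⟨rfl, -⟩ | h2
  · exact h1
  · exact chronFuture_of_chron_of_joins h1 (Joins.mono h2 (subset_univ _))

end Spacetime

end Push

/-! ### Limits of causal curves in a coordinate ball. -/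

section LocalClosed

set_option linter.unusedSectionVars false

variable {n : ℕ} {M : Type*} [TopologicalSpace M]
  [ChartedSpace (EuclideanSpace ℝ (Fin (n + 1))) M] [IsManifold (𝓡 (n + 1)) ∞ M]

local notation "Eₙ" => EuclideanSpace ℝ (Fin (n + 1))

open Spacetime

namespace Patch

variable {g : Spacetime n M} {p : M} (Q : Patch g p)

theorem half_le : Q.R / 2 ≤ Q.R := by have := Q.R_pos; linarith

theorem half_ball_subset : Metric.closedBall (chartAt Eₙ p p) (Q.R / 2) ⊆
    Metric.closedBall (chartAt Eₙ p p) Q.R :=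
  Metric.closedBall_subset_closedBall Q.half_le

/-- Displacements along causal curves lie in every closed convex cone that contains the
velocities. -/
theorem displacement_mem {γ : ℝ → M} {a b : ℝ} (hab : a ≤ b)
    (hγ : PiecewiseC1With g.FutureCausal γ (Icc a b))
    (hN : MapsTo γ (Icc a b) (Q.region (Q.R / 2))) {S : Set Eₙ} (hconv : Convex ℝ S)
    (hclosed : IsClosed S) (hcone : ∀ a : ℝ, 0 < a → ∀ x ∈ S, a • x ∈ S) (h0 : (0 : Eₙ) ∈ S)
    (hS : ∀ t ∈ Icc a b, ∀ v, g.pullback p (chartAt Eₙ p (γ t)) v v ≤ 0 → 0 < Q.ℓ v → v ∈ S) :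
    chartAt Eₙ p (γ b) - chartAt Eₙ p (γ a) ∈ S := by
  have hadd : ∀ x ∈ S, ∀ y ∈ S, x + y ∈ S := by
    intro x hx y hy
    have := hcone 2 two_pos _ (hconv hx hy (a := 1 / 2) (b := 1 / 2) (by norm_num) (by norm_num)
      (by norm_num))
    rwa [smul_add, smul_smul, smul_smul, show (2 : ℝ) * (1 / 2) = 1 by norm_num, one_smul,
      one_smul] at this
  refine PiecewiseC1With.induction
    (Q := fun s t ↦ chartAt Eₙ p (γ t) - chartAt Eₙ p (γ s) ∈ S) hab hγ (fun t _ ↦ by simpa using h0)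
    (fun r s t _ _ _ _ h1 h2 ↦ ?_) fun t ht ↦ ?_
  · have := hadd _ h1 _ h2
    rwa [sub_add_sub_cancel'] at this
  · refine ⟨univ, univ_mem, fun c d hc hcd hd _ _ hpc ↦ ?_⟩
    have hmem : ∀ s ∈ Icc c d, s ∈ Icc a b ∧ γ s ∈ (chartAt Eₙ p).source ∧
        chartAt Eₙ p (γ s) ∈ Metric.closedBall (chartAt Eₙ p p) (Q.R / 2) := fun s hs ↦
      have h : s ∈ Icc a b := ⟨hc.trans hs.1, hs.2.trans hd⟩
      ⟨h, (Q.mem_region_iff Q.half_le).1 (hN h)⟩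
    obtain ⟨hβ, hP⟩ := hpc.to_chart hcd fun s hs ↦ (hmem s hs).2.1
    refine sub_mem_of_derivWithin_mem hconv hclosed hcone hcd hβ fun s hs ↦ ?_
    obtain ⟨-, h2, h3⟩ := (Q.futureCausal_iff (Q.half_ball_subset (hmem s hs).2.2) _).1 (hP s hs)
    exact hS s (hmem s hs).1 _ h2 h3

/-- The cone `‖v‖ ≤ C ℓ v` is closed, convex and contains the future causal vectors at all points of
the patch. Hence `ℓ` is a time function, and curves parametrized by it are uniformly Lipschitz. -/
theorem norm_displacement_le {γ : ℝ → M} {a b : ℝ} (hab : a ≤ b)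
    (hγ : PiecewiseC1With g.FutureCausal γ (Icc a b))
    (hN : MapsTo γ (Icc a b) (Q.region (Q.R / 2))) :
    ‖chartAt Eₙ p (γ b) - chartAt Eₙ p (γ a)‖ ≤
      Q.C * Q.ℓ (chartAt Eₙ p (γ b) - chartAt Eₙ p (γ a)) := by
  refine Q.displacement_mem hab hγ hN (S := {v | ‖v‖ ≤ Q.C * Q.ℓ v}) ?_ ?_ ?_ ?_ ?_
  · intro x hx y hy s t hs ht _
    simp only [mem_ofPred_eq] at hx hy ⊢
    refine (norm_add_le _ _).trans ?_
    rw [norm_smul, norm_smul, Real.norm_eq_abs, Real.norm_eq_abs, abs_of_nonneg hs,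
      abs_of_nonneg ht, map_add, map_smul, map_smul, smul_eq_mul, smul_eq_mul]
    nlinarith [mul_le_mul_of_nonneg_left hx hs, mul_le_mul_of_nonneg_left hy ht]
  · exact isClosed_le continuous_norm (by fun_prop)
  · intro s hs x hx
    simp only [mem_ofPred_eq] at hx ⊢
    rw [norm_smul, Real.norm_eq_abs, abs_of_pos hs, map_smul, smul_eq_mul]
    nlinarith [mul_le_mul_of_nonneg_left hx hs.le]
  · simp
  · intro t ht v hv hℓ
    exact Q.norm_le_of_causal (Q.half_ball_subset ((Q.mem_region_iff Q.half_le).1 (hN ht)).2) hv hℓ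

theorem ℓ_nonneg_of_norm_le {v : Eₙ} (h : ‖v‖ ≤ Q.C * Q.ℓ v) : 0 ≤ Q.ℓ v :=
  (mul_nonneg_iff_of_pos_left Q.C_pos).1 ((norm_nonneg v).trans h)

theorem eq_of_ℓ_eq_zero {v : Eₙ} (h : ‖v‖ ≤ Q.C * Q.ℓ v) (h0 : Q.ℓ v = 0) : v = 0 := by
  rw [h0, mul_zero] at h
  exact norm_le_zero_iff.1 h

/-- The displacement along a causal curve is approximately causal. -/
theorem pullback_displacement_le {γ : ℝ → M} {a b : ℝ} (hab : a ≤ b)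
    (hγ : PiecewiseC1With g.FutureCausal γ (Icc a b))
    (hN : MapsTo γ (Icc a b) (Q.region (Q.R / 2))) {z Δ : Eₙ}
    (hz : z ∈ Metric.closedBall (chartAt Eₙ p p) Q.R)
    (hΔ : chartAt Eₙ p (γ b) - chartAt Eₙ p (γ a) = Δ) :
    g.pullback p z Δ Δ ≤
      Q.L * Q.C ^ 2 * (‖z - chartAt Eₙ p (γ a)‖ + Q.C * Q.ℓ Δ) * Q.ℓ Δ ^ 2 := by
  subst hΔ
  refine (Q.displacement_mem hab hγ hN (convex_perturbed_cone (g.pullback_symm p z) Q.c_pos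
    (Q.coercive z hz) _) ?_ ?_ ?_ ?_).2
  · exact (isClosed_le continuous_const Q.ℓ.continuous).inter
      (isClosed_le (show Continuous fun v ↦ g.pullback p z v v by fun_prop)
        (continuous_const.mul (Q.ℓ.continuous.pow 2)))
  · rintro s hs x ⟨h1, h2⟩
    refine ⟨?_, ?_⟩
    · rw [map_smul, smul_eq_mul]; positivity
    · simp only [map_smul, smul_apply, smul_eq_mul]
      nlinarith [mul_le_mul_of_nonneg_left h2 (mul_nonneg hs.le hs.le)]
  · simp
  · intro t ht v hv hℓ
    have hzt := Q.half_ball_subset ((Q.mem_region_iff Q.half_le).1 (hN ht)).2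
    refine ⟨hℓ.le, (Q.pullback_le_of_causal hzt hz hv hℓ).trans ?_⟩
    have h1 := Q.norm_displacement_le ht.1 (hγ.mono (Icc_subset_Icc_right ht.2))
      (hN.mono_left (Icc_subset_Icc_right ht.2))
    have h2 := Q.ℓ_nonneg_of_norm_le (Q.norm_displacement_le ht.2
      (hγ.mono (Icc_subset_Icc_left ht.1)) (hN.mono_left (Icc_subset_Icc_left ht.1)))
    have h3 : Q.ℓ (chartAt Eₙ p (γ t) - chartAt Eₙ p (γ a)) ≤
        Q.ℓ (chartAt Eₙ p (γ b) - chartAt Eₙ p (γ a)) := by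
      rw [map_sub] at h2 ⊢
      rw [map_sub]
      linarith
    have h4 : ‖z - chartAt Eₙ p (γ t)‖ ≤ ‖z - chartAt Eₙ p (γ a)‖ +
        Q.C * Q.ℓ (chartAt Eₙ p (γ b) - chartAt Eₙ p (γ a)) := by
      refine (norm_sub_le_norm_sub_add_norm_sub _ (chartAt Eₙ p (γ a)) _).trans ?_
      rw [norm_sub_rev (chartAt Eₙ p (γ a))]
      gcongr
      exact h1.trans (by have := Q.C_pos; gcongr)
    have := Q.L_nonneg
    gcongr

/-- A causal curve parametrized by the time function `ℓ`. -/
theorem exists_level {x y : M} (h : Joins g.FutureCausal (Q.region (Q.R / 2)) x y)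
    (hℓ : Q.ℓ (chartAt Eₙ p x) < Q.ℓ (chartAt Eₙ p y)) : ∃ f : ℝ → M, f 0 = x ∧ f 1 = y ∧
      (∀ t ∈ Icc (0 : ℝ) 1, f t ∈ Q.region (Q.R / 2) ∧ Q.ℓ (chartAt Eₙ p (f t)) =
        Q.ℓ (chartAt Eₙ p x) + t * (Q.ℓ (chartAt Eₙ p y) - Q.ℓ (chartAt Eₙ p x))) ∧
      ∀ s t, 0 ≤ s → s < t → t ≤ 1 → ∃ (γ : ℝ → M) (a b : ℝ), a < b ∧
        PiecewiseC1With g.FutureCausal γ (Icc a b) ∧ MapsTo γ (Icc a b) (Q.region (Q.R / 2)) ∧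
        γ a = f s ∧ γ b = f t := by
  obtain ⟨γ, hγ, hN, rfl, rfl⟩ := h
  have hmono : ∀ s t, 0 ≤ s → s ≤ t → t ≤ 1 →
      ‖chartAt Eₙ p (γ t) - chartAt Eₙ p (γ s)‖ ≤
        Q.C * Q.ℓ (chartAt Eₙ p (γ t) - chartAt Eₙ p (γ s)) := fun s t hs hst ht ↦
    Q.norm_displacement_le hst (hγ.mono (Icc_subset_Icc hs ht)) (hN.mono_left (Icc_subset_Icc hs ht))
  have hmono' : ∀ s t, 0 ≤ s → s ≤ t → t ≤ 1 →
      Q.ℓ (chartAt Eₙ p (γ s)) ≤ Q.ℓ (chartAt Eₙ p (γ t)) := fun s t hs hst ht ↦ by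
    have := Q.ℓ_nonneg_of_norm_le (hmono s t hs hst ht)
    rw [map_sub] at this
    linarith
  have hsrc : ∀ t ∈ Icc (0 : ℝ) 1, γ t ∈ (chartAt Eₙ p).source := fun t ht ↦
    ((Q.mem_region_iff Q.half_le).1 (hN ht)).1
  have hcont : ContinuousOn (fun t ↦ Q.ℓ (chartAt Eₙ p (γ t))) (Icc 0 1) :=
    Q.ℓ.continuous.comp_continuousOn ((chartAt Eₙ p).continuousOn.comp hγ.1 hsrc)
  have hinj : ∀ s t, 0 ≤ s → s ≤ t → t ≤ 1 →
      Q.ℓ (chartAt Eₙ p (γ s)) = Q.ℓ (chartAt Eₙ p (γ t)) → γ s = γ t := by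
    intro s t hs hst ht heq
    have h1 := Q.eq_of_ℓ_eq_zero (hmono s t hs hst ht) (by rw [map_sub, heq, sub_self])
    exact (chartAt Eₙ p).injOn (hsrc s ⟨hs, hst.trans ht⟩) (hsrc t ⟨hs.trans hst, ht⟩)
      (sub_eq_zero.1 h1).symm
  set τ := Q.ℓ (chartAt Eₙ p (γ 1)) - Q.ℓ (chartAt Eₙ p (γ 0)) with hτ
  have hτpos : 0 < τ := sub_pos.2 hℓ
  -- The parameter at which `ℓ` takes the required value; outside `[0, 1]` it is an arbitrary `0`.
  have hex : ∀ t : ℝ, ∃ u : ℝ, t ∈ Icc (0 : ℝ) 1 → u ∈ Icc (0 : ℝ) 1 ∧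
      Q.ℓ (chartAt Eₙ p (γ u)) = Q.ℓ (chartAt Eₙ p (γ 0)) + t * τ := by
    intro t
    by_cases ht : t ∈ Icc (0 : ℝ) 1
    · obtain ⟨u, hu, hu'⟩ := intermediate_value_Icc zero_le_one hcont
        (show Q.ℓ (chartAt Eₙ p (γ 0)) + t * τ ∈ _ from
          ⟨by nlinarith [mul_nonneg ht.1 hτpos.le],
            by nlinarith [mul_le_mul_of_nonneg_right ht.2 hτpos.le]⟩)
      exact ⟨u, fun _ ↦ ⟨hu, hu'⟩⟩
    · exact ⟨0, fun h ↦ absurd h ht⟩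
  choose u hu using hex
  have hu0 := hu 0 (left_mem_Icc.2 zero_le_one)
  have hu1 := hu 1 (right_mem_Icc.2 zero_le_one)
  refine ⟨fun t ↦ γ (u t), ?_, ?_, fun t ht ↦ ⟨hN (hu t ht).1, (hu t ht).2⟩,
    fun s t hs hst ht ↦ ?_⟩
  · refine (hinj 0 (u 0) le_rfl hu0.1.1 hu0.1.2 ?_).symm
    rw [hu0.2]; ring
  · refine hinj (u 1) 1 hu1.1.1 hu1.1.2 le_rfl ?_
    rw [hu1.2, hτ]; ring
  · have hs' := hu s ⟨hs, (hst.trans_le ht).le⟩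
    have ht' := hu t ⟨hs.trans hst.le, ht⟩
    refine ⟨γ, u s, u t, ?_, hγ.mono (Icc_subset_Icc hs'.1.1 ht'.1.2),
      hN.mono_left (Icc_subset_Icc hs'.1.1 ht'.1.2), rfl, rfl⟩
    by_contra! hle
    have h1 := hmono' (u t) (u s) ht'.1.1 hle hs'.1.2
    rw [hs'.2, ht'.2] at h1
    nlinarith

/-- An achronal limit of causal curves, parametrized by `ℓ`, is a `C¹` causal curve. -/
theorem joins_of_achronal {c : ℝ → Eₙ} {τ : ℝ} (hτ : 0 < τ)
    (hc : ∀ t ∈ Icc (0 : ℝ) 1, c t ∈ Metric.closedBall (chartAt Eₙ p p) (Q.R / 2))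
    (hℓ : ∀ s ∈ Icc (0 : ℝ) 1, ∀ t ∈ Icc (0 : ℝ) 1, Q.ℓ (c t - c s) = τ * (t - s))
    (hnorm : ∀ s t, 0 ≤ s → s < t → t ≤ 1 → ‖c t - c s‖ ≤ Q.C * (τ * (t - s)))
    (hpull : ∀ s t, 0 ≤ s → s < t → t ≤ 1 → ∀ z ∈ Metric.closedBall (chartAt Eₙ p p) Q.R,
      g.pullback p z (c t - c s) (c t - c s) ≤
        Q.L * Q.C ^ 2 * (‖z - c s‖ + Q.C * (τ * (t - s))) * (τ * (t - s)) ^ 2)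
    (hach : ∀ s t, 0 ≤ s → s < t → t ≤ 1 →
      (chartAt Eₙ p).symm (c t) ∉ g.chronFuture ((chartAt Eₙ p).symm (c s))) :
    Joins g.FutureCausal univ ((chartAt Eₙ p).symm (c 0)) ((chartAt Eₙ p).symm (c 1)) := by
  have hL := Q.L_nonneg
  have hC := Q.C_pos
  have hcpos := Q.c_pos
  have hcR : ∀ t ∈ Icc (0 : ℝ) 1, c t ∈ Metric.closedBall (chartAt Eₙ p p) Q.R :=
    fun t ht ↦ Q.half_ball_subset (hc t ht)
  have hslope : ∀ s t : ℝ, s ≠ t → c t - c s = (t - s) • slope c s t := by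
    intro s t hst
    rw [slope_def_module, smul_smul, mul_inv_cancel₀ (sub_ne_zero.2 hst.symm), one_smul]
  set D := Q.L * Q.C ^ 3 * τ ^ 3 with hD
  have hDnn : 0 ≤ D := by positivity
  -- the forms evaluated on slopes
  have hup : ∀ s t, 0 ≤ s → s < t → t ≤ 1 → ∀ u, 0 ≤ u → u ≤ t → 
      g.pullback p (c u) (slope c s t) (slope c s t) ≤ D * (|u - s| + (t - s)) := by
    intro s t hs hst ht u hu hut
    have h0 : 0 < t - s := sub_pos.2 hst
    have hsI : s ∈ Icc (0 : ℝ) 1 := ⟨hs, by linarith⟩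
    have h1 := hpull s t hs hst ht (c u) (hcR u ⟨hu, by linarith⟩)
    have h2 : ‖c u - c s‖ ≤ Q.C * (τ * |u - s|) := by
      rcases lt_trichotomy u s with h | rfl | h
      · rw [norm_sub_rev, abs_sub_comm, abs_of_pos (sub_pos.2 h)]
        exact hnorm u s hu h hsI.2
      · simp
      · rw [abs_of_pos (sub_pos.2 h)]
        exact hnorm s u hs h (by linarith)
    have h3 : Q.L * Q.C ^ 2 * (‖c u - c s‖ + Q.C * (τ * (t - s))) * (τ * (t - s)) ^ 2 ≤
        Q.L * Q.C ^ 2 * (Q.C * (τ * |u - s|) + Q.C * (τ * (t - s))) * (τ * (t - s)) ^ 2 := by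
      gcongr
    rw [hslope s t hst.ne] at h1
    simp only [map_smul, smul_apply, smul_eq_mul] at h1
    have h4 : (t - s) ^ 2 * g.pullback p (c u) (slope c s t) (slope c s t) ≤
        (t - s) ^ 2 * (D * (|u - s| + (t - s))) := by
      calc _ = (t - s) * ((t - s) * g.pullback p (c u) (slope c s t) (slope c s t)) := by ring
        _ ≤ _ := h1.trans h3
        _ = _ := by rw [hD]; ring
    exact le_of_mul_le_mul_left h4 (by positivity)
  -- Achronality bounds the form from below: were it more negative, the straight segment from `c s`
  -- to `c t` would be timelike.
  have hlow : ∀ s t, 0 ≤ s → s < t → t ≤ 1 →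
      -(D * (t - s)) ≤ g.pullback p (c s) (slope c s t) (slope c s t) := by
    intro s t hs hst ht
    have h0 : 0 < t - s := sub_pos.2 hst
    have hsI : s ∈ Icc (0 : ℝ) 1 := ⟨hs, by linarith⟩
    have htI : t ∈ Icc (0 : ℝ) 1 := ⟨by linarith, ht⟩
    by_contra! hlt
    refine hach s t hs hst ht (Q.chron_of_neg (hcR s hsI) (hcR t htI) ?_ ?_)
    · rw [hℓ s hsI t htI]; positivity
    · have h1 : ‖c t - c s‖ ^ 3 ≤ (Q.C * (τ * (t - s))) ^ 3 := by
        gcongr; exact hnorm s t hs hst ht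
      have h2 : Q.L * ‖c t - c s‖ ^ 3 ≤ (t - s) ^ 2 * (D * (t - s)) := by
        calc _ ≤ Q.L * (Q.C * (τ * (t - s))) ^ 3 := by gcongr
          _ = _ := by rw [hD]; ring
      have h3 : g.pullback p (c s) (c t - c s) (c t - c s) =
          (t - s) ^ 2 * g.pullback p (c s) (slope c s t) (slope c s t) := by
        rw [hslope s t hst.ne]
        simp only [map_smul, smul_apply, smul_eq_mul]
        ring
      rw [h3]
      nlinarith [mul_lt_mul_of_pos_left hlt (pow_pos h0 2)]
  have hℓs : ∀ s ∈ Icc (0 : ℝ) 1, ∀ t ∈ Icc (0 : ℝ) 1, s ≠ t → Q.ℓ (slope c s t) = τ := by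
    intro s hs t ht hst
    have := hℓ s hs t ht
    rw [hslope s t hst, map_smul, smul_eq_mul, mul_comm] at this
    exact mul_right_cancel₀ (sub_ne_zero.2 hst.symm) this
  -- The slopes over adjacent intervals have the same `ℓ`, so the form is coercive on their
  -- difference. With interval lengths `α, β` its value there, times `αβ`, is `(α + β)(α A₁ + β A₂)
  -- - (α + β)² A`. The upper bound for `A₁, A₂` and the lower bound for `A` each contribute `D (α +
  -- β)³`.
  have hC1 : ContDiffOn ℝ 1 c (Icc 0 1) := by
    refine contDiffOn_one_of_slope (A := 2 * D / Q.c) one_pos (by positivity)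
      fun s m t hs ht hsm hmt ↦ ?_
    have hmI : m ∈ Icc (0 : ℝ) 1 := ⟨by linarith [hs.1], by linarith [ht.2]⟩
    set q₁ := slope c s m
    set q₂ := slope c m t
    set q := slope c s t
    have hq : (t - s) • q = (m - s) • q₁ + (t - m) • q₂ := by
      rw [← hslope s t (hsm.trans hmt).ne, ← hslope s m hsm.ne, ← hslope m t hmt.ne]
      abel
    have a1 := hup s m hs.1 hsm hmI.2 s hs.1 hsm.le
    have a2 := hup m t hmI.1 hmt ht.2 s hs.1 (by linarith)
    have a3 := hlow s t hs.1 (hsm.trans hmt) ht.2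
    rw [sub_self, abs_zero, zero_add] at a1
    rw [abs_sub_comm, abs_of_pos (sub_pos.2 hsm)] at a2
    have a4 := Q.coercive (c s) (hcR s hs) (q₁ - q₂)
      (by rw [map_sub, hℓs s hs m hmI hsm.ne, hℓs m hmI t ht hmt.ne, sub_self])
    have hsy := g.pullback_symm p (c s) q₂ q₁
    have key : (t - s) ^ 2 * g.pullback p (c s) q q =
        (m - s) ^ 2 * g.pullback p (c s) q₁ q₁ + 2 * ((m - s) * (t - m)) * g.pullback p (c s) q₁ q₂ +
        (t - m) ^ 2 * g.pullback p (c s) q₂ q₂ := by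
      have e1 : g.pullback p (c s) ((t - s) • q) ((t - s) • q) =
        (t - s) ^ 2 * g.pullback p (c s) q q := by
        simp only [map_smul, smul_apply, smul_eq_mul]; ring
      rw [← e1, hq]
      simp only [map_add, add_apply, map_smul, smul_apply, smul_eq_mul, hsy]
      ring
    simp only [map_sub, sub_apply, hsy] at a4
    have hp : 0 < m - s := sub_pos.2 hsm
    have hr : 0 < t - m := sub_pos.2 hmt
    set A₁ := g.pullback p (c s) q₁ q₁
    set A₂ := g.pullback p (c s) q₂ q₂
    set A₃ := g.pullback p (c s) q₁ q₂
    set A := g.pullback p (c s) q q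
    obtain ⟨α, hα⟩ : ∃ α, α = m - s := ⟨_, rfl⟩
    obtain ⟨β, hβ⟩ : ∃ β, β = t - m := ⟨_, rfl⟩
    have hαβ : t - s = α + β := by rw [hα, hβ]; ring
    rw [hαβ] at key a3 ⊢
    rw [← hα, ← hβ] at key a2
    rw [← hα] at a1 hp ⊢
    rw [← hβ] at hr ⊢
    have b1 : α * β * (Q.c * ‖q₁ - q₂‖ ^ 2) ≤ α * β * (A₁ - A₃ - (A₃ - A₂)) := by gcongr
    have b2 : α * β * (A₁ - A₃ - (A₃ - A₂)) = (α + β) * (α * A₁ + β * A₂) - (α + β) ^ 2 * A := by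
      rw [key]; ring
    have b3 : (α + β) * (α * A₁ + β * A₂) ≤ (α + β) * (α * (D * (α + β)) + β * (D * (α + β))) := by
      gcongr
      exact a1.trans (by gcongr; linarith)
    have b4 : (α + β) ^ 2 * -(D * (α + β)) ≤ (α + β) ^ 2 * A := by gcongr
    rw [div_mul_eq_mul_div, le_div_iff₀ hcpos]
    nlinarith
  have hder : ∀ t ∈ Icc (0 : ℝ) 1, HasDerivWithinAt c (derivWithin c (Icc 0 1) t) (Icc 0 1) t :=
    fun t ht ↦ ((hC1 t ht).differentiableWithinAt one_ne_zero).hasDerivWithinAt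
  have hcaus : ∀ t ∈ Icc (0 : ℝ) 1, g.pullback p (c t) (derivWithin c (Icc 0 1) t)
      (derivWithin c (Icc 0 1) t) ≤ 0 ∧ Q.ℓ (derivWithin c (Icc 0 1) t) = τ := by
    intro t ht
    have hlim := hasDerivWithinAt_iff_tendsto_slope.1 (hder t ht)
    have hne : (𝓝[Icc 0 1 \ {t}] t).NeBot := by
      have := ((uniqueDiffOn_Icc (zero_lt_one (α := ℝ))) t ht).accPt
      rwa [accPt_principal_iff_nhdsWithin] at this
    constructor
    · have h1 : Continuous fun v ↦ g.pullback p (c t) v v := by fun_prop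
      have h2 : Tendsto (fun s : ℝ ↦ 2 * D * |s - t|) (𝓝[Icc 0 1 \ {t}] t) (𝓝 0) := by
        have : Continuous fun s : ℝ ↦ 2 * D * |s - t| := by fun_prop
        have := this.tendsto t
        rw [sub_self, abs_zero, mul_zero] at this
        exact this.mono_left nhdsWithin_le_nhds
      refine le_of_tendsto_of_tendsto ((h1.tendsto _).comp hlim) h2 ?_
      filter_upwards [self_mem_nhdsWithin] with s hs
      simp only [Function.comp]
      rcases lt_or_gt_of_ne (show s ≠ t from hs.2) with h | h
      · rw [slope_comm]
        have := hup s t hs.1.1 h ht.2 t ht.1 le_rfl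
        rw [abs_sub_comm s t, abs_of_pos (sub_pos.2 h)] 
        rw [abs_of_pos (sub_pos.2 h)] at this
        linarith
      · have := hup t s ht.1 h hs.1.2 t ht.1 h.le
        rw [sub_self, abs_zero, zero_add] at this
        rw [abs_of_pos (sub_pos.2 h)]
        nlinarith [mul_nonneg hDnn (sub_pos.2 h).le]
    · refine tendsto_nhds_unique ((Q.ℓ.continuous.tendsto _).comp hlim) ?_
      refine tendsto_const_nhds.congr' ?_
      filter_upwards [self_mem_nhdsWithin] with s hs
      exact (hℓs t ht s hs.1 (Ne.symm hs.2)).symm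
  have hcurve : C1With g.FutureCausal ((chartAt Eₙ p).symm ∘ c) 0 1 := by
    refine C1With.of_chart one_pos hC1 (fun t ht ↦ Q.ball_subset (hcR t ht)) fun t ht ↦ ?_
    obtain ⟨h1, h2⟩ := hcaus t ht
    refine (Q.futureCausal_iff (hcR t ht) _).2 ⟨?_, h1, by rw [h2]; exact hτ⟩
    intro h0
    rw [h0, map_zero] at h2
    exact hτ.ne h2
  exact ⟨_, hcurve.piecewise, mapsTo_univ _ _, rfl, rfl⟩

/-- The causal relation of a coordinate ball is closed. -/
theorem causalLE_of_tendsto [T2Space M] {ι : Type*} {𝓖 : Ultrafilter ι} {a b : ι → M} {x y : M}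
    (ha : Tendsto a 𝓖 (𝓝 x)) (hb : Tendsto b 𝓖 (𝓝 y))
    (h : ∀ᶠ i in 𝓖, g.CausalLE (Q.region (Q.R / 2)) (a i) (b i)) : g.CausalLE univ x y := by
  have hC := Q.C_pos
  rcases Ultrafilter.eventually_or.1 h with heq | hJ
  · refine Or.inl ⟨tendsto_nhds_unique (ha.congr' ?_) hb, mem_univ _⟩
    filter_upwards [heq] with i hi using hi.1
  replace hJ : ∀ᶠ i in 𝓖, Joins g.FutureCausal (Q.region (Q.R / 2)) (a i) (b i) := hJ
  have hclosed := (Q.isCompact_region Q.half_le).isClosed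
  have hx : x ∈ Q.region (Q.R / 2) := hclosed.mem_of_tendsto ha (by
    filter_upwards [hJ] with i hi
    obtain ⟨γ, -, hm, h0, -⟩ := hi
    exact h0 ▸ hm (left_mem_Icc.2 zero_le_one))
  have hy : y ∈ Q.region (Q.R / 2) := hclosed.mem_of_tendsto hb (by
    filter_upwards [hJ] with i hi
    obtain ⟨γ, -, hm, -, h1⟩ := hi
    exact h1 ▸ hm (right_mem_Icc.2 zero_le_one))
  obtain ⟨hxs, hxb⟩ := (Q.mem_region_iff Q.half_le).1 hx
  obtain ⟨hys, hyb⟩ := (Q.mem_region_iff Q.half_le).1 hy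
  set φ := chartAt Eₙ p with hφ
  have hA : Tendsto (fun i ↦ φ (a i)) 𝓖 (𝓝 (φ x)) := (φ.continuousAt hxs).tendsto.comp ha
  have hB : Tendsto (fun i ↦ φ (b i)) 𝓖 (𝓝 (φ y)) := (φ.continuousAt hys).tendsto.comp hb
  have hnorm : ‖φ y - φ x‖ ≤ Q.C * Q.ℓ (φ y - φ x) := by
    refine le_of_tendsto_of_tendsto (hB.sub hA).norm
      (((Q.ℓ.continuous.tendsto _).comp (hB.sub hA)).const_mul _) ?_
    filter_upwards [hJ] with i hi
    obtain ⟨γ, hγ, hm, h0, h1⟩ := hi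
    have := Q.norm_displacement_le zero_le_one hγ hm
    rwa [h0, h1] at this
  -- If `ℓ` does not increase from `x` to `y`, the curves shrink to a point and `x = y`.
  rcases (Q.ℓ_nonneg_of_norm_le hnorm).eq_or_lt with h0 | hτ
  · refine Or.inl ⟨?_, mem_univ _⟩
    exact φ.injOn hxs hys (sub_eq_zero.1 (Q.eq_of_ℓ_eq_zero hnorm h0.symm)).symm
  refine Or.inr ?_
  set τ := Q.ℓ (φ y - φ x) with hτdef
  have hlt : ∀ᶠ i in 𝓖, Q.ℓ (φ (a i)) < Q.ℓ (φ (b i)) := by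
    have := ((Q.ℓ.continuous.tendsto _).comp (hB.sub hA)).eventually (lt_mem_nhds hτ)
    filter_upwards [this] with i hi
    simp only [Function.comp, map_sub] at hi
    linarith
  have hex := hJ.and hlt
  replace hex := hex.mono fun i hi ↦ Q.exists_level hi.1 hi.2
  obtain ⟨f, hf⟩ := hex.choice
  -- The limit curve is taken pointwise along the ultrafilter; its Lipschitz bound is inherited from
  -- the estimates on displacements.
  have hlim : ∀ t : ℝ, ∃ z : Eₙ, t ∈ Icc (0 : ℝ) 1 →
      z ∈ Metric.closedBall (φ p) (Q.R / 2) ∧ Tendsto (fun i ↦ φ (f i t)) 𝓖 (𝓝 z) := by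
    intro t
    by_cases ht : t ∈ Icc (0 : ℝ) 1
    · obtain ⟨z, hz, hz'⟩ := (isCompact_closedBall (φ p) (Q.R / 2)).ultrafilter_le_nhds
        (𝓖.map fun i ↦ φ (f i t)) (by
          rw [le_principal_iff]
          change ∀ᶠ i in 𝓖, φ (f i t) ∈ _
          filter_upwards [hf] with i hi
          exact ((Q.mem_region_iff Q.half_le).1 (hi.2.2.1 t ht).1).2)
      exact ⟨z, fun _ ↦ ⟨hz, hz'⟩⟩
    · exact ⟨0, fun h ↦ absurd h ht⟩
  choose c hc using hlim
  have h0I : (0 : ℝ) ∈ Icc (0 : ℝ) 1 := left_mem_Icc.2 zero_le_one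
  have h1I : (1 : ℝ) ∈ Icc (0 : ℝ) 1 := right_mem_Icc.2 zero_le_one
  have hc0 : c 0 = φ x := tendsto_nhds_unique (hc 0 h0I).2 (hA.congr' (by
    filter_upwards [hf] with i hi
    rw [hi.1]))
  have hc1 : c 1 = φ y := tendsto_nhds_unique (hc 1 h1I).2 (hB.congr' (by
    filter_upwards [hf] with i hi
    rw [hi.2.1]))
  have hℓc : ∀ t ∈ Icc (0 : ℝ) 1, Q.ℓ (c t) = Q.ℓ (φ x) + t * τ := by
    intro t ht
    have h1 : Tendsto (fun i ↦ Q.ℓ (φ (f i t))) 𝓖 (𝓝 (Q.ℓ (c t))) :=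
      (Q.ℓ.continuous.tendsto _).comp (hc t ht).2
    have h2 : Tendsto (fun i ↦ Q.ℓ (φ (a i)) + t * (Q.ℓ (φ (b i)) - Q.ℓ (φ (a i)))) 𝓖
        (𝓝 (Q.ℓ (φ x) + t * (Q.ℓ (φ y) - Q.ℓ (φ x)))) :=
      ((Q.ℓ.continuous.tendsto _).comp hA).add ((((Q.ℓ.continuous.tendsto _).comp hB).sub
        ((Q.ℓ.continuous.tendsto _).comp hA)).const_mul t)
    rw [hτdef, map_sub]
    refine tendsto_nhds_unique h1 (h2.congr' ?_)
    filter_upwards [hf] with i hi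
    exact (hi.2.2.1 t ht).2.symm
  have hℓc' : ∀ s ∈ Icc (0 : ℝ) 1, ∀ t ∈ Icc (0 : ℝ) 1, Q.ℓ (c t - c s) = τ * (t - s) := by
    intro s hs t ht
    rw [map_sub, hℓc s hs, hℓc t ht]
    ring
  have hdiff : ∀ s ∈ Icc (0 : ℝ) 1, ∀ t ∈ Icc (0 : ℝ) 1,
      Tendsto (fun i ↦ φ (f i t) - φ (f i s)) 𝓖 (𝓝 (c t - c s)) := fun s hs t ht ↦
    (hc t ht).2.sub (hc s hs).2
  by_cases hach : ∀ s t, 0 ≤ s → s < t → t ≤ 1 → φ.symm (c t) ∉ g.chronFuture (φ.symm (c s))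
  · have := Q.joins_of_achronal hτ (fun t ht ↦ (hc t ht).1) hℓc' (fun s t hs hst ht ↦ ?_)
      (fun s t hs hst ht z hz ↦ ?_) hach
    · rwa [hc0, hc1, φ.left_inv hxs, φ.left_inv hys] at this
    · have hsI : s ∈ Icc (0 : ℝ) 1 := ⟨hs, by linarith⟩
      have htI : t ∈ Icc (0 : ℝ) 1 := ⟨by linarith, ht⟩
      rw [← hℓc' s hsI t htI]
      refine le_of_tendsto_of_tendsto (hdiff s hsI t htI).norm
        (((Q.ℓ.continuous.tendsto _).comp (hdiff s hsI t htI)).const_mul _) ?_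
      filter_upwards [hf] with i hi
      obtain ⟨γ, a', b', hab, hγ, hm, e0, e1⟩ := hi.2.2.2 s t hs hst ht
      have := Q.norm_displacement_le hab.le hγ hm
      rwa [e0, e1] at this
    · have hsI : s ∈ Icc (0 : ℝ) 1 := ⟨hs, by linarith⟩
      have htI : t ∈ Icc (0 : ℝ) 1 := ⟨by linarith, ht⟩
      rw [← hℓc' s hsI t htI]
      have hd := hdiff s hsI t htI
      have hℓd := (Q.ℓ.continuous.tendsto _).comp hd
      have hpc : Continuous fun v ↦ g.pullback p z v v := by fun_prop
      refine le_of_tendsto_of_tendsto ((hpc.tendsto _).comp hd)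
        ((((((hc s hsI).2.const_sub z).norm).add (hℓd.const_mul Q.C)).const_mul
          (Q.L * Q.C ^ 2)).mul (hℓd.pow 2)) ?_
      filter_upwards [hf] with i hi
      obtain ⟨γ, a', b', hab, hγ, hm, e0, e1⟩ := hi.2.2.2 s t hs hst ht
      have := Q.pullback_displacement_le hab.le hγ hm hz (Δ := φ (f i t) - φ (f i s))
        (by rw [e0, e1])
      rwa [e0] at this
  · push Not at hach
    obtain ⟨s, t, hs, hst, ht, hch⟩ := hach
    have hsI : s ∈ Icc (0 : ℝ) 1 := ⟨hs, by linarith⟩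
    have htI : t ∈ Icc (0 : ℝ) 1 := ⟨by linarith, ht⟩
    -- Push an approximating curve so that it starts at `x` and passes close enough to `c s` to
    -- enter the open past of `c t`. The end at `y` is treated in the same way below.
    have hx' : φ.symm (c t) ∈ g.chronFuture x := by
      rcases hs.eq_or_lt with rfl | hs0
      · rwa [hc0, φ.left_inv hxs] at hch
      · have hnh : {q | φ.symm q ∈ {w | φ.symm (c t) ∈ g.chronFuture w}} ∈ 𝓝 (c s) :=
          Q.tendsto_symm (Q.half_ball_subset (hc s hsI).1) ((g.isOpen_chronPast _).mem_nhds hch)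
        obtain ⟨r, hr, hball⟩ := Metric.mem_nhds_iff.1 hnh
        obtain ⟨δ, hδ, hpush⟩ := Q.exists_push_from (half_pos hr)
        obtain ⟨i, hi, hi1, hi2⟩ := (hf.and ((hA.eventually (Metric.ball_mem_nhds _ hδ)).and
          ((hc s hsI).2.eventually (Metric.ball_mem_nhds _ (half_pos hr))))).exists
        obtain ⟨γ, a', b', hab, hγ, hm, e0, e1⟩ := hi.2.2.2 0 s le_rfl hs0 hsI.2
        have hj := Joins.of_Icc hab g.futureCausal_smul hγ hm
        rw [e0, e1, hi.1] at hj
        obtain ⟨z', hz', hch'⟩ := hpush _ _ hj (φ x) (by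
          rw [← dist_eq_norm, dist_comm]; exact hi1)
        rw [φ.left_inv hxs] at hch'
        refine chronFuture_trans hch' (hball ?_)
        rw [Metric.mem_ball]
        have := dist_triangle z' (φ (f i s)) (c s)
        have h3 : dist (φ (f i s)) (c s) < r / 2 := hi2
        rw [← dist_eq_norm] at hz'
        linarith
    apply joins_causal_of_mem_chronFuture
    rcases ht.eq_or_lt with rfl | ht1
    · rwa [hc1, φ.left_inv hys] at hx'
    · have hnh : {q | φ.symm q ∈ g.chronFuture x} ∈ 𝓝 (c t) :=
        Q.tendsto_symm (Q.half_ball_subset (hc t htI).1) ((g.isOpen_chronFuture _).mem_nhds hx')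
      obtain ⟨r, hr, hball⟩ := Metric.mem_nhds_iff.1 hnh
      obtain ⟨δ, hδ, hpush⟩ := Q.exists_push_to (half_pos hr)
      obtain ⟨i, hi, hi1, hi2⟩ := (hf.and ((hB.eventually (Metric.ball_mem_nhds _ hδ)).and
        ((hc t htI).2.eventually (Metric.ball_mem_nhds _ (half_pos hr))))).exists
      obtain ⟨γ, a', b', hab, hγ, hm, e0, e1⟩ := hi.2.2.2 t 1 htI.1 ht1 le_rfl
      have hj := Joins.of_Icc hab g.futureCausal_smul hγ hm
      rw [e0, e1, hi.2.1] at hj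
      obtain ⟨z', hz', hch'⟩ := hpush _ _ hj (φ y) (by
        rw [← dist_eq_norm, dist_comm]; exact hi1)
      rw [φ.left_inv hys] at hch'
      refine chronFuture_trans (hball ?_) hch'
      rw [Metric.mem_ball]
      have := dist_triangle z' (φ (f i t)) (c t)
      have h3 : dist (φ (f i t)) (c t) < r / 2 := hi2
      rw [← dist_eq_norm] at hz'
      linarith

end Patch

end LocalClosed

/-! ### Positivity of the volume of nonempty open sets. -/

section Volume

set_option linter.unusedSectionVars false

variable {n : ℕ} {M : Type*} [TopologicalSpace M]
  [ChartedSpace (EuclideanSpace ℝ (Fin (n + 1))) M] [IsManifold (𝓡 (n + 1)) ∞ M]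

local notation "Eₙ" => EuclideanSpace ℝ (Fin (n + 1))

namespace Spacetime

variable (g : Spacetime n M)

theorem gram_apply (x : M) (z : Eₙ) (i j : Fin (n + 1)) :
    g.gram x z i j = g.pullback x z (EuclideanSpace.single i 1) (EuclideanSpace.single j 1) := rfl

/-- A null vector of the Gram matrix is orthogonal to everything, in particular to the time field.
Positivity on the complement of the time field contradicts its being orthogonal to itself. -/
theorem det_gram_ne_zero (x : M) {z : Eₙ} (hz : z ∈ (chartAt Eₙ x).target) :
    (g.gram x z).det ≠ 0 := by
  intro h
  obtain ⟨v, hv, hv0⟩ := Matrix.exists_mulVec_eq_zero_iff.2 h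
  set V : Eₙ := WithLp.toLp 2 v with hV
  have hVsum : V = ∑ j, v j • EuclideanSpace.single j (1 : ℝ) := by
    ext k
    simp [hV, Finset.sum_apply, Pi.single_apply]
  have h1 : ∀ i, g.pullback x z (EuclideanSpace.single i 1) V = 0 := by
    intro i
    have := congrFun hv0 i
    simp only [Matrix.mulVec, dotProduct, g.gram_apply, Pi.zero_apply] at this
    rw [hVsum, map_sum, ← this]
    exact Finset.sum_congr rfl fun j _ ↦ by rw [map_smul, smul_eq_mul, mul_comm]
  have h2 : ∀ w : Eₙ, g.pullback x z w V = 0 := by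
    intro w
    have hw : w = ∑ j, w j • EuclideanSpace.single j (1 : ℝ) := by
      ext k
      simp [Finset.sum_apply, Pi.single_apply]
    rw [g.pullback_symm, hw, map_sum]
    exact Finset.sum_eq_zero fun j _ ↦ by rw [map_smul, g.pullback_symm, h1, smul_zero]
  obtain ⟨T, -, hT⟩ := g.exists_coord_timeField x
  have h3 := h2 (T z)
  rw [g.pullback_apply, hT z hz] at h3
  have hV0 : V ≠ 0 := by
    intro h0
    apply hv
    ext i
    simpa [hV] using congrArg (fun u : Eₙ ↦ u i) h0
  have h4 := g.metric_pos _ (chartFrame x z V) h3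
    fun h0 ↦ hV0 (chartFrame_injective hz (h0.trans (map_zero _).symm))
  rw [← g.pullback_apply, h2] at h4
  exact lt_irrefl _ h4

theorem continuousOn_det_gram (x : M) :
    ContinuousOn (fun z ↦ (g.gram x z).det) (chartAt Eₙ x).target := by
  have hG := (g.contDiffOn_pullback x).continuousOn
  have h1 : ContinuousOn (g.gram x) (chartAt Eₙ x).target := by
    refine continuousOn_pi.2 fun i ↦ continuousOn_pi.2 fun j ↦ ?_
    exact (hG.clm_apply continuousOn_const).clm_apply continuousOn_const
  exact (continuous_id.matrix_det).comp_continuousOn h1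

variable [MeasurableSpace M] [BorelSpace M]

theorem vol_pos_of_isOpen {O : Set M} (hO : IsOpen O) (hne : O.Nonempty) : 0 < g.vol O := by
  obtain ⟨x, hx⟩ := hne
  refine lt_of_lt_of_le ?_ (le_iSup g.chartVol x O)
  set φ := chartAt Eₙ x with hφ
  set f : Eₙ → ENNReal := fun z ↦ ENNReal.ofReal √|(g.gram x z).det| with hf
  -- The inverse chart is controlled only on its target, which carries this measure.
  have hmeas : AEMeasurable φ.symm ((volume.restrict φ.target).withDensity f) :=
    (φ.continuousOn_symm.aemeasurable φ.open_target.measurableSet).mono_ac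
      (withDensity_absolutelyContinuous _ _)
  have hV : IsOpen (φ.target ∩ φ.symm ⁻¹' O) := φ.isOpen_inter_preimage_symm hO
  have hVne : (φ.target ∩ φ.symm ⁻¹' O).Nonempty :=
    ⟨φ x, mem_chart_target _ x, by
      rw [mem_preimage, φ.left_inv (mem_chart_source _ x)]; exact hx⟩
  change 0 < Measure.map φ.symm ((volume.restrict φ.target).withDensity f) O
  rw [Measure.map_apply_of_aemeasurable hmeas hO.measurableSet]
  refine lt_of_lt_of_le ?_ (measure_mono (inter_subset_right (s := φ.target)))
  rw [withDensity_apply _ hV.measurableSet, Measure.restrict_restrict hV.measurableSet,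
    inter_eq_self_of_subset_left inter_subset_left, pos_iff_ne_zero]
  intro h0
  have hfc : ContinuousOn f (φ.target ∩ φ.symm ⁻¹' O) := by
    have h1 : Continuous fun r : ℝ ↦ ENNReal.ofReal √|r| :=
      ENNReal.continuous_ofReal.comp (Real.continuous_sqrt.comp continuous_abs)
    exact h1.comp_continuousOn ((g.continuousOn_det_gram x).mono inter_subset_left)
  rw [lintegral_eq_zero_iff' (hfc.aemeasurable hV.measurableSet)] at h0
  have h1 := (ae_restrict_iff' hV.measurableSet).1 h0
  have h2 : ∀ᵐ z ∂(volume : Measure Eₙ), z ∉ φ.target ∩ φ.symm ⁻¹' O := by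
    filter_upwards [h1] with z hz hzV
    have := hz hzV
    simp only [hf, Pi.zero_apply, ENNReal.ofReal_eq_zero] at this
    exact absurd (Real.sqrt_pos.2 (abs_pos.2 (g.det_gram_ne_zero x hzV.1))) (not_lt.2 this)
  have h3 : (volume : Measure Eₙ) (φ.target ∩ φ.symm ⁻¹' O) = 0 :=
    measure_eq_zero_iff_ae_notMem.2 h2
  exact (hV.measure_pos volume hVne).ne' h3

end Spacetime

end Volume

/-! ### Parameter intervals, and vanishing from global hyperbolicity. -/

section VanishingOfHyperbolic

set_option linter.unusedSectionVars false

namespace Spacetime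

theorem eventually_towards {b : EReal} {s : ℝ} (hs : s ∈ paramInterval b) :
    ∀ᶠ t in towards b, s < t ∧ t ∈ paramInterval b := by
  have h : Ioo (s : EReal) b ∈ 𝓝[<] b := Ioo_mem_nhdsLT hs.2
  filter_upwards [preimage_mem_comap h] with t ht
  have h1 : s < t := EReal.coe_lt_coe_iff.1 ht.1
  exact ⟨h1, hs.1.trans h1.le, ht.2⟩

theorem towards_neBot {b : EReal} (hb : 0 < b) : (towards b).NeBot := by
  refine comap_neBot_iff.2 fun t ht ↦ ?_
  obtain ⟨l, hl, hlt⟩ := (mem_nhdsLT_iff_exists_Ioo_subset' hb).1 ht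
  obtain ⟨r, hr1, hr2⟩ := EReal.lt_iff_exists_real_btwn.1 hl
  exact ⟨r, hlt ⟨hr1, hr2⟩⟩

instance towards_isCountablyGenerated (b : EReal) : (towards b).IsCountablyGenerated := by
  unfold towards
  infer_instance

theorem zero_mem_paramInterval {b : EReal} (hb : 0 < b) : (0 : ℝ) ∈ paramInterval b :=
  ⟨le_rfl, by exact_mod_cast hb⟩

theorem Icc_subset_paramInterval {b : EReal} {s t : ℝ} (hs : s ∈ paramInterval b)
    (ht : t ∈ paramInterval b) : Icc s t ⊆ paramInterval b := fun _ hu ↦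
  ⟨hs.1.trans hu.1, (EReal.coe_le_coe_iff.2 hu.2).trans_lt ht.2⟩

theorem paramInterval_top : paramInterval ⊤ = Ici 0 := by
  ext s
  simp [paramInterval]

theorem towards_top : towards ⊤ = atTop := by
  have h : Iio (⊤ : EReal) = {⊤}ᶜ := by
    ext x; simp [lt_top_iff_ne_top]
  rw [towards, h, EReal.nhdsWithin_top, comap_map EReal.coe_injective]

variable {n : ℕ} {M : Type*} [TopologicalSpace M]
  [ChartedSpace (EuclideanSpace ℝ (Fin (n + 1))) M] [IsManifold (𝓡 (n + 1)) ∞ M]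

local notation "Eₙ" => EuclideanSpace ℝ (Fin (n + 1))

variable {g : Spacetime n M}

theorem CausalLE.target_mem {U : Set M} {x y : M} (h : g.CausalLE U x y) : y ∈ U := by
  rcases h with ⟨rfl, h⟩ | ⟨γ, -, hm, -, rfl⟩
  · exact h
  · exact hm (right_mem_Icc.2 zero_le_one)

theorem causalLE_of_Icc {γ : ℝ → M} {U : Set M} {a b : ℝ} (hab : a ≤ b)
    (hγ : g.IsCausalCurve γ (Icc a b)) (hU : MapsTo γ (Icc a b) U) :
    g.CausalLE U (γ a) (γ b) := by
  rcases hab.eq_or_lt with rfl | hlt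
  · exact Or.inl ⟨rfl, hU (left_mem_Icc.2 le_rfl)⟩
  · exact Or.inr (Joins.of_Icc hlt g.futureCausal_smul hγ hU)

/-- In a future set, causal curves from points of the set stay in it. -/
theorem CausalLE.restrict {U : Set M} (hU : ∀ x ∈ U, ∀ y, g.CausalLE univ x y → y ∈ U) {x y : M}
    (hx : x ∈ U) (h : g.CausalLE univ x y) : g.CausalLE U x y := by
  rcases h with ⟨rfl, -⟩ | ⟨γ, hγ, -, rfl, rfl⟩
  · exact Or.inl ⟨rfl, hx⟩
  · refine causalLE_of_Icc zero_le_one hγ fun t ht ↦ hU _ hx _ ?_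
    exact causalLE_of_Icc ht.1 (PiecewiseC1With.mono hγ (Icc_subset_Icc_right ht.2))
      (mapsTo_univ _ _)

theorem causalLE_of_mem_chronFuture {x y : M} (h : y ∈ g.chronFuture x) : g.CausalLE univ x y :=
  Or.inr (joins_causal_of_mem_chronFuture h)

variable [MeasurableSpace M] [BorelSpace M]

theorem mem_finiteFutureRegion_of_causalLE {x y : M} (hx : x ∈ g.finiteFutureRegion)
    (h : g.CausalLE univ x y) : y ∈ g.finiteFutureRegion :=
  (measure_mono h.chronFuture_subset).trans_lt hx

theorem futureVolumeVanishes_of_globallyHyperbolic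
    (hGH : g.GloballyHyperbolicOn g.finiteFutureRegion) : g.FutureVolumeVanishes := by
  intro b γ hb ⟨hγ, hinext⟩ hfin
  have h0 := zero_mem_paramInterval hb
  have hne := towards_neBot hb
  have hle : ∀ s ∈ paramInterval b, ∀ t ∈ paramInterval b, s ≤ t →
      g.CausalLE univ (γ s) (γ t) := fun s hs t ht hst ↦
    causalLE_of_Icc hst (PiecewiseC1With.mono hγ (Icc_subset_paramInterval hs ht)) (mapsTo_univ _ _)
  have hB : ∀ s ∈ paramInterval b, γ s ∈ g.finiteFutureRegion := fun s hs ↦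
    mem_finiteFutureRegion_of_causalLE hfin (hle 0 h0 s hs hs.1)
  have hBfut : ∀ x ∈ g.finiteFutureRegion, ∀ y, g.CausalLE univ x y → y ∈ g.finiteFutureRegion :=
    fun x hx y h ↦ mem_finiteFutureRegion_of_causalLE hx h
  by_contra hnot
  rw [ENNReal.tendsto_nhds_zero] at hnot
  push Not at hnot
  obtain ⟨ε, hε, hfreq⟩ := hnot
  -- The volume is monotone along the curve, so a lower bound at arbitrarily late parameters holds
  -- at all of them.
  have hge : ∀ s ∈ paramInterval b, ε ≤ g.vol (g.chronFuture (γ s)) := by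
    intro s hs
    obtain ⟨t, ht, ht'⟩ := (hfreq.and_eventually (eventually_towards hs)).exists
    exact ht.le.trans (measure_mono (hle s hs t ht'.2 ht'.1.le).chronFuture_subset)
  obtain ⟨u, hu⟩ := exists_seq_tendsto (towards b)
  have hu0 : ∀ᶠ k in atTop, u k ∈ paramInterval b :=
    (hu.eventually (eventually_towards h0)).mono fun k hk ↦ hk.2
  obtain ⟨k₀, hk₀⟩ := eventually_atTop.1 hu0
  -- Continuity from above needs a countable family; the shift keeps the sequence inside `[0, b)`.
  set v : ℕ → ℝ := fun k ↦ u (k + k₀) with hv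
  have hvI : ∀ k, v k ∈ paramInterval b := fun k ↦ hk₀ _ (Nat.le_add_left _ _)
  have hvt : Tendsto v atTop (towards b) := hu.comp (tendsto_add_atTop_nat k₀)
  have hvlt : ∀ s ∈ paramInterval b, ∀ᶠ k in atTop, s < v k := fun s hs ↦
    (hvt.eventually (eventually_towards hs)).mono fun k hk ↦ hk.1
  have hmeas := Directed.measure_iInter (μ := g.vol) (s := fun k ↦ g.chronFuture (γ (v k)))
    (fun k ↦ (g.isOpen_chronFuture _).measurableSet.nullMeasurableSet) (fun i j ↦ by
      obtain ⟨k, hki, hkj⟩ := ((hvlt _ (hvI i)).and (hvlt _ (hvI j))).exists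
      exact ⟨k, (hle _ (hvI i) _ (hvI k) hki.le).chronFuture_subset,
        (hle _ (hvI j) _ (hvI k) hkj.le).chronFuture_subset⟩) ⟨0, (hB _ (hvI 0)).ne⟩
  have hpos : g.vol (⋂ k, g.chronFuture (γ (v k))) ≠ 0 := by
    rw [hmeas]
    exact (hε.trans_le (le_iInf fun k ↦ hge _ (hvI k))).ne'
  obtain ⟨q, hq⟩ := nonempty_of_measure_ne_zero hpos
  have hq' : ∀ s ∈ paramInterval b, g.CausalLE univ (γ s) q := by
    intro s hs
    obtain ⟨k, hk⟩ := (hvlt s hs).exists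
    exact (hle s hs _ (hvI k) hk.le).trans (causalLE_of_mem_chronFuture (mem_iInter.1 hq k))
  have hqB := hBfut _ hfin q (hq' 0 h0)
  have hK := hGH.2 (γ 0) hfin q hqB
  have hmem : ∀ᶠ s in towards b,
      γ s ∈ {x : M | g.CausalLE g.finiteFutureRegion (γ 0) x ∧ g.CausalLE g.finiteFutureRegion x q} := by
    filter_upwards [eventually_towards h0] with s hs
    exact ⟨CausalLE.restrict hBfut hfin (hle 0 h0 s hs.2 hs.1.le),
      CausalLE.restrict hBfut (hB s hs.2) (hq' s hs.2)⟩
  obtain ⟨p, hp, hcl⟩ := hK (f := map γ (towards b)) (le_principal_iff.2 hmem)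
  refine hinext ⟨p, fun W hW ↦ ?_⟩
  -- The curve returns to `V` arbitrarily late, and between two visits it cannot leave `W`; so the
  -- cluster point is a limit.
  obtain ⟨V, hV, -, hSC⟩ := hGH.1 p hp.1.target_mem W hW
  have hfreqV : ∃ᶠ s in towards b, γ s ∈ V := mapClusterPt_iff_frequently.1 hcl V hV
  obtain ⟨s, hsV, -, hs⟩ := (hfreqV.and_eventually (eventually_towards h0)).exists
  rw [mem_map]
  filter_upwards [eventually_towards hs] with t ht
  obtain ⟨t', ht'V, htt', ht'⟩ := (hfreqV.and_eventually (eventually_towards ht.2)).exists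
  have hsub := Icc_subset_paramInterval hs ht'
  exact hSC γ s t' (ht.1.trans htt').le (PiecewiseC1With.mono hγ hsub) (fun r hr ↦ hB r (hsub hr))
    hsV ht'V ⟨ht.1.le, htt'.le⟩

/-- Along a chain of causally related points without limit the volumes of the futures tend to
zero. -/
theorem FutureVolumeVanishes.tendsto_chain (h : g.FutureVolumeVanishes) {z : ℕ → M}
    (hz : ∀ i, Joins g.FutureCausal univ (z i) (z (i + 1))) (h0 : z 0 ∈ g.finiteFutureRegion)
    (hlim : ¬ ∃ p, Tendsto z atTop (𝓝 p)) :
    Tendsto (fun i ↦ g.vol (g.chronFuture (z i))) atTop (𝓝 0) := by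
  -- The concatenated curve is inextendible because its values at the integers already have no
  -- limit.
  obtain ⟨γ, hγ, -, hγz⟩ := exists_curve_of_chain g.futureCausal_smul hz
  have hγ0 : γ 0 = z 0 := by simpa using hγz 0
  have := h ⊤ γ (by simp) ⟨by rwa [paramInterval_top], ?_⟩ (by rw [hγ0]; exact h0)
  · rw [towards_top] at this
    simpa only [Function.comp_def, hγz] using this.comp tendsto_natCast_atTop_atTop
  · rintro ⟨p, hp⟩
    rw [towards_top] at hp
    refine hlim ⟨p, ?_⟩
    simpa only [Function.comp_def, hγz] using hp.comp tendsto_natCast_atTop_atTop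

end Spacetime

end VanishingOfHyperbolic

/-! ### Global hyperbolicity of the interior from vanishing. -/

section HyperbolicOfVanishing

set_option linter.unusedSectionVars false

theorem exists_seq_of_step {α : Type*} {P : ℕ → α → Prop} {R : α → α → Prop} {a₀ : α}
    (h0 : P 0 a₀) (h : ∀ i a, P i a → ∃ b, P (i + 1) b ∧ R a b) :
    ∃ f : ℕ → α, f 0 = a₀ ∧ (∀ i, P i (f i)) ∧ ∀ i, R (f i) (f (i + 1)) := by
  choose! s hs using h
  set f : ℕ → α := fun i ↦ Nat.rec a₀ s i with hf
  have hP : ∀ i, P i (f i) := by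
    intro i
    induction i with
    | zero => exact h0
    | succ i ih => exact (hs i _ ih).1
  exact ⟨f, rfl, hP, fun i ↦ (hs i _ (hP i)).2⟩

theorem IsCompact.exists_tendsto_of_ultrafilter {X ι : Type*} [TopologicalSpace X] {K : Set X}
    (hK : IsCompact K) {𝓖 : Ultrafilter ι} {f : ι → X} (h : ∀ᶠ i in 𝓖, f i ∈ K) :
    ∃ y ∈ K, Tendsto f 𝓖 (𝓝 y) :=
  isCompact_iff_ultrafilter_le_nhds.1 hK (𝓖.map f) (le_principal_iff.2 h)

variable {n : ℕ} {M : Type*} [TopologicalSpace M]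
  [ChartedSpace (EuclideanSpace ℝ (Fin (n + 1))) M] [IsManifold (𝓡 (n + 1)) ∞ M]

local notation "Eₙ" => EuclideanSpace ℝ (Fin (n + 1))

variable {g : Spacetime n M}

namespace Patch

variable {p : M} (Q : Patch g p)

/-- The open coordinate ball of radius `r`. -/
def core (_ : Patch g p) (r : ℝ) : Set M :=
  (chartAt Eₙ p).source ∩ chartAt Eₙ p ⁻¹' Metric.ball (chartAt Eₙ p p) r

theorem isOpen_core (r : ℝ) : IsOpen (Q.core r) :=
  (chartAt Eₙ p).isOpen_inter_preimage Metric.isOpen_ball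

theorem mem_core {r : ℝ} (hr : 0 < r) : p ∈ Q.core r :=
  ⟨mem_chart_source _ p, Metric.mem_ball_self hr⟩

theorem core_subset_region {r : ℝ} (hr : r ≤ Q.R) : Q.core r ⊆ Q.region r := fun _ hx ↦
  (Q.mem_region_iff hr).2 ⟨hx.1, Metric.ball_subset_closedBall hx.2⟩

theorem region_subset_core {r r' : ℝ} (hr : r ≤ Q.R) (hrr : r < r') : Q.region r ⊆ Q.core r' :=
  fun _ hx ↦ ⟨((Q.mem_region_iff hr).1 hx).1,
    Metric.closedBall_subset_ball hrr ((Q.mem_region_iff hr).1 hx).2⟩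

/-- The coordinate sphere of half the radius of the patch. -/
def shell : Set M := Q.region (Q.R / 2) \ Q.core (Q.R / 2)

theorem isCompact_shell : IsCompact Q.shell :=
  (Q.isCompact_region Q.half_le).diff (Q.isOpen_core _)

variable [T2Space M]

/-- A causal curve that leaves a coordinate ball passes through the sphere. -/
theorem exists_exit {γ : ℝ → M} {a b : ℝ} (hγ : g.IsCausalCurve γ (Icc a b))
    (ha : γ a ∈ Q.core (Q.R / 2)) (hex : ¬ MapsTo γ (Icc a b) (Q.core (Q.R / 2))) :
    ∃ y ∈ Q.shell, g.CausalLE (Q.region (Q.R / 2)) (γ a) y ∧ g.CausalLE univ y (γ b) := by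
  have hT : IsCompact (Icc a b ∩ γ ⁻¹' (Q.core (Q.R / 2))ᶜ) :=
    isCompact_Icc.of_isClosed_subset
      (hγ.1.preimage_isClosed_of_isClosed isClosed_Icc (Q.isOpen_core _).isClosed_compl)
      inter_subset_left
  have hne : (Icc a b ∩ γ ⁻¹' (Q.core (Q.R / 2))ᶜ).Nonempty := by
    simp only [MapsTo] at hex
    push Not at hex
    obtain ⟨t, ht, ht'⟩ := hex
    exact ⟨t, ht, ht'⟩
  -- The first parameter outside the open ball; by continuity the curve is still in the closed ball
  -- there, hence on the sphere.
  obtain ⟨s, ⟨hs, hsO⟩, hmin⟩ := hT.exists_isLeast hne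
  have has : a < s := lt_of_le_of_ne hs.1 (by rintro rfl; exact hsO ha)
  have hbefore : MapsTo γ (Ico a s) (Q.region (Q.R / 2)) := fun t ht ↦ by
    refine Q.core_subset_region Q.half_le (by_contra fun hn ↦ ?_)
    exact (hmin ⟨⟨ht.1, ht.2.le.trans hs.2⟩, hn⟩).not_gt ht.2
  have hγs : g.IsCausalCurve γ (Icc a s) := PiecewiseC1With.mono hγ (Icc_subset_Icc_right hs.2)
  have hN : MapsTo γ (Icc a s) (Q.region (Q.R / 2)) := by
    have h := hbefore.closure_of_continuousOn (by rw [closure_Ico has.ne]; exact hγs.1)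
    rwa [closure_Ico has.ne, (Q.isCompact_region Q.half_le).isClosed.closure_eq] at h
  refine ⟨γ s, ⟨hN (right_mem_Icc.2 hs.1), hsO⟩, Spacetime.causalLE_of_Icc hs.1 hγs hN, ?_⟩
  exact Spacetime.causalLE_of_Icc hs.2 (PiecewiseC1With.mono hγ (Icc_subset_Icc_left hs.1))
    (mapsTo_univ _ _)

theorem causalLE_or_exit {a x : M} (ha : a ∈ Q.core (Q.R / 2)) (h : g.CausalLE univ a x) :
    g.CausalLE (Q.region (Q.R / 2)) a x ∨
      ∃ y ∈ Q.shell, g.CausalLE (Q.region (Q.R / 2)) a y ∧ g.CausalLE univ y x := by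
  rcases h with ⟨rfl, -⟩ | ⟨γ, hγ, -, rfl, rfl⟩
  · exact Or.inl (Or.inl ⟨rfl, Q.core_subset_region Q.half_le ha⟩)
  · by_cases hall : MapsTo γ (Icc 0 1) (Q.core (Q.R / 2))
    · exact Or.inl (Spacetime.causalLE_of_Icc zero_le_one hγ
        (hall.mono_right (Q.core_subset_region Q.half_le)))
    · exact Or.inr (Q.exists_exit hγ ha hall)

/-- The ends of causal curves that start near a point of a coordinate ball either converge along
an ultrafilter, or the curves leave the ball near a common point. -/
theorem exists_limit_or_exit {ι : Type*} {𝓖 : Ultrafilter ι} {a x : ι → M} {z : M}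
    (hz : z ∈ Q.core (Q.R / 2)) (ha : Tendsto a 𝓖 (𝓝 z))
    (h : ∀ᶠ i in 𝓖, g.CausalLE univ (a i) (x i)) :
    (∃ w, Tendsto x 𝓖 (𝓝 w) ∧ g.CausalLE univ z w) ∨
      ∃ y ∈ Q.shell, g.CausalLE univ z y ∧
        ∃ a' : ι → M, Tendsto a' 𝓖 (𝓝 y) ∧ ∀ᶠ i in 𝓖, g.CausalLE univ (a' i) (x i) := by
  have hcore : ∀ᶠ i in (𝓖 : Filter ι), a i ∈ Q.core (Q.R / 2) :=
    ha.eventually ((Q.isOpen_core _).mem_nhds hz)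
  have hor := (hcore.and h).mono fun i hi ↦ Q.causalLE_or_exit hi.1 hi.2
  rcases Ultrafilter.eventually_or.1 hor with h1 | h1
  · obtain ⟨w, -, hw⟩ := (Q.isCompact_region Q.half_le).exists_tendsto_of_ultrafilter
      (h1.mono fun i hi ↦ hi.target_mem)
    exact Or.inl ⟨w, hw, Q.causalLE_of_tendsto ha hw h1⟩
  · have : Nonempty M := ⟨z⟩
    obtain ⟨a', ha'⟩ := h1.choice
    obtain ⟨y, hy, hlim⟩ := Q.isCompact_shell.exists_tendsto_of_ultrafilter
      (ha'.mono fun i hi ↦ hi.1)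
    exact Or.inr ⟨y, hy, Q.causalLE_of_tendsto ha hlim (ha'.mono fun i hi ↦ hi.2.1), a', hlim,
      ha'.mono fun i hi ↦ hi.2.2⟩

end Patch

namespace Spacetime

variable [MeasurableSpace M] [BorelSpace M]

theorem mem_interior_of_mem_chronFuture {w x : M} (hw : w ∈ g.finiteFutureRegion)
    (h : x ∈ g.chronFuture w) : x ∈ interior g.finiteFutureRegion :=
  interior_maximal (fun _ hy ↦ mem_finiteFutureRegion_of_causalLE hw
    (causalLE_of_mem_chronFuture hy)) (g.isOpen_chronFuture w) h

/-- Some point `w` of 𝓑 lies chronologically before `x`, hence before `y`, and the open set `I⁺(w)`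
is contained in 𝓑. -/
theorem mem_interior_of_causalLE {x y : M} (hx : x ∈ interior g.finiteFutureRegion)
    (h : g.CausalLE univ x y) : y ∈ interior g.finiteFutureRegion := by
  obtain ⟨-, -, -, w, hw, hwx⟩ := g.exists_mem_chronFuture_near x
    (mem_interior_iff_mem_nhds.1 hx)
  exact mem_interior_of_mem_chronFuture hw (mem_chronFuture_of_chron_of_causalLE hwx h)

theorem vol_chronFuture_pos (g : Spacetime n M) (x : M) : 0 < g.vol (g.chronFuture x) := by
  obtain ⟨y, -, hy, -⟩ := g.exists_mem_chronFuture_near x univ_mem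
  exact g.vol_pos_of_isOpen (g.isOpen_chronFuture x) ⟨y, hy⟩

theorem joins_of_causalLE {U : Set M} {x y : M} (h : g.CausalLE U x y) (hne : x ≠ y) :
    Joins g.FutureCausal U x y := by
  rcases h with ⟨h, -⟩ | h
  · exact (hne h).elim
  · exact h

variable [T2Space M] [SecondCountableTopology M]

/-- A countable family of patches whose inner balls cover the manifold, with an index function
that is minimal. -/
theorem exists_patch_cover [Nonempty M] (g : Spacetime n M) :
    ∃ (c : ℕ → M) (Q : ∀ j, Patch g (c j)) (J : M → ℕ),
      (∀ x, x ∈ (Q (J x)).core ((Q (J x)).R / 4)) ∧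
      ∀ x j, x ∈ (Q j).core ((Q j).R / 4) → J x ≤ j := by
  classical
  choose Q _ using fun p : M ↦ g.exists_patch p univ_mem
  obtain ⟨s, hs, hcov⟩ := TopologicalSpace.countable_cover_nhds
    (f := fun p ↦ (Q p).core ((Q p).R / 4))
    fun p ↦ ((Q p).isOpen_core _).mem_nhds ((Q p).mem_core (by have := (Q p).R_pos; linarith))
  have hne : s.Nonempty := by
    rw [nonempty_iff_ne_empty]
    rintro rfl
    exact Set.empty_ne_univ (by simpa using hcov)
  obtain ⟨c, rfl⟩ := hs.exists_eq_range hne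
  have hex : ∀ x, ∃ j, x ∈ (Q (c j)).core ((Q (c j)).R / 4) := fun x ↦ by
    have : x ∈ ⋃ p ∈ range c, (Q p).core ((Q p).R / 4) := hcov ▸ mem_univ x
    simpa using this
  exact ⟨c, fun j ↦ Q (c j), fun x ↦ Nat.find (hex x), fun x ↦ Nat.find_spec (hex x),
    fun x j hj ↦ Nat.find_min' (hex x) hj⟩

/-- A sequence each of whose members lies outside the patch of smallest index around its
predecessor does not converge. -/
theorem not_tendsto_of_exit {c : ℕ → M} {Q : ∀ j, Patch g (c j)} {J : M → ℕ}
    (hJ : ∀ x, x ∈ (Q (J x)).core ((Q (J x)).R / 4))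
    (hmin : ∀ x j, x ∈ (Q j).core ((Q j).R / 4) → J x ≤ j) {z : ℕ → M}
    (hz : ∀ i, z (i + 1) ∉ (Q (J (z i))).core ((Q (J (z i))).R / 2)) (w : M) :
    ¬ Tendsto z atTop (𝓝 w) := by
  intro hw
  -- Near a limit `w` the minimal index is at most `J w`, so only finitely many patches occur. A
  -- patch used infinitely often has `w` in its closed quarter ball, so later members cannot leave
  -- its half ball.
  have hle : ∀ᶠ i in atTop, J (z i) ∈ Finset.range (J w + 1) :=
    (hw.eventually (((Q (J w)).isOpen_core _).mem_nhds (hJ w))).mono fun i hi ↦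
      Finset.mem_range.2 (Nat.lt_succ_of_le (hmin _ _ hi))
  have hev : ∀ m ∈ Finset.range (J w + 1), ∀ᶠ i in atTop, J (z i) ≠ m := by
    intro m _
    by_contra hfreq
    have hfreq : ∃ᶠ i in atTop, J (z i) = m := by simpa [Filter.Frequently] using hfreq
    have hR := (Q m).R_pos
    have hcl : w ∈ (Q m).region ((Q m).R / 4) := by
      refine ((Q m).isCompact_region (by linarith)).isClosed.mem_of_frequently_of_tendsto
        (hfreq.mono fun i hi ↦ ?_) hw
      subst hi
      exact (Q _).core_subset_region (by linarith) (hJ _)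
    have hin : ∀ᶠ i in atTop, z (i + 1) ∈ (Q m).core ((Q m).R / 2) :=
      (hw.comp (tendsto_add_atTop_nat 1)).eventually (((Q m).isOpen_core _).mem_nhds
        ((Q m).region_subset_core (by linarith) (by linarith) hcl))
    obtain ⟨i, hi, hi'⟩ := (hfreq.and_eventually hin).exists
    subst hi
    exact hz i hi'
  obtain ⟨i, hi, hi'⟩ := (hle.and ((Finset.eventually_all _).2 hev)).exists
  exact hi' _ hi rfl

/-- If the volumes of futures vanish along inextendible curves, then the ends of causal curves
that start near a point of the interior of `𝓑` and are bounded to the future converge along an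
ultrafilter. -/
theorem FutureVolumeVanishes.exists_limit (hv : g.FutureVolumeVanishes) {ι : Type*}
    {𝓖 : Ultrafilter ι} {a x : ι → M} {z q : M} (hz : z ∈ interior g.finiteFutureRegion)
    (ha : Tendsto a 𝓖 (𝓝 z)) (h : ∀ᶠ i in 𝓖, g.CausalLE univ (a i) (x i))
    (hq : ∀ᶠ i in 𝓖, g.CausalLE univ (x i) q) :
    ∃ w, Tendsto x 𝓖 (𝓝 w) ∧ g.CausalLE univ z w := by
  by_contra hno
  have : Nonempty M := ⟨z⟩
  have : LocallyCompactSpace M := ChartedSpace.locallyCompactSpace Eₙ M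
  have : TopologicalSpace.MetrizableSpace M := Manifold.metrizableSpace (𝓡 (n + 1)) M
  let _ : MetricSpace M := TopologicalSpace.metrizableSpaceMetric M
  obtain ⟨c, Q, J, hJ, hmin⟩ := g.exists_patch_cover
  -- A limit of points from which the `x i` are still reachable; this property passes from one exit
  -- point to the next.
  set S : M → Prop := fun y ↦
    ∃ a' : ι → M, Tendsto a' 𝓖 (𝓝 y) ∧ ∀ᶠ i in 𝓖, g.CausalLE univ (a' i) (x i) with hS
  have hstep : ∀ y, S y → g.CausalLE univ z y → ∃ y' ∈ (Q (J y)).shell, g.CausalLE univ y y' ∧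
      S y' := by
    rintro y ⟨a', ha', hx'⟩ hzy
    have hR := (Q (J y)).R_pos
    rcases (Q (J y)).exists_limit_or_exit ((Q (J y)).region_subset_core (by linarith)
      (by linarith) ((Q (J y)).core_subset_region (by linarith) (hJ y))) ha' hx' with
      ⟨w, hw, hyw⟩ | hy'
    · exact (hno ⟨w, hw, hzy.trans hyw⟩).elim
    · exact hy'
  -- The shadow chain must start in 𝓑 strictly before `z`; this is where `z` has to be interior.
  obtain ⟨-, -, -, z₀, ⟨hz₀, hz₀d⟩, hz₀z⟩ := g.exists_mem_chronFuture_near z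
    (inter_mem (mem_interior_iff_mem_nhds.1 hz) (Metric.ball_mem_nhds z one_pos))
  -- The first components are the exit points. The second components are their shadows,
  -- chronologically before them at distance below `1 / (i + 1)`, so the two sequences can only
  -- converge together.
  obtain ⟨f, hf0, hfP, hfR⟩ := exists_seq_of_step (α := M × M)
    (P := fun i u ↦ S u.1 ∧ g.CausalLE univ z u.1 ∧ u.1 ∈ g.chronFuture u.2 ∧
      dist u.2 u.1 < 1 / ((i : ℝ) + 1))
    (R := fun u u' ↦ u'.1 ∉ (Q (J u.1)).core ((Q (J u.1)).R / 2) ∧ u'.2 ∈ g.chronFuture u.2)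
    (a₀ := (z, z₀)) ⟨⟨a, ha, h⟩, Or.inl ⟨rfl, mem_univ _⟩, hz₀z, by simpa using hz₀d⟩ (by
      rintro i ⟨y, y₀⟩ ⟨hy, hzy, hyy, -⟩
      obtain ⟨y', hy', hyy', hSy'⟩ := hstep y hy hzy
      have hpos : (0 : ℝ) < 1 / (((i + 1 : ℕ) : ℝ) + 1) := by positivity
      obtain ⟨-, -, -, y₁, ⟨hy₁, hy₁d⟩, hy₁y⟩ := g.exists_mem_chronFuture_near y'
        (inter_mem ((g.isOpen_chronFuture y₀).mem_nhds
          (mem_chronFuture_of_chron_of_causalLE hyy hyy')) (Metric.ball_mem_nhds y' hpos))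
      exact ⟨(y', y₁), ⟨hSy', hzy.trans hyy', hy₁y, hy₁d⟩, hy'.2, hy₁⟩)
  have hlim : ¬ ∃ w, Tendsto (fun i ↦ (f i).2) atTop (𝓝 w) := by
    rintro ⟨w, hw⟩
    refine not_tendsto_of_exit hJ hmin (z := fun i ↦ (f i).1) (fun i ↦ (hfR i).1) w ?_
    refine (tendsto_iff_of_dist ?_).1 hw
    exact squeeze_zero (fun _ ↦ dist_nonneg) (fun i ↦ (hfP i).2.2.2.le)
      tendsto_one_div_add_atTop_nhds_zero_nat
  have hchain := hv.tendsto_chain (z := fun i ↦ (f i).2)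
    (fun i ↦ joins_causal_of_mem_chronFuture (hfR i).2) (by rw [hf0]; exact hz₀) hlim
  refine (g.vol_chronFuture_pos q).not_ge (ge_of_tendsto' hchain fun i ↦ measure_mono ?_)
  obtain ⟨⟨a', ha', hx'⟩, -, hchron, -⟩ := hfP i
  -- The future of the shadow point is open and contains the limit of `a'`, hence some `a' k ≤ x k ≤
  -- q`.
  obtain ⟨k, ⟨hk1, hk2⟩, hk3⟩ := (((ha'.eventually
    ((g.isOpen_chronFuture (f i).2).mem_nhds hchron)).and hx').and hq).exists
  exact (causalLE_of_mem_chronFuture (mem_chronFuture_of_chron_of_causalLE hk1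
    (hk2.trans hk3))).chronFuture_subset

/-- If the volumes of futures vanish along inextendible curves, then there are no closed causal
curves through points of `𝓑`. -/
theorem FutureVolumeVanishes.causalLE_antisymm (hv : g.FutureVolumeVanishes) {x y : M}
    (hx : x ∈ g.finiteFutureRegion) (hxy : g.CausalLE univ x y) (hyx : g.CausalLE univ y x) :
    x = y := by
  by_contra hne
  -- Going round the loop forever gives a chain without limit that returns to `x`, whose future has
  -- fixed positive volume.
  set z : ℕ → M := fun i ↦ if Even i then x else y with hz
  have heven : ∀ k, z (2 * k) = x := fun k ↦ by simp [hz]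
  have hodd : ∀ k, z (2 * k + 1) = y := fun k ↦ by simp [hz]
  have hto : Tendsto (fun k : ℕ ↦ 2 * k) atTop atTop :=
    tendsto_id.const_mul_atTop' two_pos
  have hchain := hv.tendsto_chain (z := z) (fun i ↦ by
    by_cases hi : Even i
    · simpa [hz, hi, Nat.even_add_one] using joins_of_causalLE hxy hne
    · simpa [hz, hi, Nat.even_add_one] using joins_of_causalLE hyx (Ne.symm hne))
    (by simpa [hz] using hx) (by
      rintro ⟨w, hw⟩
      have h1 := hw.comp hto
      have h2 := hw.comp ((tendsto_add_atTop_nat 1).comp hto)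
      simp only [Function.comp_def, heven, hodd] at h1 h2
      exact hne ((tendsto_nhds_unique tendsto_const_nhds h1).trans
        (tendsto_nhds_unique tendsto_const_nhds h2).symm))
  have h := hchain.comp hto
  simp only [Function.comp_def, heven] at h
  exact (g.vol_chronFuture_pos x).ne (tendsto_nhds_unique h tendsto_const_nhds)

theorem FutureVolumeVanishes.isCompact_diamond (hv : g.FutureVolumeVanishes) {p : M}
    (hp : p ∈ interior g.finiteFutureRegion) (q : M) :
    IsCompact {x : M | g.CausalLE (interior g.finiteFutureRegion) p x ∧
      g.CausalLE (interior g.finiteFutureRegion) x q} := by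
  refine isCompact_iff_ultrafilter_le_nhds.2 fun 𝓖 h𝓖 ↦ ?_
  have hD := le_principal_iff.1 h𝓖
  have h1 : ∀ᶠ x in (𝓖 : Filter M), g.CausalLE univ p x :=
    mem_of_superset hD fun x hx ↦ hx.1.mono (subset_univ _)
  have h2 : ∀ᶠ x in (𝓖 : Filter M), g.CausalLE univ x q :=
    mem_of_superset hD fun x hx ↦ hx.2.mono (subset_univ _)
  obtain ⟨w, hw, hpw⟩ := hv.exists_limit (a := fun _ ↦ p) (x := id) hp tendsto_const_nhds h1 h2
  have hwU := mem_interior_of_causalLE hp hpw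
  -- The second use has moving starting points tending to `w` and constant ends, which gives `w ≤
  -- q`.
  obtain ⟨q', hq', hwq⟩ := hv.exists_limit (a := id) (x := fun _ ↦ q) hwU hw h2
    (Eventually.of_forall fun _ ↦ Or.inl ⟨rfl, mem_univ q⟩)
  obtain rfl := tendsto_nhds_unique tendsto_const_nhds hq'
  have hfut : ∀ x ∈ interior g.finiteFutureRegion, ∀ y, g.CausalLE univ x y →
      y ∈ interior g.finiteFutureRegion := fun x hx y h ↦ mem_interior_of_causalLE hx h
  exact ⟨w, ⟨CausalLE.restrict hfut hp hpw, CausalLE.restrict hfut hwU hwq⟩, hw⟩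

/-- Curves that start and end ever closer to `p` but leave a fixed ball cross its sphere; their exit
points converge to some `w` on the sphere with `p ≤ w ≤ p`, which antisymmetry excludes. -/
theorem FutureVolumeVanishes.stronglyCausalOn (hv : g.FutureVolumeVanishes) :
    g.StronglyCausalOn (interior g.finiteFutureRegion) := by
  intro p hp W hW
  by_contra hcon
  push Not at hcon
  obtain ⟨Q, hQ⟩ := g.exists_patch p hW
  have hR := Q.R_pos
  have hcW : Q.core (Q.R / 2) ⊆ W := fun x hx ↦ by
    have := hQ (Metric.ball_subset_closedBall (Metric.ball_subset_ball Q.half_le hx.2))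
    rwa [(chartAt Eₙ p).left_inv hx.1] at this
  have hpc : p ∈ Q.core (Q.R / 2) := Q.mem_core (by linarith)
  have hcp : Q.core (Q.R / 2) ∈ 𝓝 p := (Q.isOpen_core _).mem_nhds hpc
  obtain ⟨V, hV⟩ := (𝓝 p).exists_antitone_basis
  have hex : ∀ k : ℕ, ∃ a b y : M, a ∈ V k ∧ b ∈ V k ∧ y ∈ Q.shell ∧
      g.CausalLE (Q.region (Q.R / 2)) a y ∧ g.CausalLE univ y b := by
    intro k
    obtain ⟨γ, a, b, -, hγ, -, ha, hb, hesc⟩ := hcon (V k ∩ Q.core (Q.R / 2))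
      (inter_mem (hV.mem k) hcp) (inter_subset_right.trans hcW)
    obtain ⟨y, hy, h1, h2⟩ := Q.exists_exit hγ ha.2 fun h ↦ hesc (h.mono_right hcW)
    exact ⟨γ a, γ b, y, ha.1, hb.1, hy, h1, h2⟩
  choose a b y ha hb hy hay hyb using hex
  set 𝓖 : Ultrafilter ℕ := hyperfilter ℕ
  have h𝓖 : (𝓖 : Filter ℕ) ≤ atTop := Nat.hyperfilter_le_atTop
  have ha' : Tendsto a 𝓖 (𝓝 p) := (hV.tendsto ha).mono_left h𝓖
  have hb' : Tendsto b 𝓖 (𝓝 p) := (hV.tendsto hb).mono_left h𝓖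
  obtain ⟨w, hw, hyw⟩ := Q.isCompact_shell.exists_tendsto_of_ultrafilter
    (𝓖 := 𝓖) (Eventually.of_forall hy)
  have hpw : g.CausalLE univ p w := Q.causalLE_of_tendsto ha' hyw (Eventually.of_forall hay)
  -- A point chronologically after `p` bounds the returning ends `b k` to the future, as
  -- `exists_limit` requires.
  obtain ⟨q, -, hq, -⟩ := g.exists_mem_chronFuture_near p univ_mem
  obtain ⟨p', hp', hwp⟩ := hv.exists_limit (mem_interior_of_causalLE hp hpw) hyw
    (Eventually.of_forall hyb) (q := q) ((hb'.eventually
      ((g.isOpen_chronPast q).mem_nhds hq)).mono fun i hi ↦ causalLE_of_mem_chronFuture hi)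
  obtain rfl := tendsto_nhds_unique hb' hp'
  obtain rfl := hv.causalLE_antisymm (interior_subset hp) hpw hwp
  exact hw.2 hpc

theorem globallyHyperbolicOn_interior_of_futureVolumeVanishes (hv : g.FutureVolumeVanishes) :
    g.GloballyHyperbolicOn (interior g.finiteFutureRegion) :=
  ⟨hv.stronglyCausalOn, fun _ hp q _ ↦ hv.isCompact_diamond hp q⟩

end Spacetime

end HyperbolicOfVanishing

theorem mainTheorem5 {n : ℕ} {M : Type*} [TopologicalSpace M] [T2Space M]
    [SecondCountableTopology M] [ChartedSpace (EuclideanSpace ℝ (Fin (n + 1))) M]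
    [IsManifold (𝓡 (n + 1)) ∞ M] [MeasurableSpace M] [BorelSpace M] (g : Spacetime n M) :
    (IsOpen g.finiteFutureRegion →
      (g.FutureVolumeVanishes ↔ g.GloballyHyperbolicOn g.finiteFutureRegion)) ∧
    (g.GloballyHyperbolicOn g.finiteFutureRegion → g.FutureVolumeVanishes) ∧
    (g.FutureVolumeVanishes → g.GloballyHyperbolicOn (interior g.finiteFutureRegion)) := by
  refine ⟨fun hopen ↦ ⟨fun hv ↦ ?_, Spacetime.futureVolumeVanishes_of_globallyHyperbolic⟩,
    Spacetime.futureVolumeVanishes_of_globallyHyperbolic,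
    Spacetime.globallyHyperbolicOn_interior_of_futureVolumeVanishes⟩
  have := Spacetime.globallyHyperbolicOn_interior_of_futureVolumeVanishes hv
  rwa [hopen.interior_eq] at this
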